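/- For $f\in L^2(\mathbb R)$ let $\hat f(\xi)=(2\pi)^{-1/2}\int e^{-ix\xi}f(x)\,dx$ (in the Plancherel sense), let $\langle\xi\rangle=1+|\xi|$, and let $G^{\sigma,s}(\mathbb R)$ be the space of all $f\in L^2(\mathbb R)$ with $$\|f\|_{G^{\sigma,s}}=\big\|e^{\sigma|\xi|}\langle\xi\rangle^s\hat f(\xi)\big\|_{L^2_\xi}<\infty .$$ For $w\in L^2(\mathbb R^2)$ let $\hat w(\xi,\tau)$ be the space-time Fourier transform and let $Y^{\sigma,s,b}$ be the space of all such $w$ with $$\|w\|_{Y^{\sigma,s,b}}=\big\|e^{\sigma|\xi|}\langle\xi\rangle^s\langle\tau-\xi^3\rangle^b\,\hat w(\xi,\tau)\big\|_{L^2_{\xi,\tau}}<\infty$$ (for $\sigma,s,b\ge 0$ this is the closure of the Schwartz space under this norm). For $T>0$ let $Y_T^{\sigma,s,b}$ be the corresponding space restricted to $\mathbb R\times(-T,T)$, with norm $\|u\|_{Y_T^{\sigma,s,b}}=\inf\{\|w\|_{Y^{\sigma,s,b}} : w=u \text{ on } \mathbb R\times(-T,T)\}$. Theorem. There is $b\in(\tfrac12,1)$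 such that for every $s\ge\tfrac14$ there is a function $T_0:[0,\infty)\to(0,\infty)$ with the following property. Let $\mu\in\{1,-1\}$, let $\sigma>0$, let $u_0\in G^{\sigma,s}(\mathbb R)$ be real-valued, and put $T=T_0(\|u_0\|_{G^{\sigma,s}})$. Then: (i) There is exactly one real-valued solution $u\in C([-T,T];G^{\sigma,s}(\mathbb R))\cap Y_T^{\sigma,s,b}$ of $$\partial_tu+\partial_x^3u+\mu u^2\partial_xu=0,\qquad u(x,0)=u_0(x),$$ on $\mathbb R\times[-T,T]$; the equation holds at every point of $\mathbb R\times[-T,T]$, with one-sided time derivatives at $t=\pm T$. (ii) For every $t\in[-T,T]$ the function $u(\cdot,t)$ extends holomorphically to the strip $\{x+iy:|y|<\sigma\}$. (iii) The data-to-solution map is locally Lipschitz: there are $\delta>0$ and $L\ge0$ such that for every real-valued $v_0$ with $\|v_0-u_0\|_{G^{\sigma,s}}<\delta$ the initial value problem with datum $v_0$ has a solution in $C([-T,T];G^{\sigma,s}(\mathbb R))\cap Y_T^{\sigma,s,b}$, and any two such solutions $v,w$ with data $v_0,w_0$ in this ball satisfy $$\sup_{|t|\le T}\|v(t)-w(t)\|_{G^{\sigma,s}}\le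 L\|v_0-w_0\|_{G^{\sigma,s}},\qquad \|v-w\|_{Y_T^{\sigma,s,b}}\le L\|v_0-w_0\|_{G^{\sigma,s}}.$$ -/

import Mathlib

open MeasureTheory Set Filter Topology
open scoped FourierTransform ENNReal NNReal

namespace MKdV

noncomputable section

/-- The bracket `⟨ξ⟩ = 1 + |ξ|`. -/
def bracket (ξ : ℝ) : ℝ := 1 + |ξ|

/-- The Gevrey norm `‖f‖_{G^{σ,s}} = ‖e^{σ|ξ|} ⟨ξ⟩^s f̂(ξ)‖_{L²_ξ}` of (the `L²` class of) a real
function `f`, equal to `∞` if `f` is not in `L²(ℝ)`. In the convention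
`f̂(ξ) = (2π)^{-1/2} ∫ e^{-ixξ} f(x) dx` the frequency is `ξ = 2πη`, where `η` is the frequency of the
Plancherel-Fourier transform `𝓕` on `L²`; with this constant the `L²` norms in `ξ` and in `η` agree. -/
def gevreyENorm (σ s : ℝ) (f : ℝ → ℝ) : ℝ≥0∞ :=
  ⨅ hf : MemLp (fun x => (f x : ℂ)) 2 (volume : Measure ℝ),
    eLpNorm (fun η : ℝ =>
      ((Real.exp (σ * |2 * Real.pi * η|) * bracket (2 * Real.pi * η) ^ s : ℝ) : ℂ) *
        (𝓕 (hf.toLp (fun x => (f x : ℂ))) : Lp ℂ 2 (volume : Measure ℝ)) η) 2 volume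

/-- `f` is a real-valued element of `G^{σ,s}(ℝ)`. -/
def MemGevrey (σ s : ℝ) (f : ℝ → ℝ) : Prop := gevreyENorm σ s f < ∞

/-- The space-time plane; `z 0` is the space variable `x` and `z 1` is the time variable `t`. -/
abbrev Plane : Type := EuclideanSpace ℝ (Fin 2)

/-- The Gevrey-Bourgain norm
`‖w‖_{Y^{σ,s,b}} = ‖e^{σ|ξ|} ⟨ξ⟩^s ⟨τ - ξ³⟩^b ŵ(ξ,τ)‖_{L²_{ξ,τ}}` of `w ∈ L²(ℝ²)`, with
`ξ = 2π ζ₀`, `τ = 2π ζ₁`. For `σ, s, b ≥ 0` the closure of the Schwartz functions under this norm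
is exactly the set of all `w ∈ L²(ℝ²)` for which it is finite. -/
def bourgainENorm (σ s b : ℝ) (w : Lp ℂ 2 (volume : Measure Plane)) : ℝ≥0∞ :=
  eLpNorm (fun ζ : Plane =>
    ((Real.exp (σ * |2 * Real.pi * ζ 0|) * bracket (2 * Real.pi * ζ 0) ^ s *
        bracket (2 * Real.pi * ζ 1 - (2 * Real.pi * ζ 0) ^ 3) ^ b : ℝ) : ℂ) *
      (𝓕 w : Lp ℂ 2 (volume : Measure Plane)) ζ) 2 volume

/-- The norm of the restricted space `Y_T^{σ,s,b}`: the infimum of `‖w‖_{Y^{σ,s,b}}` over all `w`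
that agree with `u` on `ℝ × (-T, T)`; it is `∞` if there is no such `w` of finite norm. The value
of `u` at time `t` and position `x` is `u t x`. -/
def restrictedENorm (σ s b T : ℝ) (u : ℝ → ℝ → ℝ) : ℝ≥0∞ :=
  ⨅ (w : Lp ℂ 2 (volume : Measure Plane))
    (_ : ∀ᵐ z : Plane, z 1 ∈ Ioo (-T) T → w z = (u (z 1) (z 0) : ℂ)), bourgainENorm σ s b w

/-- `u ∈ Y_T^{σ,s,b}`. -/
def MemRestricted (σ s b T : ℝ) (u : ℝ → ℝ → ℝ) : Prop := restrictedENorm σ s b T u < ∞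

/-- `u ∈ C([-T,T]; G^{σ,s}(ℝ))`. -/
def ContinuousInGevrey (σ s T : ℝ) (u : ℝ → ℝ → ℝ) : Prop :=
  (∀ t ∈ Icc (-T) T, MemGevrey σ s (u t)) ∧
    ∀ t ∈ Icc (-T) T,
      Tendsto (fun r => gevreyENorm σ s (u r - u t)) (𝓝[Icc (-T) T] t) (𝓝 0)

/-- `u` solves `∂ₜu + ∂ₓ³u + μ u² ∂ₓu = 0`, `u(0) = u₀` on `[-T,T] × ℝ`. The equation holds at
every point, with one-sided time derivatives at `t = ±T`; the datum `u₀` is an `L²` class. -/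
structure SolvesIVP (μ T : ℝ) (u₀ : ℝ → ℝ) (u : ℝ → ℝ → ℝ) : Prop where
  contDiff : ∀ t ∈ Icc (-T) T, ContDiff ℝ 3 (u t)
  equation : ∀ t ∈ Icc (-T) T, ∀ x : ℝ, ∃ ut : ℝ,
    HasDerivWithinAt (fun r => u r x) ut (Icc (-T) T) t ∧
      ut + iteratedDeriv 3 (u t) x + μ * (u t x) ^ 2 * deriv (u t) x = 0
  initial : u 0 =ᵐ[volume] u₀

/-- `u` is a solution on `[-T,T]` in the class `C([-T,T]; G^{σ,s}(ℝ)) ∩ Y_T^{σ,s,b}`. -/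
structure IsSolution (μ σ s b T : ℝ) (u₀ : ℝ → ℝ) (u : ℝ → ℝ → ℝ) : Prop where
  solves : SolvesIVP μ T u₀ u
  continuous : ContinuousInGevrey σ s T u
  bourgain : MemRestricted σ s b T u

/-- `f` extends holomorphically to the strip `{x + iy : |y| < σ}`. -/
def ExtendsToStrip (σ : ℝ) (f : ℝ → ℝ) : Prop :=
  ∃ F : ℂ → ℂ, DifferentiableOn ℂ F {z : ℂ | |z.im| < σ} ∧ ∀ x : ℝ, F (x : ℂ) = (f x : ℂ)

end

end MKdV

namespace MKdV

/-! The solution is built on the Fourier side. Localized in time, the initial value problem becomes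
the fixed point equation `F = freeTerm φ + duhamelTerm T c F` for the space-time transform `F` of
`u`, posed in the L² space with weight e^{σ|ξ|}⟨ξ⟩^s L^{9/16}, where L is the modulation bracket.
Hence b = 9/16.

The core is the trilinear estimate for ∂ₓ(u³). For s ≥ 1/4 the weight e^{σ|ξ|}⟨ξ⟩^{s-1/4} is
submultiplicative with constant 1 (`gevreyWeight_add_le`), so it cancels and no constant depends on
σ; this is why the existence time depends only on the size of the datum. What remains is the case s
= 1/4, σ = 0. The derivatives are distributed so that the output and one input carry +1/2 while the
two other inputs carry -1/4 (`abs_mul_gevreyWeight_le`). In dual form this is two applications of a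
single bilinear L² estimate, `exists_bilinear_le`. That estimate follows from Cauchy-Schwarz and the
resonance identity: with input frequencies ξ/2 ± m, the modulation is a quadratic polynomial in m
with no linear term, and the resulting kernel is integrable in m uniformly in all parameters
(`exists_lintegral_resonanceKernel_le`). Small output frequency with large modulation is treated
separately, by confining one frequency to a short interval.

The Duhamel operator takes L^{-3/8} to L^{9/16} with a gain T^{1 - 9/16 - 3/8} = T^{1/16}
(`exists_duhamelKernel_le`). Together with the trilinear estimate this makes the cubic map a
contraction for small T, and the solution depends on the datum in a Lipschitz way
(`exists_amplitude`).

Since σ > 0, the amplitude `F` is integrable against every polynomial in the space frequency. For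
|t| ≤ T the cutoffs equal 1, so the integral equation can be differentiated in t and x under the
integral sign, and the differential equation holds pointwise. The exponential weight also gives the
holomorphic extension. The solution is real because the conjugate reflection of `F` solves the same
equation in the same ball.

Uniqueness among all solutions does not come from the contraction. Functions in C([-T,T]; G^{σ,s})
that solve the equation are smooth with bounded derivatives, and the L² norm of the difference of
two of them obeys a Gronwall inequality (`EnergyClass.eq`). Every solution is therefore the
constructed one, and the Lipschitz bounds for amplitudes pass to all solutions. -/

/-! ### Cauchy-Schwarz and duality for nonnegative integrals. -/

theorem sq_lintegral_mul_le {α : Type*} [MeasurableSpace α] (ν : Measure α) {f g : α → ℝ≥0∞}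
    (hf : AEMeasurable f ν) (hg : AEMeasurable g ν) :
    (∫⁻ a, f a * g a ∂ν) ^ 2 ≤ (∫⁻ a, f a ^ 2 ∂ν) * ∫⁻ a, g a ^ 2 ∂ν := by
  have h := ENNReal.lintegral_mul_le_Lp_mul_Lq ν
    (show (2 : ℝ).HolderConjugate 2 from Real.HolderConjugate.two_two) hf hg
  simp only [ENNReal.rpow_two, Pi.mul_apply] at h
  calc _ ≤ ((∫⁻ a, f a ^ 2 ∂ν) ^ (1 / 2 : ℝ) * (∫⁻ a, g a ^ 2 ∂ν) ^ (1 / 2 : ℝ)) ^ 2 := by gcongr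
    _ = _ := by
      rw [mul_pow, ← ENNReal.rpow_natCast, ← ENNReal.rpow_natCast, ← ENNReal.rpow_mul,
        ← ENNReal.rpow_mul]
      norm_num

/-- Schur-type bound for a bilinear form whose kernel is square integrable in one variable. -/
theorem sq_lintegral_kernel_le {α β : Type*} [MeasurableSpace α] [MeasurableSpace β]
    (ν : Measure α) (ρ : Measure β) [SFinite ρ] {K Q : α → β → ℝ≥0∞} {P : α → ℝ≥0∞} {C : ℝ≥0∞}
    (hK : Measurable (Function.uncurry K)) (hQ : Measurable (Function.uncurry Q))
    (hP : Measurable P) (hC : ∀ a, ∫⁻ b, K a b ^ 2 ∂ρ ≤ C) :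
    (∫⁻ a, ∫⁻ b, K a b * (P a * Q a b) ∂ρ ∂ν) ^ 2 ≤
      C * (∫⁻ a, P a ^ 2 ∂ν) * ∫⁻ a, ∫⁻ b, Q a b ^ 2 ∂ρ ∂ν := by
  have hKQ : Measurable fun a => ∫⁻ b, K a b * Q a b ∂ρ :=
    Measurable.lintegral_prod_right' (f := fun z : α × β => K z.1 z.2 * Q z.1 z.2) (hK.mul hQ)
  have hQ2 : Measurable fun a => ∫⁻ b, Q a b ^ 2 ∂ρ :=
    Measurable.lintegral_prod_right' (f := fun z : α × β => Q z.1 z.2 ^ 2) (hQ.pow_const 2)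
  have hKa : ∀ a, Measurable (K a) := fun a => hK.comp measurable_prodMk_left
  have hQa : ∀ a, Measurable (Q a) := fun a => hQ.comp measurable_prodMk_left
  have h1 : ∀ a, ∫⁻ b, K a b * (P a * Q a b) ∂ρ = P a * ∫⁻ b, K a b * Q a b ∂ρ := by
    intro a
    rw [← lintegral_const_mul (P a) (f := fun b => K a b * Q a b) ((hKa a).mul (hQa a))]
    exact lintegral_congr fun b => by ring
  simp_rw [h1]
  -- Cauchy-Schwarz is applied in `a` with `P` split off, then in `b` for fixed `a`, where `hC`
  -- bounds the kernel.
  calc _ ≤ (∫⁻ a, P a ^ 2 ∂ν) * ∫⁻ a, (∫⁻ b, K a b * Q a b ∂ρ) ^ 2 ∂ν :=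
        sq_lintegral_mul_le ν hP.aemeasurable hKQ.aemeasurable
    _ ≤ (∫⁻ a, P a ^ 2 ∂ν) * ∫⁻ a, C * ∫⁻ b, Q a b ^ 2 ∂ρ ∂ν := by
        gcongr with a
        exact (sq_lintegral_mul_le ρ (hKa a).aemeasurable (hQa a).aemeasurable).trans
          (by gcongr; exact hC a)
    _ = _ := by rw [lintegral_const_mul _ hQ2]; ring

/-- Converse of the Cauchy-Schwarz inequality. -/
theorem lintegral_sq_le_of_forall {α : Type*} [MeasurableSpace α] (ν : Measure α) [SigmaFinite ν]
    {H : α → ℝ≥0∞} (hH : Measurable H) {C : ℝ≥0∞}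
    (h : ∀ g : α → ℝ≥0∞, Measurable g → (∫⁻ a, H a * g a ∂ν) ^ 2 ≤ C * ∫⁻ a, g a ^ 2 ∂ν) :
    ∫⁻ a, H a ^ 2 ∂ν ≤ C := by
  classical
  -- The test functions are truncations of `H` in height and in support, so that their square
  -- integrals are finite and can be cancelled; Fatou's lemma removes the truncation.
  let g : ℕ → α → ℝ≥0∞ := fun n => (spanningSets ν n).indicator fun a => min (H a) n
  have hgm : ∀ n, Measurable (g n) := fun n =>
    (hH.min measurable_const).indicator (measurableSet_spanningSets ν n)
  have hgH : ∀ n a, g n a ≤ H a := fun n a =>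
    (indicator_le_self _ _ a).trans (min_le_left _ _)
  have hgn : ∀ n, ∫⁻ a, g n a ^ 2 ∂ν ≤ C := by
    intro n
    have hfin : ∫⁻ a, g n a ^ 2 ∂ν ≠ ∞ := by
      have : ∫⁻ a, g n a ^ 2 ∂ν ≤ ∫⁻ a, (spanningSets ν n).indicator (fun _ => (n : ℝ≥0∞) ^ 2) a ∂ν := by
        refine lintegral_mono fun a => ?_
        by_cases ha : a ∈ spanningSets ν n
        · simp only [g, indicator_of_mem ha]; gcongr; exact min_le_right _ _
        · simp [g, indicator_of_notMem ha]
      refine ne_top_of_le_ne_top ?_ this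
      rw [lintegral_indicator_const (measurableSet_spanningSets ν n)]
      exact ENNReal.mul_ne_top (by finiteness) (measure_spanningSets_lt_top ν n).ne
    -- Because `g n ≤ H`, the square of `g n` is at most `H * g n`, and the hypothesis applies with
    -- `g n` as test function.
    have h2 : (∫⁻ a, g n a ^ 2 ∂ν) ^ 2 ≤ C * ∫⁻ a, g n a ^ 2 ∂ν := by
      refine le_trans ?_ (h (g n) (hgm n))
      gcongr with a
      rw [sq]; gcongr; exact hgH n a
    rcases eq_or_ne (∫⁻ a, g n a ^ 2 ∂ν) 0 with h0 | h0
    · rw [h0]; exact zero_le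
    · rw [sq] at h2
      exact (ENNReal.mul_le_mul_iff_left h0 hfin).1 h2
  have hlim : ∀ a, Tendsto (fun n => g n a ^ 2) atTop (𝓝 (H a ^ 2)) := by
    intro a
    have h1 : Tendsto (fun n : ℕ => min (H a) (n : ℝ≥0∞)) atTop (𝓝 (H a)) := by
      simpa using (tendsto_const_nhds (x := H a)).min ENNReal.tendsto_nat_nhds_top
    have h2 : Tendsto (fun n => g n a) atTop (𝓝 (H a)) := by
      refine h1.congr' ?_
      obtain ⟨N, hN⟩ := mem_iUnion.1 ((iUnion_spanningSets ν).symm ▸ mem_univ a :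
        a ∈ ⋃ i, spanningSets ν i)
      filter_upwards [eventually_ge_atTop N] with n hn
      simp only [g, indicator_of_mem (monotone_spanningSets ν hn hN)]
    exact ENNReal.Tendsto.pow h2
  calc ∫⁻ a, H a ^ 2 ∂ν = ∫⁻ a, liminf (fun n => g n a ^ 2) atTop ∂ν :=
        lintegral_congr fun a => ((hlim a).liminf_eq).symm
    _ ≤ liminf (fun n => ∫⁻ a, g n a ^ 2 ∂ν) atTop :=
        lintegral_liminf_le fun n => (hgm n).pow_const 2
    _ ≤ C := by
        refine (liminf_le_liminf (v := fun _ => C) (Eventually.of_forall hgn)).trans ?_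
        simp

/-! ### The bracket and integrals over the line. -/

theorem one_le_bracket (x : ℝ) : 1 ≤ bracket x := by simp [bracket]

theorem bracket_pos (x : ℝ) : 0 < bracket x := zero_lt_one.trans_le (one_le_bracket x)

theorem bracket_neg (x : ℝ) : bracket (-x) = bracket x := by simp [bracket]

theorem bracket_add_le (x y : ℝ) : bracket (x + y) ≤ bracket x * bracket y := by
  unfold bracket
  nlinarith [abs_add_le x y, mul_nonneg (abs_nonneg x) (abs_nonneg y)]

@[fun_prop]
theorem continuous_bracket : Continuous bracket := by unfold bracket; fun_prop

@[fun_prop]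
theorem measurable_bracket : Measurable bracket := continuous_bracket.measurable

theorem lintegral_bracket_rpow_lt_top {p : ℝ} (hp : 1 < p) :
    ∫⁻ x, ENNReal.ofReal (bracket x ^ (-p)) < ∞ := by
  have h := integrable_one_add_norm (E := ℝ) (μ := volume) (r := p) (by simpa using hp)
  exact h.lintegral_lt_top

theorem ofReal_abs_mul_lintegral_comp_mul {f : ℝ → ℝ≥0∞} (hf : Measurable f) {r : ℝ}
    (hr : r ≠ 0) : ENNReal.ofReal |r| * ∫⁻ y, f (r * y) = ∫⁻ y, f y := by
  conv_rhs => rw [← Real.smul_map_volume_mul_left hr]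
  rw [lintegral_smul_measure, lintegral_map hf (measurable_const_mul r), smul_eq_mul]

/-- On each half-line |m| is ±m, and translation and scaling reduce both pieces to the integral of
`φ`. The bound is uniform in `r` and `a`, which is what makes the resonance kernel uniformly
integrable. -/
theorem lintegral_comp_sub_abs_le {φ : ℝ → ℝ≥0∞} (hφ : Measurable φ) {r : ℝ} (hr : 0 < r)
    (a : ℝ) : ∫⁻ m, ENNReal.ofReal r * φ (r * (|m| - a)) ≤ 2 * ∫⁻ y, φ y := by
  have hsc : ENNReal.ofReal r * ∫⁻ y, φ (r * y) = ∫⁻ y, φ y := by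
    simpa [abs_of_pos hr] using ofReal_abs_mul_lintegral_comp_mul hφ hr.ne'
  have hm : Measurable fun m : ℝ => φ (r * (m - a)) := by fun_prop
  have h2 : ∫⁻ m, φ (r * (m - a)) = ∫⁻ y, φ (r * y) :=
    lintegral_sub_right_eq_self (fun y => φ (r * y)) a
  have h3 : ∫⁻ m, φ (r * (-m - a)) = ∫⁻ y, φ (r * y) := by
    rw [← h2]; exact lintegral_neg_eq_self (fun m => φ (r * (m - a)))
  calc ∫⁻ m, ENNReal.ofReal r * φ (r * (|m| - a))
      ≤ ∫⁻ m, ENNReal.ofReal r * (φ (r * (m - a)) + φ (r * (-m - a))) := by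
        refine lintegral_mono fun m => ?_
        gcongr
        rcases abs_choice m with h | h <;> rw [h]
        · exact le_self_add
        · exact le_add_self
    _ = 2 * ∫⁻ y, φ y := by
        rw [lintegral_const_mul' _ _ ENNReal.ofReal_ne_top, lintegral_add_left hm, h2, h3, mul_add,
          hsc, two_mul]

theorem lintegral_abs_rpow_indicator_lt_top {p R : ℝ} (hp0 : 0 < p) (hp : p < 1) :
    ∫⁻ x, {x : ℝ | |x| ≤ R}.indicator (fun x => ENNReal.ofReal (|x| ^ (-p))) x < ∞ := by
  let g : ℝ → ℝ≥0∞ := (Ioc 0 R).indicator fun x => ENNReal.ofReal (x ^ (-p))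
  have hg : ∫⁻ x, g x < ∞ := by
    rw [lintegral_indicator measurableSet_Ioc]
    have := (intervalIntegral.intervalIntegrable_rpow' (a := 0) (b := R)
      (show -1 < -p by linarith)).1
    exact this.lintegral_lt_top
  have hgm : Measurable g := by
    refine Measurable.indicator ?_ measurableSet_Ioc
    fun_prop
  refine lt_of_le_of_lt (b := ∫⁻ x, (g x + g (-x))) ?_ ?_
  · refine lintegral_mono fun x => ?_
    by_cases hx : |x| ≤ R
    · rw [indicator_of_mem (by exact hx)]
      rcases lt_trichotomy x 0 with h | h | h
      · refine le_trans ?_ le_add_self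
        simp only [g]
        rw [indicator_of_mem (by constructor <;> linarith [abs_of_neg h]), abs_of_neg h]
      -- At the singularity the real power takes the default value 0, so the inequality is trivial
      -- there.
      · subst h; simp [Real.zero_rpow (neg_ne_zero.2 hp0.ne')]
      · refine le_trans ?_ le_self_add
        simp only [g]
        rw [indicator_of_mem (by constructor <;> linarith [abs_of_pos h]), abs_of_pos h]
    · rw [indicator_of_notMem (by exact hx)]; exact zero_le
  · rw [lintegral_add_left hgm, lintegral_neg_eq_self g]
    exact ENNReal.add_lt_top.2 ⟨hg, hg⟩

theorem lintegral_one_add_sq_rpow_lt_top :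
    ∫⁻ x : ℝ, ENNReal.ofReal ((1 + x ^ 2) ^ (-(3 / 4 : ℝ))) < ∞ := by
  have h := integrable_rpow_neg_one_add_norm_sq (E := ℝ) (μ := volume) (r := 3 / 2) (by simp; norm_num)
  refine lt_of_le_of_lt (lintegral_mono fun x => ?_) h.lintegral_lt_top
  apply ENNReal.ofReal_le_ofReal
  simp only [Real.norm_eq_abs, sq_abs]
  norm_num

/-! ### Uniform integrability of the resonance kernel. -/

/-- With q = τ/(3κξ) the right side is 3κ|ξ||q - m²|. If q ≥ 0, then a = √q factors q - m² exactly;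
if q ≤ 0, then a = 0 works because m² ≤ |q - m²|. The factor 3κ ≥ 1 is dropped, so later constants
do not depend on κ. -/
theorem exists_root (κ ξ τ : ℝ) (hκ : 1 ≤ 3 * κ) :
    ∃ a : ℝ, 0 ≤ a ∧ ∀ m : ℝ, |ξ| * (|(|m| - a)| * (|m| + a)) ≤ |τ - 3 * κ * ξ * m ^ 2| := by
  rcases eq_or_ne ξ 0 with rfl | hξ
  · exact ⟨0, le_rfl, fun m => by simp⟩
  have hk : 0 < 3 * κ := by linarith
  set q := τ / (3 * κ * ξ) with hq
  have hne : 3 * κ * ξ ≠ 0 := mul_ne_zero hk.ne' hξ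
  have hfac : ∀ m : ℝ, |τ - 3 * κ * ξ * m ^ 2| = 3 * κ * |ξ| * |q - m ^ 2| := by
    intro m
    rw [← abs_of_pos hk, ← abs_mul, ← abs_mul, abs_of_pos hk, mul_sub, hq, mul_div_cancel₀ _ hne]
  have hb : ∀ X : ℝ, 0 ≤ X → |ξ| * X ≤ 3 * κ * |ξ| * X := fun X hX => by
    nlinarith [mul_nonneg (abs_nonneg ξ) hX]
  rcases le_total 0 q with h0 | h0
  · refine ⟨√q, Real.sqrt_nonneg q, fun m => ?_⟩
    rw [hfac]
    have : |(|m| - √q)| * (|m| + √q) = |q - m ^ 2| := by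
      rw [← abs_of_nonneg (a := |m| + √q) (by positivity), ← abs_mul, abs_sub_comm q]
      congr 1
      nlinarith [Real.sq_sqrt h0, sq_abs m]
    rw [this]
    exact hb _ (abs_nonneg _)
  · refine ⟨0, le_rfl, fun m => ?_⟩
    rw [hfac]
    have : |(|m| - 0)| * (|m| + 0) ≤ |q - m ^ 2| := by
      rw [sub_zero, add_zero, abs_abs, abs_of_nonpos (a := q - m ^ 2) (by nlinarith [sq_nonneg m])]
      nlinarith [sq_abs m]
    exact (mul_le_mul_of_nonneg_left this (abs_nonneg _)).trans (hb _ (abs_nonneg _))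

theorem rpow_neg_le_rpow_neg {a b p : ℝ} (ha : 0 < a) (hab : a ≤ b) (hp : 0 ≤ p) :
    b ^ (-p) ≤ a ^ (-p) :=
  Real.rpow_le_rpow_of_nonpos ha hab (by linarith)

/-- High-high interactions with large sum of modulations. -/
theorem kernel_le_of_abs_le {ξ m d k : ℝ} (hm : 1 ≤ |m|) (hξ : ξ ≠ 0) (hξm : |ξ| ≤ |m|) (hd : 0 < d)
    (hk : 1 + |ξ| * (d * |m|) ≤ k)
    (hS : 3 * bracket (ξ / 2 - m) < bracket (ξ / 2 + m) ∨ k < ξ ^ 2 * bracket (ξ / 2 + m)) :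
    d / |ξ| ≤ 5 / 2 ∧ bracket (ξ / 2 + m) * bracket (ξ / 2 - m) ^ (-(1 / 2) : ℝ) * k ^ (-(3 / 4) : ℝ) ≤
      5 * (|ξ|⁻¹ * (d / |ξ|) ^ (-(1 / 2) : ℝ)) := by
  have hξ0 : 0 < |ξ| := abs_pos.2 hξ
  have hx : bracket (ξ / 2 + m) ≤ 5 / 2 * |m| ∧ bracket (ξ / 2 + m) ≤ 1 + 3 / 2 * |m| := by
    have : |ξ / 2 + m| ≤ |ξ| / 2 + |m| := by
      refine (abs_add_le _ _).trans ?_; rw [abs_div]; norm_num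
    unfold bracket; constructor <;> linarith
  have hy : 1 + |m| / 2 ≤ bracket (ξ / 2 - m) := by
    have : |m| - |ξ| / 2 ≤ |ξ / 2 - m| := by
      have := abs_sub_abs_le_abs_sub m (ξ / 2)
      rw [abs_sub_comm m, abs_div] at this; norm_num at this; linarith
    unfold bracket; linarith
  -- For |ξ| ≤ |m| the two input brackets are comparable, and the constant 3 excludes the first
  -- alternative of `hS`. The second one bounds d/|ξ|.
  have hS' : k < ξ ^ 2 * bracket (ξ / 2 + m) := by
    rcases hS with h | h
    · linarith [hx.2]
    · exact h
  have hdm : 0 < |ξ| * (d * |m|) := by positivity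
  have hm0 : 0 < |m| := by linarith
  constructor
  · rw [div_le_iff₀ hξ0]
    have h1 : |ξ| * (d * |m|) ≤ |ξ| * (5 / 2 * |ξ| * |m|) := by
      have : ξ ^ 2 * bracket (ξ / 2 + m) ≤ |ξ| ^ 2 * (5 / 2 * |m|) := by
        rw [sq_abs]; exact mul_le_mul_of_nonneg_left hx.1 (sq_nonneg _)
      nlinarith
    have h2 := le_of_mul_le_mul_left h1 hξ0
    exact le_of_mul_le_mul_right h2 hm0
  -- Only the power -1/2 of the modulation is spent here. It balances the factors of |m| exactly and
  -- leaves |ξ|⁻¹ψ(d/|ξ|) with ψ(y) = y^{-1/2}, whose integral over bounded d/|ξ| does not depend on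
  -- ξ.
  · have hk1 : k ^ (-(3 / 4) : ℝ) ≤ (|ξ| * (d * |m|)) ^ (-(1 / 2) : ℝ) :=
      (Real.rpow_le_rpow_of_exponent_le (by linarith) (by norm_num)).trans
        (rpow_neg_le_rpow_neg hdm (by linarith) (by norm_num))
    have hy1 : bracket (ξ / 2 - m) ^ (-(1 / 2) : ℝ) ≤ (|m| / 4) ^ (-(1 / 2) : ℝ) :=
      rpow_neg_le_rpow_neg (by positivity) (by linarith) (by norm_num)
    have h4 : (|m| / 4) ^ (-(1 / 2) : ℝ) * (|ξ| * (d * |m|)) ^ (-(1 / 2) : ℝ) =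
        2 * |m|⁻¹ * (|ξ|⁻¹ * (d / |ξ|) ^ (-(1 / 2) : ℝ)) := by
      rw [← Real.mul_rpow (by positivity) (by positivity)]
      have : |m| / 4 * (|ξ| * (d * |m|)) = (|m| * |ξ| / 2) ^ (2 : ℝ) * (d / |ξ|) := by
        rw [Real.rpow_two]; field_simp; ring
      rw [this, Real.mul_rpow (by positivity) (by positivity), ← Real.rpow_mul (by positivity)]
      norm_num [Real.rpow_neg_one]
      field_simp
    calc _ ≤ 5 / 2 * |m| * (|m| / 4) ^ (-(1 / 2) : ℝ) * (|ξ| * (d * |m|)) ^ (-(1 / 2) : ℝ) := by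
          have hk0 : 0 < k := by linarith
          have := bracket_pos (ξ / 2 - m)
          gcongr
          exact hx.1
      _ = 5 * (|ξ|⁻¹ * (d / |ξ|) ^ (-(1 / 2) : ℝ)) := by rw [mul_assoc, h4]; field_simp

theorem kernel_le_of_small {ξ m k : ℝ} (hξ : |ξ| ≤ 1) (hm : |m| ≤ 1) (hk : 1 ≤ k) :
    bracket (ξ / 2 + m) * bracket (ξ / 2 - m) ^ (-(1 / 2) : ℝ) * k ^ (-(3 / 4) : ℝ) ≤ 5 / 2 := by
  have hx : bracket (ξ / 2 + m) ≤ 5 / 2 := by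
    have : |ξ / 2 + m| ≤ |ξ| / 2 + |m| := by
      refine (abs_add_le _ _).trans ?_; rw [abs_div]; norm_num
    unfold bracket; linarith
  have h1 : bracket (ξ / 2 - m) ^ (-(1 / 2) : ℝ) ≤ 1 :=
    Real.rpow_le_one_of_one_le_of_nonpos (one_le_bracket _) (by norm_num)
  have h2 : k ^ (-(3 / 4) : ℝ) ≤ 1 := Real.rpow_le_one_of_one_le_of_nonpos hk (by norm_num)
  calc bracket (ξ / 2 + m) * bracket (ξ / 2 - m) ^ (-(1 / 2) : ℝ) * k ^ (-(3 / 4) : ℝ)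
      ≤ 5 / 2 * 1 * 1 := by
        have := bracket_pos (ξ / 2 - m)
        gcongr
    _ = 5 / 2 := by norm_num

/-- Both inputs have size |ξ|, so the frequency factors amount to √|ξ|. The result has the scale
invariant form √|ξ| ψ(√|ξ| d), and ψ(y) = (1 + y²)^{-3/4} is integrable. -/
theorem kernel_le_of_four_mul_le {ξ m d k : ℝ} (hξ : 1 ≤ |ξ|) (hm : 4 * |m| ≤ |ξ|)
    (hk : 1 + |ξ| * (d * d) ≤ k) :
    bracket (ξ / 2 + m) * bracket (ξ / 2 - m) ^ (-(1 / 2) : ℝ) * k ^ (-(3 / 4) : ℝ) ≤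
      5 * (√|ξ| * (1 + (√|ξ| * d) ^ 2) ^ (-(3 / 4) : ℝ)) := by
  have hξ0 : 0 < |ξ| := by linarith
  have hx : bracket (ξ / 2 + m) ≤ 5 / 2 * |ξ| := by
    have : |ξ / 2 + m| ≤ |ξ| / 2 + |m| := by
      refine (abs_add_le _ _).trans ?_; rw [abs_div]; norm_num
    unfold bracket; linarith [abs_nonneg m]
  have hy : |ξ| / 4 ≤ bracket (ξ / 2 - m) := by
    have : |ξ| / 2 - |m| ≤ |ξ / 2 - m| := by
      have := abs_sub_abs_le_abs_sub (ξ / 2) m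
      rw [abs_div] at this; norm_num at this; linarith
    unfold bracket; linarith
  have h1 : bracket (ξ / 2 - m) ^ (-(1 / 2) : ℝ) ≤ 2 * |ξ| ^ (-(1 / 2) : ℝ) := by
    refine (rpow_neg_le_rpow_neg (by positivity) hy (by norm_num)).trans_eq ?_
    rw [div_eq_mul_inv, Real.mul_rpow (by positivity) (by norm_num)]
    have : (4⁻¹ : ℝ) = (1 / 2) ^ (2 : ℝ) := by norm_num
    rw [this, ← Real.rpow_mul (by norm_num)]
    norm_num [Real.rpow_neg_one]; ring
  have h2 : k ^ (-(3 / 4) : ℝ) ≤ (1 + (√|ξ| * d) ^ 2) ^ (-(3 / 4) : ℝ) := by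
    refine rpow_neg_le_rpow_neg (by positivity) ?_ (by norm_num)
    rw [mul_pow, Real.sq_sqrt hξ0.le]; linarith
  have h3 : |ξ| * |ξ| ^ (-(1 / 2) : ℝ) = √|ξ| := by
    nth_rewrite 1 [← Real.rpow_one |ξ|]
    rw [← Real.rpow_add hξ0, Real.sqrt_eq_rpow]; norm_num
  have hk0 : 0 < k := by nlinarith [mul_self_nonneg d]
  calc _ ≤ 5 / 2 * |ξ| * (2 * |ξ| ^ (-(1 / 2) : ℝ)) * (1 + (√|ξ| * d) ^ 2) ^ (-(3 / 4) : ℝ) := by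
        have := bracket_pos (ξ / 2 - m)
        gcongr
    _ = 5 * (|ξ| * |ξ| ^ (-(1 / 2) : ℝ)) * (1 + (√|ξ| * d) ^ 2) ^ (-(3 / 4) : ℝ) := by ring
    _ = _ := by rw [h3]; ring

/-- One input may be small, so its bracket is kept. Since k is at least |ξ|²d/4, the power k^{-3/4}
decays like |ξ|^{-3/2}, more than enough for the factor |ξ| when |ξ| ≥ 1. -/
theorem kernel_le_of_le_four_mul {ξ m d k : ℝ} (hξ : 1 ≤ |ξ|) (hm : |ξ| ≤ 4 * |m|) (hm' : |m| ≤ |ξ|)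
    (hd : 0 < d) (hk : 1 + |ξ| * (d * |m|) ≤ k) :
    bracket (ξ / 2 + m) * bracket (ξ / 2 - m) ^ (-(1 / 2) : ℝ) * k ^ (-(3 / 4) : ℝ) ≤
      20 * (bracket (ξ / 2 - m) ^ (-(1 / 2) : ℝ) * d ^ (-(3 / 4) : ℝ)) := by
  have hξ0 : 0 < |ξ| := by linarith
  have hx : bracket (ξ / 2 + m) ≤ 5 / 2 * |ξ| := by
    have : |ξ / 2 + m| ≤ |ξ| / 2 + |m| := by
      refine (abs_add_le _ _).trans ?_; rw [abs_div]; norm_num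
    unfold bracket; linarith [abs_nonneg m]
  have hkd : |ξ| ^ 2 / 4 * d ≤ k := by
    have : |ξ| * (d * (|ξ| / 4)) ≤ |ξ| * (d * |m|) := by gcongr; linarith
    linarith [this, (by ring : |ξ| ^ 2 / 4 * d = |ξ| * (d * (|ξ| / 4)))]
  have h1 : |ξ| * k ^ (-(3 / 4) : ℝ) ≤ 8 * d ^ (-(3 / 4) : ℝ) := by
    have h2 : k ^ (-(3 / 4) : ℝ) ≤ (|ξ| ^ 2 / 4) ^ (-(3 / 4) : ℝ) * d ^ (-(3 / 4) : ℝ) := by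
      rw [← Real.mul_rpow (by positivity) hd.le]
      exact rpow_neg_le_rpow_neg (by positivity) hkd (by norm_num)
    have h3 : (|ξ| ^ 2 / 4) ^ (-(3 / 4) : ℝ) ≤ 8 * |ξ|⁻¹ := by
      have e : |ξ| ^ 2 / 4 = (|ξ| / 2) ^ (2 : ℝ) := by rw [Real.rpow_two]; ring
      rw [e, ← Real.rpow_mul (by positivity)]
      norm_num
      rw [Real.div_rpow hξ0.le (by norm_num), div_eq_mul_inv, mul_comm]
      gcongr
      · rw [← Real.rpow_neg (by norm_num)]
        calc (2 : ℝ) ^ (-(-(3 / 2)) : ℝ) ≤ 2 ^ (3 : ℝ) :=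
              Real.rpow_le_rpow_of_exponent_le (by norm_num) (by norm_num)
          _ = 8 := by norm_num
      · rw [← Real.rpow_neg_one]
        exact Real.rpow_le_rpow_of_exponent_le hξ (by norm_num)
    calc |ξ| * k ^ (-(3 / 4) : ℝ) ≤ |ξ| * (8 * |ξ|⁻¹ * d ^ (-(3 / 4) : ℝ)) := by
          gcongr; exact h2.trans (by gcongr)
      _ = _ := by field_simp
  have hk0 : 0 < k := by linarith [show 0 ≤ |ξ| * (d * |m|) by positivity]
  calc _ ≤ 5 / 2 * |ξ| * bracket (ξ / 2 - m) ^ (-(1 / 2) : ℝ) * k ^ (-(3 / 4) : ℝ) := by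
        have := bracket_pos (ξ / 2 - m)
        gcongr
    _ = 5 / 2 * bracket (ξ / 2 - m) ^ (-(1 / 2) : ℝ) * (|ξ| * k ^ (-(3 / 4) : ℝ)) := by ring
    _ ≤ 5 / 2 * bracket (ξ / 2 - m) ^ (-(1 / 2) : ℝ) * (8 * d ^ (-(3 / 4) : ℝ)) := by
        have := bracket_pos (ξ / 2 - m)
        gcongr
    _ = _ := by ring

/-- The smaller of the two quantities can take over both powers, and the total exponent -5/4 is
integrable at infinity. The constant 4 bounds 2^{5/4}, the cost of replacing d ≥ 1 by half its
bracket. -/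
theorem bracket_rpow_mul_rpow_le {y d : ℝ} (hd : 1 ≤ d) :
    bracket y ^ (-(1 / 2) : ℝ) * d ^ (-(3 / 4) : ℝ) ≤
      bracket y ^ (-(5 / 4) : ℝ) + 4 * bracket d ^ (-(5 / 4) : ℝ) := by
  have hb := bracket_pos y
  have hd0 : 0 < d := by linarith
  rcases le_total (bracket y) d with h | h
  · calc _ ≤ bracket y ^ (-(1 / 2) : ℝ) * bracket y ^ (-(3 / 4) : ℝ) := by
          exact mul_le_mul_of_nonneg_left (rpow_neg_le_rpow_neg hb h (by norm_num)) (by positivity)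
      _ = bracket y ^ (-(5 / 4) : ℝ) := by rw [← Real.rpow_add hb]; norm_num
      _ ≤ bracket y ^ (-(5 / 4) : ℝ) + 4 * bracket d ^ (-(5 / 4) : ℝ) := 
          le_add_of_nonneg_right (by have := bracket_pos d; positivity)
  · calc _ ≤ d ^ (-(1 / 2) : ℝ) * d ^ (-(3 / 4) : ℝ) := by
          exact mul_le_mul_of_nonneg_right (rpow_neg_le_rpow_neg hd0 h (by norm_num)) (by positivity)
      _ = d ^ (-(5 / 4) : ℝ) := by rw [← Real.rpow_add hd0]; norm_num
      _ ≤ (bracket d / 2) ^ (-(5 / 4) : ℝ) := by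
          refine rpow_neg_le_rpow_neg (by have := bracket_pos d; positivity) ?_ (by norm_num)
          unfold bracket; rw [abs_of_pos hd0]; linarith
      _ = 2 ^ (5 / 4 : ℝ) * bracket d ^ (-(5 / 4) : ℝ) := by
          rw [Real.div_rpow (bracket_pos d).le (by norm_num), Real.rpow_neg (by norm_num : (0:ℝ) ≤ 2)]
          field_simp
      _ ≤ 4 * bracket d ^ (-(5 / 4) : ℝ) := by
          have := bracket_pos d
          gcongr
          calc (2 : ℝ) ^ (5 / 4 : ℝ) ≤ 2 ^ (2 : ℝ) :=
                Real.rpow_le_rpow_of_exponent_le (by norm_num) (by norm_num)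
            _ = 4 := by norm_num
      _ ≤ bracket y ^ (-(5 / 4) : ℝ) + 4 * bracket d ^ (-(5 / 4) : ℝ) := le_add_of_nonneg_left (by positivity)

/-- The resonance kernel of the bilinear estimate, away from the region of small output frequency
and large modulation. -/
noncomputable def resonanceKernel (κ ξ τ m : ℝ) : ℝ≥0∞ :=
  {m : ℝ | 3 * bracket (ξ / 2 - m) < bracket (ξ / 2 + m) ∨
      bracket (τ - 3 * κ * ξ * m ^ 2) < ξ ^ 2 * bracket (ξ / 2 + m)}.indicator
    (fun m => ENNReal.ofReal (bracket (ξ / 2 + m) * bracket (ξ / 2 - m) ^ (-(1 / 2) : ℝ) *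
      bracket (τ - 3 * κ * ξ * m ^ 2) ^ (-(3 / 4) : ℝ))) m

noncomputable def singularCutoff (p R : ℝ) (y : ℝ) : ℝ≥0∞ :=
  {x : ℝ | |x| ≤ R}.indicator (fun x => ENNReal.ofReal (|x| ^ (-p))) y

theorem measurable_singularCutoff (p R : ℝ) : Measurable (singularCutoff p R) := by
  unfold singularCutoff
  refine Measurable.indicator (by fun_prop) ?_
  exact (isClosed_le continuous_abs continuous_const).measurableSet

/-- The plane of (ξ, m) is divided by the relative size of |ξ| and |m|, and each region is dominated
by a summand whose integral in m is bounded independently of ξ and a. The largest constant is 80 =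
20 · 4, from the region where |m| is comparable to |ξ| and d ≥ 1. -/
theorem resonanceKernel_le {κ ξ τ m a : ℝ} (ha : 0 ≤ a) (hma : |m| - a ≠ 0)
    (h : |ξ| * (|(|m| - a)| * (|m| + a)) ≤ |τ - 3 * κ * ξ * m ^ 2|) :
    resonanceKernel κ ξ τ m ≤ ENNReal.ofReal 80 *
      ({x : ℝ | |x| ≤ 1}.indicator 1 m +
        ENNReal.ofReal |ξ|⁻¹ * singularCutoff (1 / 2) (5 / 2) (|ξ|⁻¹ * (|m| - a)) +
        ENNReal.ofReal √|ξ| * ENNReal.ofReal ((1 + (√|ξ| * (|m| - a)) ^ 2) ^ (-(3 / 4) : ℝ)) +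
        ENNReal.ofReal 1 * singularCutoff (3 / 4) 1 (1 * (|m| - a)) +
        ENNReal.ofReal (bracket (ξ / 2 - m) ^ (-(5 / 4) : ℝ)) +
        ENNReal.ofReal 1 * ENNReal.ofReal (bracket (1 * (|m| - a)) ^ (-(5 / 4) : ℝ))) := by
  unfold resonanceKernel
  set k := bracket (τ - 3 * κ * ξ * m ^ 2) with hk
  set d := |(|m| - a)| with hd
  have hd0 : 0 < d := abs_pos.2 hma
  have hk1 : 1 ≤ k := one_le_bracket _
  have hkD : 1 + |ξ| * (d * (|m| + a)) ≤ k := by rw [hk, bracket]; linarith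
  have hdm : d ≤ |m| + a := by
    rw [hd]; refine (abs_sub _ _).trans ?_; rw [abs_abs, abs_of_nonneg ha]
  have hkm : 1 + |ξ| * (d * |m|) ≤ k := by
    refine le_trans ?_ hkD; gcongr; linarith
  have hkd : 1 + |ξ| * (d * d) ≤ k := by
    refine le_trans ?_ hkD; gcongr
  by_cases hS : 3 * bracket (ξ / 2 - m) < bracket (ξ / 2 + m) ∨ k < ξ ^ 2 * bracket (ξ / 2 + m)
  swap
  · rw [indicator_of_notMem (by exact hS)]; exact zero_le
  rw [indicator_of_mem (by exact hS)]
  rcases eq_or_ne ξ 0 with h0 | hξ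
  · exfalso; subst h0
    have := bracket_pos m
    rcases hS with h | h <;> simp [bracket] at h <;> linarith [abs_nonneg m]
  have hξ0 : 0 < |ξ| := abs_pos.2 hξ
  rcases le_total |ξ| |m| with hξm | hξm
  · rcases le_total |m| 1 with hm | hm
    · have h1 := kernel_le_of_small (hξm.trans hm) hm hk1
      calc _ ≤ ENNReal.ofReal 80 * {x : ℝ | |x| ≤ 1}.indicator 1 m := by
            rw [indicator_of_mem (by exact hm), Pi.one_apply, mul_one]
            exact ENNReal.ofReal_le_ofReal (h1.trans (by norm_num))
        _ ≤ _ := by gcongr; simp only [add_assoc]; exact le_self_add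
    · obtain ⟨h1, h2⟩ := kernel_le_of_abs_le hm hξ hξm hd0 hkm hS
      have e : |(|ξ|⁻¹ * (|m| - a))| = d / |ξ| := by
        rw [abs_mul, abs_inv, abs_abs, div_eq_inv_mul]
      calc _ ≤ ENNReal.ofReal 80 * (ENNReal.ofReal |ξ|⁻¹ *
              singularCutoff (1 / 2) (5 / 2) (|ξ|⁻¹ * (|m| - a))) := by
            rw [singularCutoff, indicator_of_mem (by simpa only [mem_ofPred_eq, e] using h1), e,
              ← ENNReal.ofReal_mul (by positivity), ← ENNReal.ofReal_mul (by positivity)]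
            apply ENNReal.ofReal_le_ofReal
            refine h2.trans ?_
            gcongr; norm_num
        _ ≤ _ := by gcongr; simp only [add_assoc]; exact le_add_left le_self_add
  · rcases le_total |ξ| 1 with hξ1 | hξ1
    · have h1 := kernel_le_of_small hξ1 (hξm.trans hξ1) hk1
      calc _ ≤ ENNReal.ofReal 80 * {x : ℝ | |x| ≤ 1}.indicator 1 m := by
            rw [indicator_of_mem (by exact hξm.trans hξ1), Pi.one_apply, mul_one]
            exact ENNReal.ofReal_le_ofReal (h1.trans (by norm_num))
        _ ≤ _ := by gcongr; simp only [add_assoc]; exact le_self_add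
    · rcases le_total (4 * |m|) |ξ| with h4 | h4
      · have h1 := kernel_le_of_four_mul_le hξ1 h4 hkd
        have e : (√|ξ| * d) ^ 2 = (√|ξ| * (|m| - a)) ^ 2 := by
          rw [mul_pow, mul_pow, hd, sq_abs]
        rw [e] at h1
        calc _ ≤ ENNReal.ofReal 80 * (ENNReal.ofReal √|ξ| *
                ENNReal.ofReal ((1 + (√|ξ| * (|m| - a)) ^ 2) ^ (-(3 / 4) : ℝ))) := by
              rw [← ENNReal.ofReal_mul (by positivity), ← ENNReal.ofReal_mul (by positivity)]
              apply ENNReal.ofReal_le_ofReal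
              refine h1.trans ?_
              gcongr; norm_num
          _ ≤ _ := by gcongr; simp only [add_assoc]; exact le_add_left (le_add_left le_self_add)
      · have h1 := kernel_le_of_le_four_mul hξ1 h4 hξm hd0 hkm
        have hb := bracket_pos (ξ / 2 - m)
        rcases le_total d 1 with hd1 | hd1
        · calc _ ≤ ENNReal.ofReal 80 *
                  (ENNReal.ofReal 1 * singularCutoff (3 / 4) 1 (1 * (|m| - a))) := by
                rw [one_mul, singularCutoff, indicator_of_mem (by exact hd1),
                  ← ENNReal.ofReal_mul (by positivity), ← ENNReal.ofReal_mul (by positivity)]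
                apply ENNReal.ofReal_le_ofReal
                refine h1.trans ?_
                have : bracket (ξ / 2 - m) ^ (-(1 / 2) : ℝ) ≤ 1 :=
                  Real.rpow_le_one_of_one_le_of_nonpos (one_le_bracket _) (by norm_num)
                gcongr; norm_num
            _ ≤ _ := by
                gcongr; simp only [add_assoc]
                exact le_add_left (le_add_left (le_add_left le_self_add))
        · have h2 := bracket_rpow_mul_rpow_le (y := ξ / 2 - m) hd1
          have e : bracket d = bracket (|m| - a) := by simp only [bracket, hd, abs_abs]
          have hb' := bracket_pos (|m| - a)
          calc _ ≤ ENNReal.ofReal 80 * (ENNReal.ofReal (bracket (ξ / 2 - m) ^ (-(5 / 4) : ℝ)) +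
                ENNReal.ofReal 1 * ENNReal.ofReal (bracket (1 * (|m| - a)) ^ (-(5 / 4) : ℝ))) := by
                rw [one_mul, ENNReal.ofReal_one, one_mul, ← ENNReal.ofReal_add (by positivity)
                  (by positivity), ← ENNReal.ofReal_mul (by positivity)]
                apply ENNReal.ofReal_le_ofReal
                refine h1.trans ?_
                rw [e] at h2
                have : 0 ≤ bracket (ξ / 2 - m) ^ (-(5 / 4) : ℝ) := by positivity
                linarith
            _ ≤ _ := by
                gcongr; simp only [add_assoc]
                exact le_add_left (le_add_left (le_add_left (le_add_left le_rfl)))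

/-- Uniform integrability of the resonance kernel. -/
theorem exists_lintegral_resonanceKernel_le :
    ∃ C : ℝ≥0, ∀ κ ξ τ : ℝ, 1 ≤ 3 * κ → ∫⁻ m, resonanceKernel κ ξ τ m ≤ C := by
  set A := ∫⁻ m : ℝ, {x : ℝ | |x| ≤ 1}.indicator (1 : ℝ → ℝ≥0∞) m with hA
  set B := ∫⁻ y, singularCutoff (1 / 2) (5 / 2) y with hB
  set D := ∫⁻ y : ℝ, ENNReal.ofReal ((1 + y ^ 2) ^ (-(3 / 4) : ℝ)) with hD
  set E := ∫⁻ y, singularCutoff (3 / 4) 1 y with hE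
  set F := ∫⁻ y : ℝ, ENNReal.ofReal (bracket y ^ (-(5 / 4) : ℝ)) with hF
  have hAf : A ≠ ∞ := by
    have : {x : ℝ | |x| ≤ 1} = Icc (-1) 1 := by ext; simp [abs_le]
    rw [hA, this, lintegral_indicator_one measurableSet_Icc]; simp
  have hBf : B ≠ ∞ :=
    (lintegral_abs_rpow_indicator_lt_top (by norm_num) (by norm_num)).ne
  have hDf : D ≠ ∞ := lintegral_one_add_sq_rpow_lt_top.ne
  have hEf : E ≠ ∞ :=
    (lintegral_abs_rpow_indicator_lt_top (by norm_num) (by norm_num)).ne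
  have hFf : F ≠ ∞ := (lintegral_bracket_rpow_lt_top (by norm_num)).ne
  set C := ENNReal.ofReal 80 * (A + 2 * B + 2 * D + 2 * E + F + 2 * F) with hC
  have hCf : C ≠ ∞ := by rw [hC]; finiteness
  refine ⟨C.toNNReal, fun κ ξ τ hκ => ?_⟩
  rw [ENNReal.coe_toNNReal hCf]
  -- At ξ = 0 the two input brackets agree and the factor ξ² vanishes, so the kernel has empty
  -- support.
  rcases eq_or_ne ξ 0 with h0 | hξ
  · subst h0
    have : ∀ m, resonanceKernel κ 0 τ m = 0 := by
      intro m
      unfold resonanceKernel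
      rw [indicator_of_notMem]
      have := one_le_bracket m
      have := bracket_pos (τ - 3 * κ * 0 * m ^ 2)
      simp only [mem_ofPred_eq, not_or, not_lt]
      constructor
      · simp only [zero_div, zero_sub, zero_add, bracket_neg]; linarith
      · simpa using this.le
    simp [this]
  have hξ0 : 0 < |ξ| := abs_pos.2 hξ
  obtain ⟨a, ha, hroot⟩ := exists_root κ ξ τ hκ
  have hae : ∀ᵐ m : ℝ, resonanceKernel κ ξ τ m ≤ ENNReal.ofReal 80 *
      ({x : ℝ | |x| ≤ 1}.indicator 1 m +
        ENNReal.ofReal |ξ|⁻¹ * singularCutoff (1 / 2) (5 / 2) (|ξ|⁻¹ * (|m| - a)) +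
        ENNReal.ofReal √|ξ| * ENNReal.ofReal ((1 + (√|ξ| * (|m| - a)) ^ 2) ^ (-(3 / 4) : ℝ)) +
        ENNReal.ofReal 1 * singularCutoff (3 / 4) 1 (1 * (|m| - a)) +
        ENNReal.ofReal (bracket (ξ / 2 - m) ^ (-(5 / 4) : ℝ)) +
        ENNReal.ofReal 1 * ENNReal.ofReal (bracket (1 * (|m| - a)) ^ (-(5 / 4) : ℝ))) := by
    -- The pointwise bound fails to apply only where |m| = a, a null set.
    have hfin : ({a, -a} : Set ℝ).Finite := by simp
    filter_upwards [compl_mem_ae_iff.2 (hfin.measure_zero volume)] with m hm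
    refine resonanceKernel_le ha (fun h => hm ?_) (hroot m)
    rcases abs_choice m with h' | h' <;> rw [h'] at h
    · left; linarith
    · right; simp only [mem_singleton_iff]; linarith
  have hm1 := measurable_singularCutoff (1 / 2) (5 / 2)
  have hm2 := measurable_singularCutoff (3 / 4) 1
  have hA1 : Measurable ({x : ℝ | |x| ≤ 1}.indicator (1 : ℝ → ℝ≥0∞)) :=
    measurable_one.indicator (isClosed_le continuous_abs continuous_const).measurableSet
  have hF2 : ∫⁻ m, ENNReal.ofReal (bracket (ξ / 2 - m) ^ (-(5 / 4) : ℝ)) = F :=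
    lintegral_sub_left_eq_self (fun m => ENNReal.ofReal (bracket m ^ (-(5 / 4) : ℝ))) _
  refine (lintegral_mono_ae hae).trans ?_
  rw [lintegral_const_mul' _ _ ENNReal.ofReal_ne_top, lintegral_add_left, lintegral_add_left,
    lintegral_add_left, lintegral_add_left, lintegral_add_left, hF2, hC]
  · gcongr
    · exact lintegral_comp_sub_abs_le hm1 (inv_pos.2 hξ0) a
    · exact lintegral_comp_sub_abs_le (φ := fun y => ENNReal.ofReal ((1 + y ^ 2) ^ (-(3 / 4) : ℝ)))
        (by fun_prop) (Real.sqrt_pos.2 hξ0) a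
    · exact lintegral_comp_sub_abs_le hm2 one_pos a
    · exact lintegral_comp_sub_abs_le (φ := fun y => ENNReal.ofReal (bracket y ^ (-(5 / 4) : ℝ)))
        (by fun_prop) one_pos a
  all_goals fun_prop

/-! ### The bilinear estimate. -/

/-- The modulation bracket `⟨θ - κ η³⟩` at `ζ = (η, θ)`. -/
noncomputable def modulation (κ : ℝ) (ζ : ℝ × ℝ) : ℝ := bracket (ζ.2 - κ * ζ.1 ^ 3)

theorem modulation_pos (κ : ℝ) (ζ : ℝ × ℝ) : 0 < modulation κ ζ := bracket_pos _

theorem one_le_modulation (κ : ℝ) (ζ : ℝ × ℝ) : 1 ≤ modulation κ ζ := one_le_bracket _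

theorem modulation_neg (κ : ℝ) (ζ : ℝ × ℝ) : modulation κ (-ζ) = modulation κ ζ := by
  unfold modulation
  rw [← bracket_neg]
  congr 1
  simp only [Prod.fst_neg, Prod.snd_neg]; ring

@[fun_prop]
theorem measurable_modulation (κ : ℝ) : Measurable (modulation κ) := by
  unfold modulation; fun_prop

/-- The first factor carries half a derivative and only L^{-3/8}; the second gives up a quarter
derivative and has L^{-9/16}, whose square is integrable in the modulation variable. -/
noncomputable def bilinearWeight (κ : ℝ) (z w : ℝ × ℝ) : ℝ≥0∞ :=
  ENNReal.ofReal (bracket z.1 ^ (1 / 2 : ℝ) * modulation κ z ^ (-(3 / 8) : ℝ) *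
    (bracket w.1 ^ (-(1 / 4) : ℝ) * modulation κ w ^ (-(9 / 16) : ℝ)))

theorem measurable_bilinearWeight (κ : ℝ) :
    Measurable fun p : (ℝ × ℝ) × (ℝ × ℝ) => bilinearWeight κ p.1 p.2 := by
  unfold bilinearWeight; fun_prop

theorem bilinearWeight_sq (κ : ℝ) (z w : ℝ × ℝ) : bilinearWeight κ z w ^ 2 =
    ENNReal.ofReal (modulation κ w ^ (-(9 / 8) : ℝ)) *
      ENNReal.ofReal (bracket z.1 * bracket w.1 ^ (-(1 / 2) : ℝ) *
        modulation κ z ^ (-(3 / 4) : ℝ)) := by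
  have h1 := bracket_pos z.1
  have h2 := bracket_pos w.1
  have h3 := modulation_pos κ z
  have h4 := modulation_pos κ w
  unfold bilinearWeight
  rw [← ENNReal.ofReal_pow (by positivity), ← ENNReal.ofReal_mul (by positivity)]
  congr 1
  simp only [mul_pow, ← Real.rpow_natCast, ← Real.rpow_mul h1.le, ← Real.rpow_mul h2.le,
    ← Real.rpow_mul h3.le, ← Real.rpow_mul h4.le]
  norm_num
  ring

/-- The region of small output frequency and large modulation. -/
def lowOutputRegion (κ : ℝ) : Set ((ℝ × ℝ) × (ℝ × ℝ)) :=
  {p | (p.1.1 + p.2.1) ^ 2 * bracket p.1.1 ≤ modulation κ p.1 ∧ bracket p.1.1 ≤ 3 * bracket p.2.1}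

theorem measurableSet_lowOutputRegion (κ : ℝ) : MeasurableSet (lowOutputRegion κ) := by
  have h1 : MeasurableSet {p : (ℝ × ℝ) × (ℝ × ℝ) |
      (p.1.1 + p.2.1) ^ 2 * bracket p.1.1 ≤ modulation κ p.1} :=
    measurableSet_le (by fun_prop) (by fun_prop)
  have h2 : MeasurableSet {p : (ℝ × ℝ) × (ℝ × ℝ) | bracket p.1.1 ≤ 3 * bracket p.2.1} :=
    measurableSet_le (by fun_prop) (by fun_prop)
  exact h1.inter h2

/-- For fixed `z` the region confines the frequency of `w` to an interval of radius r = √(L/⟨ξ⟩)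
around -ξ. There the squared weight is at most 2/r times a function of the modulation of `w` alone,
so length times height is 2r · 2/r = 4, whatever `z` is. -/
theorem exists_lintegral_low_le : ∃ C : ℝ≥0, ∀ (κ : ℝ) (z : ℝ × ℝ),
    ∫⁻ w, (lowOutputRegion κ).indicator (fun p => bilinearWeight κ p.1 p.2) (z, w) ^ 2 ≤ C := by
  set B := ∫⁻ y : ℝ, ENNReal.ofReal (bracket y ^ (-(9 / 8) : ℝ)) with hB
  have hBf : B ≠ ∞ := (lintegral_bracket_rpow_lt_top (by norm_num)).ne
  refine ⟨(4 * B).toNNReal, fun κ z => ?_⟩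
  rw [ENNReal.coe_toNNReal (by finiteness)]
  have hx := bracket_pos z.1
  have hk := modulation_pos κ z
  set r := √(modulation κ z / bracket z.1) with hr
  have hr0 : 0 < r := Real.sqrt_pos.2 (by positivity)
  let G : ℝ → ℝ≥0∞ := (Icc (-z.1 - r) (-z.1 + r)).indicator fun _ => ENNReal.ofReal (2 * r⁻¹)
  have hG : Measurable G := measurable_const.indicator measurableSet_Icc
  have hpt : ∀ w : ℝ × ℝ,
      (lowOutputRegion κ).indicator (fun p => bilinearWeight κ p.1 p.2) (z, w) ^ 2 ≤
        G w.1 * ENNReal.ofReal (modulation κ w ^ (-(9 / 8) : ℝ)) := by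
    intro w
    by_cases hw : (z, w) ∈ lowOutputRegion κ
    swap
    · rw [indicator_of_notMem hw]; simp
    rw [indicator_of_mem hw, bilinearWeight_sq, mul_comm]
    obtain ⟨h1, h2⟩ := hw
    simp only at h1 h2
    have hy := bracket_pos w.1
    have hmem : w.1 ∈ Icc (-z.1 - r) (-z.1 + r) := by
      have : |z.1 + w.1| ≤ r := by
        rw [hr]; apply Real.abs_le_sqrt; rwa [le_div_iff₀ hx]
      rw [abs_le] at this
      constructor <;> linarith [this.1, this.2]
    simp only [G]
    rw [indicator_of_mem hmem]
    refine mul_le_mul' (ENNReal.ofReal_le_ofReal ?_) le_rfl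
    -- The ratio 1/3 given by the region is lowered to 1/4, whose square root is rational.
    have e1 : bracket w.1 ^ (-(1 / 2) : ℝ) ≤ 2 * bracket z.1 ^ (-(1 / 2) : ℝ) := by
      refine (rpow_neg_le_rpow_neg (a := bracket z.1 / 4) (by positivity) (by linarith)
        (by norm_num)).trans_eq ?_
      rw [div_eq_mul_inv, Real.mul_rpow hx.le (by norm_num)]
      have : (4⁻¹ : ℝ) = (1 / 2) ^ (2 : ℝ) := by norm_num
      rw [this, ← Real.rpow_mul (by norm_num)]
      norm_num [Real.rpow_neg_one]; ring
    have e2 : modulation κ z ^ (-(3 / 4) : ℝ) ≤ modulation κ z ^ (-(1 / 2) : ℝ) :=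
      Real.rpow_le_rpow_of_exponent_le (one_le_modulation κ z) (by norm_num)
    have e3 : r⁻¹ = bracket z.1 * bracket z.1 ^ (-(1 / 2) : ℝ) * modulation κ z ^ (-(1 / 2) : ℝ) := by
      nth_rewrite 1 [← Real.rpow_one (bracket z.1)]
      rw [← Real.rpow_add hx, hr, Real.sqrt_eq_rpow, ← Real.rpow_neg (by positivity),
        Real.div_rpow hk.le hx.le, div_eq_mul_inv, ← Real.rpow_neg hx.le]
      norm_num [mul_comm]
    calc _ ≤ bracket z.1 * (2 * bracket z.1 ^ (-(1 / 2) : ℝ)) * modulation κ z ^ (-(1 / 2) : ℝ) := by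
          gcongr
      _ = 2 * r⁻¹ := by rw [e3]; ring
  calc _ ≤ ∫⁻ w : ℝ × ℝ, G w.1 * ENNReal.ofReal (modulation κ w ^ (-(9 / 8) : ℝ)) :=
        lintegral_mono hpt
    _ = ∫⁻ x, ∫⁻ y, G x * ENNReal.ofReal (modulation κ (x, y) ^ (-(9 / 8) : ℝ)) := by
        rw [Measure.volume_eq_prod, lintegral_prod _ (by fun_prop)]
    _ = ∫⁻ x, G x * B := by
        refine lintegral_congr fun x => ?_
        rw [lintegral_const_mul _ (by fun_prop), hB]
        congr 1
        exact lintegral_sub_right_eq_self (fun y => ENNReal.ofReal (bracket y ^ (-(9 / 8) : ℝ)))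
          (κ * x ^ 3)
    _ = 4 * B := by
        rw [lintegral_mul_const _ hG, lintegral_indicator_const measurableSet_Icc, Real.volume_Icc,
          ← ENNReal.ofReal_mul (by positivity)]
        congr 1
        have : 2 * r⁻¹ * (-z.1 + r - (-z.1 - r)) = 4 := by field_simp; ring
        rw [this]; norm_num
    _ ≤ _ := le_rfl

/-- Coordinates adapted to the resonance are used: m is the deviation of the frequency of `w` from
half the output frequency, and y is the modulation of `z - w`. The integrand becomes the integrable
⟨y⟩^{-9/8} times the resonance kernel in m, with the time frequency shifted by y. -/
theorem exists_lintegral_high_le : ∃ C : ℝ≥0, ∀ (κ : ℝ) (z : ℝ × ℝ), 1 ≤ 3 * κ →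
    ∫⁻ w, (lowOutputRegion κ)ᶜ.indicator (fun p => bilinearWeight κ p.1 p.2) (w, z - w) ^ 2 ≤ C := by
  set B := ∫⁻ y : ℝ, ENNReal.ofReal (bracket y ^ (-(9 / 8) : ℝ)) with hB
  have hBf : B ≠ ∞ := (lintegral_bracket_rpow_lt_top (by norm_num)).ne
  obtain ⟨C, hC⟩ := exists_lintegral_resonanceKernel_le
  refine ⟨(B * C).toNNReal, fun κ z hκ => ?_⟩
  rw [ENNReal.coe_toNNReal (by finiteness)]
  set H : ℝ × ℝ → ℝ≥0∞ := fun w =>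
    (lowOutputRegion κ)ᶜ.indicator (fun p => bilinearWeight κ p.1 p.2) (w, z - w) ^ 2 with hH
  have hHm : Measurable H := by
    have h := (measurable_bilinearWeight κ).indicator (measurableSet_lowOutputRegion κ).compl
    exact (h.comp (by fun_prop : Measurable fun w : ℝ × ℝ => (w, z - w))).pow_const 2
  have hpt : ∀ m y : ℝ, H (z.1 / 2 + m, z.2 - κ * (z.1 / 2 - m) ^ 3 - y) =
      ENNReal.ofReal (bracket y ^ (-(9 / 8) : ℝ)) *
        resonanceKernel κ z.1 (z.2 - y - κ * z.1 ^ 3 / 4) m := by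
    intro m y
    have e2 : z - (z.1 / 2 + m, z.2 - κ * (z.1 / 2 - m) ^ 3 - y) =
        (z.1 / 2 - m, κ * (z.1 / 2 - m) ^ 3 + y) := by
      ext <;> simp <;> ring
    have e3 : modulation κ (z.1 / 2 - m, κ * (z.1 / 2 - m) ^ 3 + y) = bracket y := by
      simp [modulation]
    -- This is the resonance identity (ξ/2 + m)³ + (ξ/2 - m)³ = ξ³/4 + 3ξm².
    have e4 : modulation κ (z.1 / 2 + m, z.2 - κ * (z.1 / 2 - m) ^ 3 - y) =
        bracket (z.2 - y - κ * z.1 ^ 3 / 4 - 3 * κ * z.1 * m ^ 2) := by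
      simp only [modulation]; congr 1; ring
    simp only [hH, e2]
    unfold resonanceKernel
    have hiff : ((z.1 / 2 + m, z.2 - κ * (z.1 / 2 - m) ^ 3 - y),
        (z.1 / 2 - m, κ * (z.1 / 2 - m) ^ 3 + y)) ∈ (lowOutputRegion κ)ᶜ ↔
        m ∈ {m : ℝ | 3 * bracket (z.1 / 2 - m) < bracket (z.1 / 2 + m) ∨
          bracket (z.2 - y - κ * z.1 ^ 3 / 4 - 3 * κ * z.1 * m ^ 2) <
            z.1 ^ 2 * bracket (z.1 / 2 + m)} := by
      simp only [lowOutputRegion, mem_compl_iff, mem_ofPred_eq, e4, not_and_or, not_le]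
      rw [show z.1 / 2 + m + (z.1 / 2 - m) = z.1 by ring]
      tauto
    by_cases hm : ((z.1 / 2 + m, z.2 - κ * (z.1 / 2 - m) ^ 3 - y),
        (z.1 / 2 - m, κ * (z.1 / 2 - m) ^ 3 + y)) ∈ (lowOutputRegion κ)ᶜ
    · rw [indicator_of_mem hm, indicator_of_mem (hiff.1 hm), bilinearWeight_sq, e3, e4]
    · rw [indicator_of_notMem hm, indicator_of_notMem (fun h => hm (hiff.2 h))]; simp
  calc ∫⁻ w, H w = ∫⁻ x, ∫⁻ y, H (x, y) := by
        rw [Measure.volume_eq_prod, lintegral_prod _ hHm.aemeasurable]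
    _ = ∫⁻ m, ∫⁻ y, H (z.1 / 2 + m, y) :=
        (lintegral_add_left_eq_self (fun x => ∫⁻ y, H (x, y)) (z.1 / 2)).symm
    _ = ∫⁻ m, ∫⁻ y, H (z.1 / 2 + m, z.2 - κ * (z.1 / 2 - m) ^ 3 - y) :=
        lintegral_congr fun m =>
          (lintegral_sub_left_eq_self (fun y => H (z.1 / 2 + m, y)) _).symm
    _ = ∫⁻ y, ∫⁻ m, H (z.1 / 2 + m, z.2 - κ * (z.1 / 2 - m) ^ 3 - y) := by
        refine lintegral_lintegral_swap (Measurable.aemeasurable ?_)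
        exact hHm.comp (by fun_prop)
    _ = ∫⁻ y, ENNReal.ofReal (bracket y ^ (-(9 / 8) : ℝ)) *
          ∫⁻ m, resonanceKernel κ z.1 (z.2 - y - κ * z.1 ^ 3 / 4) m := by
        simp_rw [hpt]
        exact lintegral_congr fun y => lintegral_const_mul' _ _ ENNReal.ofReal_ne_top
    _ ≤ ∫⁻ y, ENNReal.ofReal (bracket y ^ (-(9 / 8) : ℝ)) * C := by
        gcongr with y
        exact hC κ _ _ hκ
    _ = B * C := lintegral_mul_const _ (by fun_prop)

theorem add_sq_le_two_mul (a b : ℝ≥0∞) : (a + b) ^ 2 ≤ 2 * (a ^ 2 + b ^ 2) := by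
  have := ENNReal.rpow_add_le_mul_rpow_add_rpow a b (p := 2) (by norm_num)
  norm_num at this
  exact_mod_cast this

/-- The form is split along `lowOutputRegion`. On each part the squared weight is integrable in one
variable, uniformly in the other, and `sq_lintegral_kernel_le` applies; only the variable held fixed
differs. -/
theorem exists_bilinear_le : ∃ C : ℝ≥0, ∀ κ : ℝ, 1 ≤ 3 * κ → ∀ f g h : ℝ × ℝ → ℝ≥0∞,
    Measurable f → Measurable g → Measurable h →
    (∫⁻ z, ∫⁻ w, bilinearWeight κ z w * (f z * (g w * h (z + w)))) ^ 2 ≤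
      C * (∫⁻ z, f z ^ 2) * (∫⁻ z, g z ^ 2) * ∫⁻ z, h z ^ 2 := by
  obtain ⟨C₁, hC₁⟩ := exists_lintegral_low_le
  obtain ⟨C₂, hC₂⟩ := exists_lintegral_high_le
  refine ⟨2 * (C₁ + C₂), fun κ hκ f g h hf hg hh => ?_⟩
  set A : (ℝ × ℝ) → (ℝ × ℝ) → ℝ≥0∞ := fun z w =>
    (lowOutputRegion κ).indicator (fun p => bilinearWeight κ p.1 p.2) (z, w) with hA
  set A' : (ℝ × ℝ) → (ℝ × ℝ) → ℝ≥0∞ := fun z w =>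
    (lowOutputRegion κ)ᶜ.indicator (fun p => bilinearWeight κ p.1 p.2) (z, w) with hA'
  have hAm : Measurable (Function.uncurry A) :=
    (measurable_bilinearWeight κ).indicator (measurableSet_lowOutputRegion κ)
  have hAm' : Measurable (Function.uncurry A') :=
    (measurable_bilinearWeight κ).indicator (measurableSet_lowOutputRegion κ).compl
  have hsum : ∀ z w, bilinearWeight κ z w = A z w + A' z w := fun z w =>
    (congrFun (indicator_self_add_compl (lowOutputRegion κ)
      (fun p : (ℝ × ℝ) × (ℝ × ℝ) => bilinearWeight κ p.1 p.2)) (z, w)).symm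
  set I := ∫⁻ z, ∫⁻ w, A z w * (f z * (g w * h (z + w))) with hI
  set I' := ∫⁻ z, ∫⁻ w, A' z w * (f z * (g w * h (z + w))) with hI'
  have hsplit : ∫⁻ z, ∫⁻ w, bilinearWeight κ z w * (f z * (g w * h (z + w))) = I + I' := by
    have hm : Measurable fun p : (ℝ × ℝ) × (ℝ × ℝ) =>
        A p.1 p.2 * (f p.1 * (g p.2 * h (p.1 + p.2))) :=
      hAm.mul (by fun_prop)
    simp_rw [hsum, add_mul]
    rw [hI, hI', ← lintegral_add_left hm.lintegral_prod_right']
    exact lintegral_congr fun z => lintegral_add_left (hm.comp measurable_prodMk_left) _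
  have hgh : ∀ P Q : ℝ × ℝ → ℝ≥0∞, Measurable P → Measurable Q →
      ∫⁻ z, ∫⁻ w, P w * Q (z + w) = (∫⁻ w, P w) * ∫⁻ w, Q w := by
    intro P Q hP hQ
    rw [lintegral_lintegral_swap (by fun_prop), ← lintegral_mul_const _ hP]
    refine lintegral_congr fun w => ?_
    rw [lintegral_const_mul _ (by fun_prop)]
    congr 1
    exact lintegral_add_right_eq_self Q w
  -- Here the input `z` is fixed and `f` is the factor split off.
  have h1 : I ^ 2 ≤ C₁ * (∫⁻ z, f z ^ 2) * ((∫⁻ z, g z ^ 2) * ∫⁻ z, h z ^ 2) := by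
    have := sq_lintegral_kernel_le volume volume (K := A) (Q := fun z w => g w * h (z + w)) (P := f)
      hAm (by fun_prop) hf (hC₁ κ)
    refine this.trans_eq ?_
    simp_rw [mul_pow]
    rw [hgh _ _ (hg.pow_const 2) (hh.pow_const 2)]
  have h2 : I' ^ 2 ≤ C₂ * (∫⁻ z, h z ^ 2) * ((∫⁻ z, f z ^ 2) * ∫⁻ z, g z ^ 2) := by
    -- Here the output is fixed instead: after a change of variables `z` denotes the sum of the
    -- inputs, and `h` is the factor split off.
    have e : I' = ∫⁻ z, ∫⁻ w, A' w (z - w) * (h z * (f w * g (z - w))) := by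
      have hm : Measurable fun p : (ℝ × ℝ) × (ℝ × ℝ) =>
          A' p.2 (p.1 - p.2) * (h p.1 * (f p.2 * g (p.1 - p.2))) :=
        Measurable.mul (hAm'.comp (by fun_prop :
          Measurable fun p : (ℝ × ℝ) × (ℝ × ℝ) => (p.2, p.1 - p.2))) (by fun_prop)
      rw [lintegral_lintegral_swap hm.aemeasurable]
      refine lintegral_congr fun z => ?_
      rw [← lintegral_add_left_eq_self (fun w => A' z (w - z) * (h w * (f z * g (w - z)))) z]
      refine lintegral_congr fun w => ?_
      rw [add_sub_cancel_left]; ring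
    rw [e]
    have := sq_lintegral_kernel_le volume volume (K := fun z w => A' w (z - w))
      (Q := fun z w => f w * g (z - w)) (P := h)
      (hAm'.comp (by fun_prop : Measurable fun p : (ℝ × ℝ) × (ℝ × ℝ) => (p.2, p.1 - p.2)))
      (by fun_prop) hh (fun z => hC₂ κ z hκ)
    refine this.trans_eq ?_
    congr 1
    simp_rw [mul_pow]
    rw [lintegral_lintegral_swap (by fun_prop), ← lintegral_mul_const _ (hf.pow_const 2)]
    refine lintegral_congr fun w => ?_
    rw [lintegral_const_mul _ (by fun_prop)]
    congr 1
    exact lintegral_sub_right_eq_self (fun z => g z ^ 2) w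
  rw [hsplit]
  calc (I + I') ^ 2 ≤ 2 * (I ^ 2 + I' ^ 2) := add_sq_le_two_mul I I'
    _ ≤ 2 * (C₁ * (∫⁻ z, f z ^ 2) * ((∫⁻ z, g z ^ 2) * ∫⁻ z, h z ^ 2) +
          C₂ * (∫⁻ z, h z ^ 2) * ((∫⁻ z, f z ^ 2) * ∫⁻ z, g z ^ 2)) := by gcongr
    _ = _ := by push_cast; ring

/-! ### The trilinear estimate with Gevrey weights. -/

noncomputable def highWeight (κ : ℝ) (z : ℝ × ℝ) : ℝ≥0∞ :=
  ENNReal.ofReal (bracket z.1 ^ (1 / 2 : ℝ) * modulation κ z ^ (-(3 / 8) : ℝ))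

noncomputable def lowWeight (κ : ℝ) (z : ℝ × ℝ) : ℝ≥0∞ :=
  ENNReal.ofReal (bracket z.1 ^ (-(1 / 4) : ℝ) * modulation κ z ^ (-(9 / 16) : ℝ))

@[fun_prop]
theorem measurable_highWeight (κ : ℝ) : Measurable (highWeight κ) := by
  unfold highWeight; fun_prop

@[fun_prop]
theorem measurable_lowWeight (κ : ℝ) : Measurable (lowWeight κ) := by
  unfold lowWeight; fun_prop

theorem lowWeight_neg (κ : ℝ) (z : ℝ × ℝ) : lowWeight κ (-z) = lowWeight κ z := by
  simp [lowWeight, modulation_neg, bracket_neg]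

theorem bilinearWeight_eq (κ : ℝ) (z w : ℝ × ℝ) :
    bilinearWeight κ z w = highWeight κ z * lowWeight κ w := by
  have h1 := bracket_pos z.1
  have h3 := modulation_pos κ z
  unfold bilinearWeight highWeight lowWeight
  rw [ENNReal.ofReal_mul (by positivity)]

/-- The trilinear form with two high-frequency weights. -/
theorem exists_quadrilinear_le : ∃ C : ℝ≥0, ∀ κ : ℝ, 1 ≤ 3 * κ → ∀ g f₁ f₂ f₃ : ℝ × ℝ → ℝ≥0∞,
    Measurable g → Measurable f₁ → Measurable f₂ → Measurable f₃ →
    (∫⁻ z₁, ∫⁻ z₂, ∫⁻ z₃, highWeight κ (z₁ + z₂ + z₃) * g (z₁ + z₂ + z₃) *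
      (lowWeight κ z₁ * f₁ z₁ * (lowWeight κ z₂ * f₂ z₂) * (highWeight κ z₃ * f₃ z₃))) ^ 2 ≤
      C * ((∫⁻ z, g z ^ 2) * (∫⁻ z, f₁ z ^ 2) * (∫⁻ z, f₂ z ^ 2) * ∫⁻ z, f₃ z ^ 2) := by
  obtain ⟨C, hC⟩ := exists_bilinear_le
  refine ⟨C * C, fun κ hκ g f₁ f₂ f₃ hg h₁ h₂ h₃ => ?_⟩
  -- `H` is the weighted convolution of `f₂` and `f₃`. The bilinear estimate, tested against an
  -- arbitrary function, bounds it in L².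
  set H : ℝ × ℝ → ℝ≥0∞ := fun w =>
    ∫⁻ z, lowWeight κ z * f₂ z * (highWeight κ (w - z) * f₃ (w - z)) with hH
  have hHm : Measurable H := by
    refine Measurable.lintegral_prod_right' (f := fun p : (ℝ × ℝ) × (ℝ × ℝ) =>
      lowWeight κ p.2 * f₂ p.2 * (highWeight κ (p.1 - p.2) * f₃ (p.1 - p.2))) ?_
    fun_prop
  have hH2 : ∫⁻ w, H w ^ 2 ≤ C * (∫⁻ z, f₃ z ^ 2) * ∫⁻ z, f₂ z ^ 2 := by
    refine lintegral_sq_le_of_forall volume hHm fun h hh => ?_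
    refine le_trans (le_of_eq ?_) (hC κ hκ f₃ f₂ h h₃ h₂ hh)
    congr 1
    calc ∫⁻ w, H w * h w
        = ∫⁻ w, ∫⁻ z, lowWeight κ z * f₂ z * (highWeight κ (w - z) * f₃ (w - z)) * h w := by
          refine lintegral_congr fun w => ?_
          rw [hH, lintegral_mul_const _ (by fun_prop)]
      _ = ∫⁻ z, ∫⁻ w, lowWeight κ z * f₂ z * (highWeight κ (w - z) * f₃ (w - z)) * h w :=
          lintegral_lintegral_swap (by fun_prop)
      _ = ∫⁻ z, ∫⁻ w, lowWeight κ z * f₂ z * (highWeight κ w * f₃ w) * h (w + z) := by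
          refine lintegral_congr fun z => ?_
          rw [← lintegral_add_right_eq_self (fun w => lowWeight κ z * f₂ z *
            (highWeight κ (w - z) * f₃ (w - z)) * h w) z]
          simp only [add_sub_cancel_right]
      _ = _ := by
          rw [lintegral_lintegral_swap (by fun_prop)]
          refine lintegral_congr fun z => lintegral_congr fun w => ?_
          rw [bilinearWeight_eq]; ring
  -- Since z₂ + z₃ is the output minus z₁, the whole form is again bilinear, in `g` and the
  -- reflection of `f₁`, tested against `H`. The bilinear estimate is thus used a second time.
  have hQ : (∫⁻ z₁, ∫⁻ z₂, ∫⁻ z₃, highWeight κ (z₁ + z₂ + z₃) * g (z₁ + z₂ + z₃) *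
      (lowWeight κ z₁ * f₁ z₁ * (lowWeight κ z₂ * f₂ z₂) * (highWeight κ z₃ * f₃ z₃))) =
      ∫⁻ z, ∫⁻ w, bilinearWeight κ z w * (g z * (f₁ (-w) * H (z + w))) := by
    calc _ = ∫⁻ z₁, ∫⁻ z₂, ∫⁻ w, highWeight κ (z₁ + w) * g (z₁ + w) * (lowWeight κ z₁ * f₁ z₁) *
          (lowWeight κ z₂ * f₂ z₂ * (highWeight κ (w - z₂) * f₃ (w - z₂))) := by
          refine lintegral_congr fun z₁ => lintegral_congr fun z₂ => ?_
          rw [← lintegral_sub_right_eq_self _ z₂]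
          refine lintegral_congr fun w => ?_
          rw [show z₁ + z₂ + (w - z₂) = z₁ + w by abel]; ring
      _ = ∫⁻ z₁, ∫⁻ w, highWeight κ (z₁ + w) * g (z₁ + w) * (lowWeight κ z₁ * f₁ z₁) * H w := by
          refine lintegral_congr fun z₁ => ?_
          rw [lintegral_lintegral_swap (by fun_prop)]
          refine lintegral_congr fun w => ?_
          rw [hH, lintegral_const_mul _ (by fun_prop)]
      _ = ∫⁻ z₁, ∫⁻ z, highWeight κ z * g z * (lowWeight κ z₁ * f₁ z₁) * H (z - z₁) := by
          refine lintegral_congr fun z₁ => ?_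
          rw [← lintegral_sub_right_eq_self _ z₁]
          refine lintegral_congr fun z => ?_
          rw [add_sub_cancel]
      _ = ∫⁻ z₁, ∫⁻ z, highWeight κ z * g z * (lowWeight κ z₁ * f₁ (-z₁)) * H (z + z₁) := by
          rw [← lintegral_neg_eq_self]
          refine lintegral_congr fun z₁ => ?_
          simp only [sub_neg_eq_add, lowWeight_neg]
      _ = _ := by
          rw [lintegral_lintegral_swap (by fun_prop)]
          refine lintegral_congr fun z => lintegral_congr fun w => ?_
          rw [bilinearWeight_eq]; ring
  rw [hQ]
  refine (hC κ hκ g (fun w => f₁ (-w)) H hg (by fun_prop) hHm).trans ?_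
  rw [lintegral_neg_eq_self (fun w => f₁ w ^ 2)]
  calc _ ≤ C * (∫⁻ z, g z ^ 2) * (∫⁻ z, f₁ z ^ 2) *
        (C * (∫⁻ z, f₃ z ^ 2) * ∫⁻ z, f₂ z ^ 2) := by gcongr
    _ = _ := by push_cast; ring

/-- The Gevrey weight `e^{σ|ξ|} ⟨ξ⟩^s` at `ξ = 2πη`. -/
noncomputable def gevreyWeight (σ s η : ℝ) : ℝ :=
  Real.exp (σ * |2 * Real.pi * η|) * bracket (2 * Real.pi * η) ^ s

theorem gevreyWeight_pos (σ s η : ℝ) : 0 < gevreyWeight σ s η := by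
  have := bracket_pos (2 * Real.pi * η)
  unfold gevreyWeight; positivity

@[fun_prop]
theorem measurable_gevreyWeight (σ s : ℝ) : Measurable (gevreyWeight σ s) := by
  unfold gevreyWeight; fun_prop

theorem bracket_le_bracket_two_pi_mul (η : ℝ) : bracket η ≤ bracket (2 * Real.pi * η) := by
  unfold bracket
  rw [abs_mul, abs_of_pos Real.two_pi_pos]
  nlinarith [Real.pi_gt_three, abs_nonneg η]

theorem bracket_two_pi_mul_le (η : ℝ) : bracket (2 * Real.pi * η) ≤ 7 * bracket η := by
  unfold bracket
  rw [abs_mul, abs_of_pos Real.two_pi_pos]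
  nlinarith [Real.pi_lt_d2, abs_nonneg η]

theorem gevreyWeight_split {σ s : ℝ} (η : ℝ) : gevreyWeight σ s η =
    gevreyWeight σ (s - 1 / 4) η * bracket (2 * Real.pi * η) ^ (1 / 4 : ℝ) := by
  unfold gevreyWeight
  rw [mul_assoc (Real.exp _), ← Real.rpow_add (bracket_pos _)]; norm_num

/-- The constant is 1 for every σ, so the exponential weight disappears from the trilinear estimate
without making its constants depend on the radius. -/
theorem gevreyWeight_add_le {σ s : ℝ} (hσ : 0 ≤ σ) (hs : 0 ≤ s) (x y : ℝ) :
    gevreyWeight σ s (x + y) ≤ gevreyWeight σ s x * gevreyWeight σ s y := by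
  have hx := bracket_pos (2 * Real.pi * x)
  have hy := bracket_pos (2 * Real.pi * y)
  have hxy := bracket_pos (2 * Real.pi * (x + y))
  unfold gevreyWeight
  calc _ ≤ Real.exp (σ * |2 * Real.pi * x| + σ * |2 * Real.pi * y|) *
        (bracket (2 * Real.pi * x) * bracket (2 * Real.pi * y)) ^ s := by
        gcongr
        · rw [← mul_add]; gcongr; rw [mul_add]; exact abs_add_le _ _
        · rw [mul_add]; exact bracket_add_le _ _
    _ = _ := by rw [Real.exp_add, Real.mul_rpow hx.le hy.le]; ring

/-- The largest of the three frequencies controls their sum up to the factor 3. -/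
theorem bracket_add_add_rpow_le (x y z : ℝ) : bracket (x + y + z) ^ (3 / 4 : ℝ) ≤
    3 * (bracket x ^ (3 / 4 : ℝ) + bracket y ^ (3 / 4 : ℝ) + bracket z ^ (3 / 4 : ℝ)) := by
  have hx := bracket_pos x
  have hy := bracket_pos y
  have hz := bracket_pos z
  have hxyz := bracket_pos (x + y + z)
  have h3 : (3 : ℝ) ^ (3 / 4 : ℝ) ≤ 3 := by
    calc (3 : ℝ) ^ (3 / 4 : ℝ) ≤ 3 ^ (1 : ℝ) :=
          Real.rpow_le_rpow_of_exponent_le (by norm_num) (by norm_num)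
      _ = 3 := by norm_num
  have hx' : 0 ≤ bracket x ^ (3 / 4 : ℝ) := by positivity
  have hy' : 0 ≤ bracket y ^ (3 / 4 : ℝ) := by positivity
  have hz' : 0 ≤ bracket z ^ (3 / 4 : ℝ) := by positivity
  have key : ∀ w : ℝ, |x + y + z| ≤ 3 * |w| →
      bracket (x + y + z) ^ (3 / 4 : ℝ) ≤ 3 * bracket w ^ (3 / 4 : ℝ) := by
    intro w hw
    have hw0 := bracket_pos w
    calc _ ≤ (3 * bracket w) ^ (3 / 4 : ℝ) := by
          gcongr; unfold bracket; linarith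
      _ = 3 ^ (3 / 4 : ℝ) * bracket w ^ (3 / 4 : ℝ) := Real.mul_rpow (by norm_num) hw0.le
      _ ≤ _ := by gcongr
  have htri : |x + y + z| ≤ |x| + |y| + |z| := abs_add_three x y z
  rcases le_total |x| |y| with h | h
  · rcases le_total |y| |z| with h' | h'
    · linarith [key z (by linarith)]
    · linarith [key y (by linarith)]
  · rcases le_total |x| |z| with h' | h'
    · linarith [key z (by linarith)]
    · linarith [key x (by linarith)]

/-- This is where s ≥ 1/4 enters. The weight of order s - 1/4 cancels by submultiplicativity,
leaving ⟨ξ⟩^{5/4} at the output and ⟨·⟩^{-1/4} at each input. Of the 5/4, one half stays at the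
output and 3/4 moves to the largest input, turning its -1/4 into +1/2. The constant is 21 = 7 · 3,
where 7 bounds 2π. -/
theorem abs_mul_gevreyWeight_le {σ s : ℝ} (hσ : 0 ≤ σ) (hs : 1 / 4 ≤ s) (x y z : ℝ) :
    |x + y + z| * gevreyWeight σ s (x + y + z) *
      ((gevreyWeight σ s x)⁻¹ * (gevreyWeight σ s y)⁻¹ * (gevreyWeight σ s z)⁻¹) ≤
    21 * (bracket (x + y + z) ^ (1 / 2 : ℝ) *
      (bracket x ^ (-(1 / 4) : ℝ) * bracket y ^ (-(1 / 4) : ℝ) * bracket z ^ (1 / 2 : ℝ) +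
       bracket x ^ (-(1 / 4) : ℝ) * bracket z ^ (-(1 / 4) : ℝ) * bracket y ^ (1 / 2 : ℝ) +
       bracket z ^ (-(1 / 4) : ℝ) * bracket y ^ (-(1 / 4) : ℝ) * bracket x ^ (1 / 2 : ℝ))) := by
  have hx := bracket_pos x
  have hy := bracket_pos y
  have hz := bracket_pos z
  have hb := bracket_pos (x + y + z)
  set P : ℝ → ℝ := gevreyWeight σ (s - 1 / 4) with hP
  have hPp : ∀ η, 0 < P η := gevreyWeight_pos σ (s - 1 / 4)
  have hPm : P (x + y + z) ≤ P x * P y * P z :=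
    (gevreyWeight_add_le hσ (by linarith) _ _).trans
      (mul_le_mul_of_nonneg_right (gevreyWeight_add_le hσ (by linarith) _ _) (hPp z).le)
  have hinv : ∀ η, (gevreyWeight σ s η)⁻¹ ≤ (P η)⁻¹ * bracket η ^ (-(1 / 4) : ℝ) := by
    intro η
    have := bracket_pos η
    have := hPp η
    rw [gevreyWeight_split, Real.rpow_neg (by positivity), ← mul_inv]
    gcongr
    exact bracket_le_bracket_two_pi_mul η
  have h7 : gevreyWeight σ s (x + y + z) ≤ P x * P y * P z * (7 * bracket (x + y + z) ^ (1 / 4 : ℝ)) := by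
    rw [gevreyWeight_split]
    have : bracket (2 * Real.pi * (x + y + z)) ^ (1 / 4 : ℝ) ≤ 7 * bracket (x + y + z) ^ (1 / 4 : ℝ) := by
      have := bracket_pos (2 * Real.pi * (x + y + z))
      calc _ ≤ (7 * bracket (x + y + z)) ^ (1 / 4 : ℝ) := by
            gcongr; exact bracket_two_pi_mul_le _
        _ = 7 ^ (1 / 4 : ℝ) * bracket (x + y + z) ^ (1 / 4 : ℝ) := Real.mul_rpow (by norm_num) hb.le
        _ ≤ _ := by
            gcongr
            calc (7 : ℝ) ^ (1 / 4 : ℝ) ≤ 7 ^ (1 : ℝ) :=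
                  Real.rpow_le_rpow_of_exponent_le (by norm_num) (by norm_num)
              _ = 7 := by norm_num
    have h1 := hPp x
    have h2 := hPp y
    have h3 := hPp z
    have := bracket_pos (2 * Real.pi * (x + y + z))
    exact mul_le_mul hPm ‹_› (by positivity) (by positivity)
  have habs : |x + y + z| ≤ bracket (x + y + z) := by unfold bracket; linarith
  have h34 : ∀ w : ℝ, bracket w ^ (3 / 4 : ℝ) * bracket w ^ (-(1 / 4) : ℝ) = bracket w ^ (1 / 2 : ℝ) := by
    intro w; rw [← Real.rpow_add (bracket_pos w)]; norm_num
  have h54 : bracket (x + y + z) * bracket (x + y + z) ^ (1 / 4 : ℝ) =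
      bracket (x + y + z) ^ (1 / 2 : ℝ) * bracket (x + y + z) ^ (3 / 4 : ℝ) := by
    nth_rewrite 1 [← Real.rpow_one (bracket (x + y + z))]
    rw [← Real.rpow_add hb, ← Real.rpow_add hb]; norm_num
  have p1 := hPp x
  have p2 := hPp y
  have p3 := hPp z
  have g1 := gevreyWeight_pos σ s x
  have g2 := gevreyWeight_pos σ s y
  have g3 := gevreyWeight_pos σ s z
  have g4 := gevreyWeight_pos σ s (x + y + z)
  calc _ ≤ bracket (x + y + z) * (P x * P y * P z * (7 * bracket (x + y + z) ^ (1 / 4 : ℝ))) *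
        (((P x)⁻¹ * bracket x ^ (-(1 / 4) : ℝ)) * ((P y)⁻¹ * bracket y ^ (-(1 / 4) : ℝ)) *
          ((P z)⁻¹ * bracket z ^ (-(1 / 4) : ℝ))) := by
        gcongr
        · exact hinv x
        · exact hinv y
        · exact hinv z
    _ = 7 * (bracket (x + y + z) * bracket (x + y + z) ^ (1 / 4 : ℝ)) *
        (bracket x ^ (-(1 / 4) : ℝ) * bracket y ^ (-(1 / 4) : ℝ) * bracket z ^ (-(1 / 4) : ℝ)) := by
        field_simp
    _ ≤ 7 * (bracket (x + y + z) ^ (1 / 2 : ℝ) *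
          (3 * (bracket x ^ (3 / 4 : ℝ) + bracket y ^ (3 / 4 : ℝ) + bracket z ^ (3 / 4 : ℝ)))) *
        (bracket x ^ (-(1 / 4) : ℝ) * bracket y ^ (-(1 / 4) : ℝ) * bracket z ^ (-(1 / 4) : ℝ)) := by
        rw [h54]
        gcongr
        exact bracket_add_add_rpow_le x y z
    _ = _ := by
        rw [← h34 x, ← h34 y, ← h34 z]; ring

/-- The inverse `ρ⁻¹ L^{-9/16}` of the weight of the Gevrey-Bourgain space. -/
noncomputable def inverseWeight (κ σ s : ℝ) (z : ℝ × ℝ) : ℝ≥0∞ :=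
  ENNReal.ofReal ((gevreyWeight σ s z.1)⁻¹ * modulation κ z ^ (-(9 / 16) : ℝ))

/-- The factor `|z.1|` is the derivative in the nonlinearity, and -3/8 is the modulation exponent
that the Duhamel operator can recover. -/
noncomputable def outputWeight (κ σ s : ℝ) (z : ℝ × ℝ) : ℝ≥0∞ :=
  ENNReal.ofReal (|z.1| * gevreyWeight σ s z.1 * modulation κ z ^ (-(3 / 8) : ℝ))

@[fun_prop]
theorem measurable_inverseWeight (κ σ s : ℝ) : Measurable (inverseWeight κ σ s) := by
  unfold inverseWeight; fun_prop

@[fun_prop]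
theorem measurable_outputWeight (κ σ s : ℝ) : Measurable (outputWeight κ σ s) := by
  unfold outputWeight; fun_prop

/-- Each term singles out one input as the high one. For that input L^{-9/16} is relaxed to
L^{-3/8}, the exponent that `highWeight` asks for. -/
theorem outputWeight_mul_le {κ σ s : ℝ} (hσ : 0 ≤ σ) (hs : 1 / 4 ≤ s) (x y z : ℝ × ℝ) :
    outputWeight κ σ s (x + y + z) *
      (inverseWeight κ σ s x * inverseWeight κ σ s y * inverseWeight κ σ s z) ≤
    21 * (highWeight κ (x + y + z) * (lowWeight κ x * lowWeight κ y * highWeight κ z) +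
      highWeight κ (x + y + z) * (lowWeight κ x * lowWeight κ z * highWeight κ y) +
      highWeight κ (x + y + z) * (lowWeight κ z * lowWeight κ y * highWeight κ x)) := by
  have hx := bracket_pos x.1
  have hy := bracket_pos y.1
  have hz := bracket_pos z.1
  have hb := bracket_pos (x + y + z).1
  have g1 := gevreyWeight_pos σ s x.1
  have g2 := gevreyWeight_pos σ s y.1
  have g3 := gevreyWeight_pos σ s z.1
  have g4 := gevreyWeight_pos σ s (x + y + z).1
  have m1 := modulation_pos κ x
  have m2 := modulation_pos κ y
  have m3 := modulation_pos κ z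
  have m4 := modulation_pos κ (x + y + z)
  have hmod : ∀ w : ℝ × ℝ, modulation κ w ^ (-(9 / 16) : ℝ) ≤ modulation κ w ^ (-(3 / 8) : ℝ) :=
    fun w => Real.rpow_le_rpow_of_exponent_le (one_le_modulation κ w) (by norm_num)
  unfold outputWeight inverseWeight highWeight lowWeight
  have h21 : (21 : ℝ≥0∞) = ENNReal.ofReal 21 := by norm_num
  rw [h21]
  simp (disch := positivity) only [← ENNReal.ofReal_mul, ← ENNReal.ofReal_add]
  apply ENNReal.ofReal_le_ofReal
  have key := abs_mul_gevreyWeight_le hσ hs x.1 y.1 z.1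
  simp only [Prod.fst_add] at *
  set M := modulation κ (x + y + z) ^ (-(3 / 8) : ℝ) with hM
  set a := modulation κ x ^ (-(9 / 16) : ℝ) with ha
  set b := modulation κ y ^ (-(9 / 16) : ℝ) with hb'
  set c := modulation κ z ^ (-(9 / 16) : ℝ) with hc
  have hM0 : 0 < M := by positivity
  have ha0 : 0 < a := by positivity
  have hb0 : 0 < b := by positivity
  have hc0 : 0 < c := by positivity
  calc _ = (|x.1 + y.1 + z.1| * gevreyWeight σ s (x.1 + y.1 + z.1) *
      ((gevreyWeight σ s x.1)⁻¹ * (gevreyWeight σ s y.1)⁻¹ * (gevreyWeight σ s z.1)⁻¹)) *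
        (M * (a * b * c)) := by ring
    _ ≤ 21 * (bracket (x.1 + y.1 + z.1) ^ (1 / 2 : ℝ) *
      (bracket x.1 ^ (-(1 / 4) : ℝ) * bracket y.1 ^ (-(1 / 4) : ℝ) * bracket z.1 ^ (1 / 2 : ℝ) +
       bracket x.1 ^ (-(1 / 4) : ℝ) * bracket z.1 ^ (-(1 / 4) : ℝ) * bracket y.1 ^ (1 / 2 : ℝ) +
       bracket z.1 ^ (-(1 / 4) : ℝ) * bracket y.1 ^ (-(1 / 4) : ℝ) * bracket x.1 ^ (1 / 2 : ℝ))) *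
        (M * (a * b * c)) := by gcongr
    _ = 21 * (bracket (x.1 + y.1 + z.1) ^ (1 / 2 : ℝ) * M *
          (bracket x.1 ^ (-(1 / 4) : ℝ) * a * (bracket y.1 ^ (-(1 / 4) : ℝ) * b) *
            (bracket z.1 ^ (1 / 2 : ℝ) * c)) +
        bracket (x.1 + y.1 + z.1) ^ (1 / 2 : ℝ) * M *
          (bracket x.1 ^ (-(1 / 4) : ℝ) * a * (bracket z.1 ^ (-(1 / 4) : ℝ) * c) *
            (bracket y.1 ^ (1 / 2 : ℝ) * b)) +
        bracket (x.1 + y.1 + z.1) ^ (1 / 2 : ℝ) * M *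
          (bracket z.1 ^ (-(1 / 4) : ℝ) * c * (bracket y.1 ^ (-(1 / 4) : ℝ) * b) *
            (bracket x.1 ^ (1 / 2 : ℝ) * a))) := by ring
    _ ≤ _ := by
        gcongr
        · exact hmod z
        · exact hmod y
        · exact hmod x

theorem lintegral_three_add {V : Type*} [MeasureSpace V] [SFinite (volume : Measure V)]
    {F G : V × V × V → ℝ≥0∞} (hF : Measurable F) :
    ∫⁻ x, ∫⁻ y, ∫⁻ z, (F (x, y, z) + G (x, y, z)) =
      (∫⁻ x, ∫⁻ y, ∫⁻ z, F (x, y, z)) + ∫⁻ x, ∫⁻ y, ∫⁻ z, G (x, y, z) := by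
  have h1 : Measurable fun p : V × V => ∫⁻ z, F (p.1, p.2, z) :=
    Measurable.lintegral_prod_right' (f := fun q : (V × V) × V => F (q.1.1, q.1.2, q.2))
      (hF.comp (by fun_prop))
  rw [← lintegral_add_left h1.lintegral_prod_right']
  refine lintegral_congr fun x => ?_
  simp only
  rw [← lintegral_add_left (f := fun y => ∫⁻ z, F (x, y, z)) (h1.comp measurable_prodMk_left)]
  refine lintegral_congr fun y => ?_
  exact lintegral_add_left (hF.comp (by fun_prop : Measurable fun z : V => (x, y, z))) _

theorem lintegral_three_add_add {V : Type*} [MeasureSpace V] [SFinite (volume : Measure V)]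
    {F G H : V → V → V → ℝ≥0∞} (hF : Measurable fun p : V × V × V => F p.1 p.2.1 p.2.2)
    (hG : Measurable fun p : V × V × V => G p.1 p.2.1 p.2.2) :
    ∫⁻ x, ∫⁻ y, ∫⁻ z, (F x y z + G x y z + H x y z) =
      (∫⁻ x, ∫⁻ y, ∫⁻ z, F x y z) + (∫⁻ x, ∫⁻ y, ∫⁻ z, G x y z) + ∫⁻ x, ∫⁻ y, ∫⁻ z, H x y z := by
  rw [lintegral_three_add (F := fun p => F p.1 p.2.1 p.2.2 + G p.1 p.2.1 p.2.2) (hF.add hG)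
    (G := fun p => H p.1 p.2.1 p.2.2), lintegral_three_add hF (G := fun p => G p.1 p.2.1 p.2.2)]

theorem lintegral_three_swap_right {V : Type*} [MeasureSpace V] [SFinite (volume : Measure V)]
    {F : V × V × V → ℝ≥0∞} (hF : Measurable F) :
    ∫⁻ x, ∫⁻ y, ∫⁻ z, F (x, z, y) = ∫⁻ x, ∫⁻ y, ∫⁻ z, F (x, y, z) := by
  refine lintegral_congr fun x => ?_
  exact lintegral_lintegral_swap (f := fun y z => F (x, z, y))
    (hF.comp (by fun_prop : Measurable fun q : V × V => (x, q.2, q.1))).aemeasurable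

theorem lintegral_three_swap_left {V : Type*} [MeasureSpace V] [SFinite (volume : Measure V)]
    {F : V × V × V → ℝ≥0∞} (hF : Measurable F) :
    ∫⁻ x, ∫⁻ y, ∫⁻ z, F (y, x, z) = ∫⁻ x, ∫⁻ y, ∫⁻ z, F (x, y, z) := by
  refine lintegral_lintegral_swap (f := fun x y => ∫⁻ z, F (y, x, z)) (Measurable.aemeasurable ?_)
  exact Measurable.lintegral_prod_right' (f := fun q : (V × V) × V => F (q.1.2, q.1.1, q.2))
    (hF.comp (by fun_prop))

theorem lintegral_three_swap_outer {V : Type*} [MeasureSpace V] [SFinite (volume : Measure V)]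
    {F : V × V × V → ℝ≥0∞} (hF : Measurable F) :
    ∫⁻ x, ∫⁻ y, ∫⁻ z, F (z, y, x) = ∫⁻ x, ∫⁻ y, ∫⁻ z, F (x, y, z) := by
  rw [← lintegral_three_swap_right (F := fun p => F (p.2.2, p.2.1, p.1))
    (hF.comp (by fun_prop : Measurable fun p : V × V × V => (p.2.2, p.2.1, p.1)))]
  rw [lintegral_three_swap_left (F := fun p => F (p.1, p.2.2, p.2.1))
    (hF.comp (by fun_prop : Measurable fun p : V × V × V => (p.1, p.2.2, p.2.1)))]
  exact lintegral_three_swap_right hF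

/-- The trilinear estimate at regularity `s ≥ 1/4`, in dual form. -/
theorem exists_trilinear_le : ∃ C : ℝ≥0, ∀ κ σ s : ℝ, 1 ≤ 3 * κ → 0 ≤ σ → 1 / 4 ≤ s →
    ∀ g f₁ f₂ f₃ : ℝ × ℝ → ℝ≥0∞, Measurable g → Measurable f₁ → Measurable f₂ → Measurable f₃ →
    (∫⁻ z₁, ∫⁻ z₂, ∫⁻ z₃, outputWeight κ σ s (z₁ + z₂ + z₃) * g (z₁ + z₂ + z₃) *
      (inverseWeight κ σ s z₁ * f₁ z₁ * (inverseWeight κ σ s z₂ * f₂ z₂) *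
        (inverseWeight κ σ s z₃ * f₃ z₃))) ^ 2 ≤
      C * ((∫⁻ z, g z ^ 2) * (∫⁻ z, f₁ z ^ 2) * (∫⁻ z, f₂ z ^ 2) * ∫⁻ z, f₃ z ^ 2) := by
  obtain ⟨C, hC⟩ := exists_quadrilinear_le
  -- The inequality (a + b)² ≤ 2(a² + b²) used twice on three terms, each with square at most `C *
  -- N`, gives 2(2 · 2 + 1) = 10.
  refine ⟨21 ^ 2 * (10 * C), fun κ σ s hκ hσ hs g f₁ f₂ f₃ hg h₁ h₂ h₃ => ?_⟩
  obtain ⟨Φ, hΦd⟩ : ∃ Φ : (ℝ × ℝ → ℝ≥0∞) → (ℝ × ℝ → ℝ≥0∞) → (ℝ × ℝ → ℝ≥0∞) → ℝ × ℝ → ℝ × ℝ → ℝ × ℝ → ℝ≥0∞,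
    Φ = fun f₁ f₂ f₃ z₁ z₂ z₃ => highWeight κ (z₁ + z₂ + z₃) * g (z₁ + z₂ + z₃) *
      (lowWeight κ z₁ * f₁ z₁ * (lowWeight κ z₂ * f₂ z₂) * (highWeight κ z₃ * f₃ z₃)) :=
    ⟨_, rfl⟩
  have hΦ : ∀ a b c : ℝ × ℝ → ℝ≥0∞, Measurable a → Measurable b → Measurable c →
      Measurable fun p : (ℝ × ℝ) × (ℝ × ℝ) × (ℝ × ℝ) => Φ a b c p.1 p.2.1 p.2.2 := by
    intro a b c ha hb hc
    simp only [hΦd]; fun_prop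
  set N := ((∫⁻ z, g z ^ 2) * (∫⁻ z, f₁ z ^ 2) * (∫⁻ z, f₂ z ^ 2) * ∫⁻ z, f₃ z ^ 2) with hN
  set I₁ := ∫⁻ z₁, ∫⁻ z₂, ∫⁻ z₃, Φ f₁ f₂ f₃ z₁ z₂ z₃ with hI₁
  set I₂ := ∫⁻ z₁, ∫⁻ z₂, ∫⁻ z₃, Φ f₁ f₃ f₂ z₁ z₃ z₂ with hI₂
  set I₃ := ∫⁻ z₁, ∫⁻ z₂, ∫⁻ z₃, Φ f₃ f₂ f₁ z₃ z₂ z₁ with hI₃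
  have hA₁ : I₁ ^ 2 ≤ C * N :=
    by rw [hI₁, hΦd]; exact hC κ hκ g f₁ f₂ f₃ hg h₁ h₂ h₃
  have hA₂ : I₂ ^ 2 ≤ C * N := by
    have e : I₂ = ∫⁻ z₁, ∫⁻ z₂, ∫⁻ z₃, Φ f₁ f₃ f₂ z₁ z₂ z₃ :=
      lintegral_three_swap_right (hΦ f₁ f₃ f₂ h₁ h₃ h₂)
    rw [e, hΦd]
    refine (hC κ hκ g f₁ f₃ f₂ hg h₁ h₃ h₂).trans_eq ?_
    ring
  have hA₃ : I₃ ^ 2 ≤ C * N := by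
    have e : I₃ = ∫⁻ z₁, ∫⁻ z₂, ∫⁻ z₃, Φ f₃ f₂ f₁ z₁ z₂ z₃ :=
      lintegral_three_swap_outer (hΦ f₃ f₂ f₁ h₃ h₂ h₁)
    rw [e, hΦd]
    refine (hC κ hκ g f₃ f₂ f₁ hg h₃ h₂ h₁).trans_eq ?_
    ring
  have hle : (∫⁻ z₁, ∫⁻ z₂, ∫⁻ z₃, outputWeight κ σ s (z₁ + z₂ + z₃) * g (z₁ + z₂ + z₃) *
      (inverseWeight κ σ s z₁ * f₁ z₁ * (inverseWeight κ σ s z₂ * f₂ z₂) *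
        (inverseWeight κ σ s z₃ * f₃ z₃))) ≤ 21 * (I₁ + I₂ + I₃) := by
    calc _ ≤ ∫⁻ z₁, ∫⁻ z₂, ∫⁻ z₃, 21 * (Φ f₁ f₂ f₃ z₁ z₂ z₃ + Φ f₁ f₃ f₂ z₁ z₃ z₂ +
          Φ f₃ f₂ f₁ z₃ z₂ z₁) := by
          refine lintegral_mono fun z₁ => lintegral_mono fun z₂ => lintegral_mono fun z₃ => ?_
          have key := outputWeight_mul_le hσ hs (κ := κ) z₁ z₂ z₃
          simp only [hΦd]
          rw [show z₁ + z₃ + z₂ = z₁ + z₂ + z₃ by abel, show z₃ + z₂ + z₁ = z₁ + z₂ + z₃ by abel]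
          calc _ = (outputWeight κ σ s (z₁ + z₂ + z₃) *
                (inverseWeight κ σ s z₁ * inverseWeight κ σ s z₂ * inverseWeight κ σ s z₃)) *
                  (g (z₁ + z₂ + z₃) * f₁ z₁ * f₂ z₂ * f₃ z₃) := by ring
            _ ≤ _ := mul_le_mul' key le_rfl
            _ = _ := by ring
      _ = 21 * ∫⁻ z₁, ∫⁻ z₂, ∫⁻ z₃, (Φ f₁ f₂ f₃ z₁ z₂ z₃ + Φ f₁ f₃ f₂ z₁ z₃ z₂ +
          Φ f₃ f₂ f₁ z₃ z₂ z₁) := by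
          have h21 : (21 : ℝ≥0∞) ≠ ∞ := by norm_num
          rw [← lintegral_const_mul' _ _ h21]
          refine lintegral_congr fun z₁ => ?_
          rw [← lintegral_const_mul' _ _ h21]
          refine lintegral_congr fun z₂ => ?_
          rw [← lintegral_const_mul' _ _ h21]
      _ = 21 * (I₁ + I₂ + I₃) := by
          have m1 := hΦ f₁ f₂ f₃ h₁ h₂ h₃
          have m2 : Measurable fun p : (ℝ × ℝ) × (ℝ × ℝ) × (ℝ × ℝ) => Φ f₁ f₃ f₂ p.1 p.2.2 p.2.1 :=
            (hΦ f₁ f₃ f₂ h₁ h₃ h₂).comp (by fun_prop :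
              Measurable fun p : (ℝ × ℝ) × (ℝ × ℝ) × (ℝ × ℝ) => (p.1, p.2.2, p.2.1))
          rw [lintegral_three_add_add (F := Φ f₁ f₂ f₃) (G := fun a b c => Φ f₁ f₃ f₂ a c b)
            (H := fun a b c => Φ f₃ f₂ f₁ c b a) m1 m2]
  refine (pow_le_pow_left' hle 2).trans ?_
  clear_value I₁ I₂ I₃ N
  calc (21 * (I₁ + I₂ + I₃)) ^ 2
      = 21 ^ 2 * (I₁ + I₂ + I₃) ^ 2 := by ring
    _ ≤ 21 ^ 2 * (2 * (2 * (I₁ ^ 2 + I₂ ^ 2) + I₃ ^ 2)) := by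
        gcongr
        refine (add_sq_le_two_mul _ _).trans ?_
        gcongr
        exact add_sq_le_two_mul _ _
    _ ≤ 21 ^ 2 * (2 * (2 * (C * N +
          C * N) +
          C * N)) := by gcongr
    _ = _ := by push_cast; ring

/-! ### The time cutoff and the Duhamel kernel. -/

/-- The character `e^{2πix}`. -/
noncomputable def wave (x : ℝ) : ℂ := Complex.exp ((2 * Real.pi * x : ℝ) * Complex.I)

theorem norm_wave (x : ℝ) : ‖wave x‖ = 1 := Complex.norm_exp_ofReal_mul_I _

theorem wave_add (x y : ℝ) : wave (x + y) = wave x * wave y := by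
  unfold wave; rw [← Complex.exp_add]; push_cast; ring_nf

theorem wave_zero : wave 0 = 1 := by simp [wave]

theorem conj_wave (x : ℝ) : (starRingEnd ℂ) (wave x) = wave (-x) := by
  unfold wave
  rw [← Complex.exp_conj, map_mul, Complex.conj_I, Complex.conj_ofReal]
  push_cast; ring_nf

@[fun_prop]
theorem continuous_wave : Continuous wave := by unfold wave; fun_prop

@[fun_prop]
theorem measurable_wave : Measurable wave := continuous_wave.measurable

theorem fourierInv_eq_integral_wave (f : ℝ → ℂ) (x : ℝ) : 𝓕⁻ f x = ∫ η, wave (x * η) * f η := by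
  rw [Real.fourierInv_eq']
  refine integral_congr_ae (Eventually.of_forall fun η => ?_)
  simp only [wave, smul_eq_mul, RCLike.inner_apply, conj_trivial]

theorem fourier_eq_integral_wave (f : ℝ → ℂ) (x : ℝ) : 𝓕 f x = ∫ η, wave (-(x * η)) * f η := by
  rw [Real.fourier_eq']
  refine integral_congr_ae (Eventually.of_forall fun η => ?_)
  simp only [wave, smul_eq_mul, RCLike.inner_apply, conj_trivial]
  ring_nf

noncomputable def cutoffBump : ContDiffBump (0 : ℝ) := ⟨1, 2, one_pos, one_lt_two⟩

/-- A smooth compactly supported function equal to `1` on `[-1,1]`. -/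
noncomputable def timeCutoff : SchwartzMap ℝ ℂ :=
  (cutoffBump.hasCompactSupport.comp_left (g := fun x : ℝ => (x : ℂ)) Complex.ofReal_zero).toSchwartzMap
    (Complex.ofRealCLM.contDiff.comp cutoffBump.contDiff)

theorem timeCutoff_apply (t : ℝ) : timeCutoff t = (cutoffBump t : ℂ) := rfl

theorem timeCutoff_eq_one {t : ℝ} (ht : |t| ≤ 1) : timeCutoff t = 1 := by
  rw [timeCutoff_apply, cutoffBump.one_of_mem_closedBall, Complex.ofReal_one]
  simpa [cutoffBump, Metric.mem_closedBall, Real.dist_eq] using ht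

noncomputable def cutoffHat (x : ℝ) : ℂ := (𝓕 timeCutoff) x

theorem contDiff_cutoffHat : ContDiff ℝ 1 cutoffHat := (𝓕 timeCutoff).smooth 1

@[fun_prop]
theorem continuous_cutoffHat : Continuous cutoffHat := contDiff_cutoffHat.continuous

@[fun_prop]
theorem measurable_cutoffHat : Measurable cutoffHat := continuous_cutoffHat.measurable

theorem integrable_cutoffHat : Integrable cutoffHat := (𝓕 timeCutoff).integrable

theorem integral_wave_mul_cutoffHat (t : ℝ) : ∫ x, wave (t * x) * cutoffHat x = timeCutoff t := by
  rw [← fourierInv_eq_integral_wave]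
  have h : 𝓕⁻ (𝓕 timeCutoff) = timeCutoff := FourierTransform.fourierInv_fourier_eq _
  have h2 := SchwartzMap.fourierInv_coe (𝓕 timeCutoff)
  rw [h] at h2
  exact (congrFun h2 t).symm

theorem conj_cutoffHat (x : ℝ) : (starRingEnd ℂ) (cutoffHat (-x)) = cutoffHat x := by
  have h : ∀ y, cutoffHat y = ∫ t, wave (-(y * t)) * timeCutoff t :=
    fun y => fourier_eq_integral_wave timeCutoff y
  rw [h, h, ← integral_conj]
  refine integral_congr_ae (Eventually.of_forall fun t => ?_)
  simp only [map_mul, conj_wave, timeCutoff_apply, Complex.conj_ofReal]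
  ring_nf

theorem exists_norm_schwartz_le (f : SchwartzMap ℝ ℂ) :
    ∃ C : ℝ, 0 ≤ C ∧ ∀ x, ‖f x‖ ≤ C * bracket x ^ (-2 : ℝ) ∧ ‖deriv f x‖ ≤ C * bracket x ^ (-2 : ℝ) := by
  have key : ∀ g : SchwartzMap ℝ ℂ, ∃ C : ℝ, 0 ≤ C ∧ ∀ x, ‖g x‖ ≤ C * bracket x ^ (-2 : ℝ) := by
    intro g
    refine ⟨2 ^ 2 * (Finset.Iic (2, 0)).sup (fun m => SchwartzMap.seminorm ℝ m.1 m.2) g,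
      by positivity, fun x => ?_⟩
    have h := SchwartzMap.one_add_le_sup_seminorm_apply (𝕜 := ℝ) (m := (2, 0)) (k := 2) (n := 0)
      le_rfl le_rfl g x
    rw [norm_iteratedFDeriv_zero] at h
    have hb := bracket_pos x
    rw [Real.rpow_neg hb.le, ← div_eq_mul_inv, le_div_iff₀ (by positivity)]
    rw [Real.rpow_two, mul_comm]
    exact h
  obtain ⟨C, hC, h⟩ := key f
  obtain ⟨D, hD, h'⟩ := key (SchwartzMap.derivCLM ℝ ℂ f)
  refine ⟨C + D, by positivity, fun x => ⟨(h x).trans ?_, (h' x).trans ?_⟩⟩ <;>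
  · have := bracket_pos x
    gcongr; linarith

/-- For |y| ≥ 1 the division by |y| gives the decay and the triangle inequality suffices. For |y| ≤
1 the mean value inequality cancels the denominator, the derivative being as small on the unit
interval around x as at x. -/
theorem exists_cutoffHat_sub_le : ∃ C : ℝ, 0 ≤ C ∧ ∀ x y : ℝ, y ≠ 0 →
    ‖cutoffHat (x - y) - cutoffHat x‖ / |y| ≤
      C * (bracket y ^ (-1 : ℝ) * (bracket (x - y) ^ (-2 : ℝ) + bracket x ^ (-2 : ℝ))) := by
  obtain ⟨C, hC, h⟩ := exists_norm_schwartz_le (𝓕 timeCutoff)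
  refine ⟨8 * C, by positivity, fun x y hy => ?_⟩
  have hy0 : 0 < |y| := abs_pos.2 hy
  have hb := bracket_pos y
  have hbx := bracket_pos x
  have hbxy := bracket_pos (x - y)
  rw [Real.rpow_neg_one]
  rcases le_total 1 |y| with h1 | h1
  · have e : |y|⁻¹ ≤ 2 * (bracket y)⁻¹ := by
      rw [← div_eq_mul_inv, inv_eq_one_div, div_le_div_iff₀ hy0 hb]; unfold bracket; linarith
    have e2 : ‖cutoffHat (x - y) - cutoffHat x‖ ≤
        C * (bracket (x - y) ^ (-2 : ℝ) + bracket x ^ (-2 : ℝ)) := by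
      refine (norm_sub_le _ _).trans ?_
      rw [mul_add]
      exact add_le_add (h _).1 (h _).1
    calc _ = ‖cutoffHat (x - y) - cutoffHat x‖ * |y|⁻¹ := div_eq_mul_inv _ _
      _ ≤ C * (bracket (x - y) ^ (-2 : ℝ) + bracket x ^ (-2 : ℝ)) * (2 * (bracket y)⁻¹) := by gcongr
      _ ≤ 4 * (C * (bracket (x - y) ^ (-2 : ℝ) + bracket x ^ (-2 : ℝ)) * (2 * (bracket y)⁻¹)) :=
          le_mul_of_one_le_left (by positivity) (by norm_num)
      _ = _ := by ring
  · have e : 1 ≤ 2 * (bracket y)⁻¹ := by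
      rw [← div_eq_mul_inv, le_div_iff₀ hb]; unfold bracket; linarith
    have e2 : ‖cutoffHat (x - y) - cutoffHat x‖ ≤ 4 * C * bracket x ^ (-2 : ℝ) * |y| := by
      have hd : ∀ z ∈ Metric.closedBall x 1, ‖deriv cutoffHat z‖ ≤ 4 * C * bracket x ^ (-2 : ℝ) := by
        intro z hz
        refine (h z).2.trans ?_
        have hz' : |z - x| ≤ 1 := by simpa [Real.dist_eq] using hz
        have hbz : bracket x / 2 ≤ bracket z := by
          have := abs_sub_abs_le_abs_sub x z
          rw [abs_sub_comm] at this
          unfold bracket; linarith [abs_nonneg z]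
        have : bracket z ^ (-2 : ℝ) ≤ 4 * bracket x ^ (-2 : ℝ) := by
          refine (rpow_neg_le_rpow_neg (by positivity) hbz (by norm_num)).trans_eq ?_
          rw [Real.rpow_neg (by positivity), Real.rpow_neg hbx.le, Real.rpow_two, Real.rpow_two]
          field_simp; norm_num
        calc _ ≤ C * (4 * bracket x ^ (-2 : ℝ)) := by gcongr
          _ = _ := by ring
      have := (convex_closedBall x 1).norm_image_sub_le_of_norm_deriv_le (f := cutoffHat)
        (fun z _ => (contDiff_cutoffHat.differentiable one_ne_zero).differentiableAt) hd
        (Metric.mem_closedBall_self zero_le_one)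
        (show x - y ∈ Metric.closedBall x 1 by simpa [Real.dist_eq] using h1)
      simpa using this
    calc _ ≤ 4 * C * bracket x ^ (-2 : ℝ) * |y| / |y| := by gcongr
      _ = 4 * C * bracket x ^ (-2 : ℝ) * 1 := by field_simp
      _ ≤ 4 * C * (bracket (x - y) ^ (-2 : ℝ) + bracket x ^ (-2 : ℝ)) * (2 * (bracket y)⁻¹) := by
          gcongr
          exact le_add_of_nonneg_left (by positivity)
      _ = _ := by ring

/-- The kernel of the localized Duhamel operator in the modulation variables. -/
noncomputable def duhamelKernel (T x y : ℝ) : ℂ :=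
  T * (cutoffHat (T * (x - y)) - cutoffHat (T * x)) / (2 * Real.pi * y * Complex.I)

@[fun_prop]
theorem measurable_duhamelKernel (T : ℝ) :
    Measurable fun p : ℝ × ℝ => duhamelKernel T p.1 p.2 := by
  unfold duhamelKernel; fun_prop

theorem conj_duhamelKernel (T x y : ℝ) :
    (starRingEnd ℂ) (duhamelKernel T (-x) (-y)) = duhamelKernel T x y := by
  unfold duhamelKernel
  simp only [map_div₀, map_mul, map_sub, Complex.conj_ofReal, Complex.conj_I, map_ofNat]
  rw [show T * (-x - -y) = -(T * (x - y)) by ring, show T * -x = -(T * x) by ring,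
    conj_cutoffHat, conj_cutoffHat]
  push_cast; ring_nf

theorem bracket_le_inv_mul {T : ℝ} (hT : 0 < T) (hT1 : T ≤ 1) (x : ℝ) :
    bracket x ≤ T⁻¹ * bracket (T * x) := by
  have : 1 ≤ T⁻¹ := (one_le_inv₀ hT).2 hT1
  unfold bracket
  rw [abs_mul, abs_of_pos hT, mul_add, ← mul_assoc, inv_mul_cancel₀ hT.ne']; linarith

/-- Each bracket is compared with the bracket at the scaled point T·x, at the cost of T⁻¹ to its
power. With the T² from the kernel this leaves T^{2 - 9/16 - 3/8} = T^{1/16} · T. The surplus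
T^{1/16} makes the Duhamel term small; the other factor T normalizes the scaled kernels. -/
theorem exists_duhamelKernel_le : ∃ C : ℝ, 0 ≤ C ∧ ∀ T : ℝ, 0 < T → T ≤ 1 → ∀ x y : ℝ,
    bracket x ^ (9 / 16 : ℝ) * ‖duhamelKernel T x y‖ * bracket y ^ (3 / 8 : ℝ) ≤
      C * T ^ (1 / 16 : ℝ) * (T * bracket (T * (x - y)) ^ (-(23 / 16) : ℝ) +
        T * (bracket (T * x) ^ (-(23 / 16) : ℝ) * bracket (T * y) ^ (-(5 / 8) : ℝ))) := by
  obtain ⟨C, hC, h⟩ := exists_cutoffHat_sub_le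
  refine ⟨C, hC, fun T hT hT1 x y => ?_⟩
  have hx := bracket_pos x
  have hy := bracket_pos y
  have hX := bracket_pos (T * x)
  have hY := bracket_pos (T * y)
  have hXY := bracket_pos (T * (x - y))
  -- At y = 0 the kernel is a division by zero and has the default value 0.
  rcases eq_or_ne y 0 with rfl | hy0
  · simp only [duhamelKernel, Complex.ofReal_zero, mul_zero, zero_mul, div_zero, norm_zero]
    positivity
  have hTy : T * y ≠ 0 := mul_ne_zero hT.ne' hy0
  have h1 := h (T * x) (T * y) hTy
  rw [← mul_sub] at h1
  have hK : ‖duhamelKernel T x y‖ ≤ T ^ 2 * (C * (bracket (T * y) ^ (-1 : ℝ) *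
      (bracket (T * (x - y)) ^ (-2 : ℝ) + bracket (T * x) ^ (-2 : ℝ)))) := by
    have hy' : 0 < |y| := abs_pos.2 hy0
    have e : ‖duhamelKernel T x y‖ =
        T * ‖cutoffHat (T * (x - y)) - cutoffHat (T * x)‖ / (2 * Real.pi * |y|) := by
      unfold duhamelKernel
      rw [norm_div, norm_mul, norm_mul, norm_mul, norm_mul]
      simp [abs_of_pos hT, abs_of_pos Real.pi_pos]
    have e2 : ‖cutoffHat (T * (x - y)) - cutoffHat (T * x)‖ / |T * y| =
        ‖cutoffHat (T * (x - y)) - cutoffHat (T * x)‖ / (T * |y|) := by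
      rw [abs_mul, abs_of_pos hT]
    rw [e2] at h1
    calc _ ≤ T * ‖cutoffHat (T * (x - y)) - cutoffHat (T * x)‖ / |y| := by
          rw [e]; gcongr; nlinarith [Real.pi_gt_three]
      _ = T ^ 2 * (‖cutoffHat (T * (x - y)) - cutoffHat (T * x)‖ / (T * |y|)) := by field_simp
      _ ≤ _ := by gcongr
  have hbx : bracket x ^ (9 / 16 : ℝ) ≤ T ^ (-(9 / 16) : ℝ) * bracket (T * x) ^ (9 / 16 : ℝ) := by
    refine (Real.rpow_le_rpow hx.le (bracket_le_inv_mul hT hT1 x) (by norm_num)).trans_eq ?_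
    rw [Real.mul_rpow (by positivity) hX.le, Real.inv_rpow hT.le, Real.rpow_neg hT.le]
  have hby : bracket y ^ (3 / 8 : ℝ) ≤ T ^ (-(3 / 8) : ℝ) * bracket (T * y) ^ (3 / 8 : ℝ) := by
    refine (Real.rpow_le_rpow hy.le (bracket_le_inv_mul hT hT1 y) (by norm_num)).trans_eq ?_
    rw [Real.mul_rpow (by positivity) hY.le, Real.inv_rpow hT.le, Real.rpow_neg hT.le]
  have hpow : T ^ (-(9 / 16) : ℝ) * T ^ (2 : ℝ) * T ^ (-(3 / 8) : ℝ) = T ^ (1 / 16 : ℝ) * T := by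
    nth_rewrite 5 [← Real.rpow_one T]
    rw [← Real.rpow_add hT, ← Real.rpow_add hT, ← Real.rpow_add hT]; norm_num
  have hX1 : bracket (T * x) ^ (9 / 16 : ℝ) ≤
      bracket (T * y) ^ (9 / 16 : ℝ) * bracket (T * (x - y)) ^ (9 / 16 : ℝ) := by
    rw [← Real.mul_rpow hY.le hXY.le]
    refine Real.rpow_le_rpow hX.le ?_ (by norm_num)
    convert bracket_add_le (T * y) (T * (x - y)) using 2
    ring
  have t1 : bracket (T * x) ^ (9 / 16 : ℝ) * bracket (T * y) ^ (-(5 / 8) : ℝ) *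
      bracket (T * (x - y)) ^ (-2 : ℝ) ≤ bracket (T * (x - y)) ^ (-(23 / 16) : ℝ) := by
    calc _ ≤ bracket (T * y) ^ (9 / 16 : ℝ) * bracket (T * (x - y)) ^ (9 / 16 : ℝ) *
          bracket (T * y) ^ (-(5 / 8) : ℝ) * bracket (T * (x - y)) ^ (-2 : ℝ) := by gcongr
      _ = (bracket (T * y) ^ (9 / 16 : ℝ) * bracket (T * y) ^ (-(5 / 8) : ℝ)) *
          (bracket (T * (x - y)) ^ (9 / 16 : ℝ) * bracket (T * (x - y)) ^ (-2 : ℝ)) := by ring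
      _ = bracket (T * y) ^ (-(1 / 16) : ℝ) * bracket (T * (x - y)) ^ (-(23 / 16) : ℝ) := by
          rw [← Real.rpow_add hY, ← Real.rpow_add hXY]; norm_num
      _ ≤ 1 * bracket (T * (x - y)) ^ (-(23 / 16) : ℝ) := by
          gcongr
          exact Real.rpow_le_one_of_one_le_of_nonpos (one_le_bracket _) (by norm_num)
      _ = _ := one_mul _
  have t2 : bracket (T * x) ^ (9 / 16 : ℝ) * bracket (T * y) ^ (-(5 / 8) : ℝ) *
      bracket (T * x) ^ (-2 : ℝ) = bracket (T * x) ^ (-(23 / 16) : ℝ) * bracket (T * y) ^ (-(5 / 8) : ℝ) := by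
    rw [mul_right_comm, ← Real.rpow_add hX]; norm_num
  have t3 : bracket (T * y) ^ (-1 : ℝ) * bracket (T * y) ^ (3 / 8 : ℝ) =
      bracket (T * y) ^ (-(5 / 8) : ℝ) := by
    rw [← Real.rpow_add hY]; norm_num
  calc _ ≤ (T ^ (-(9 / 16) : ℝ) * bracket (T * x) ^ (9 / 16 : ℝ)) *
        (T ^ 2 * (C * (bracket (T * y) ^ (-1 : ℝ) *
          (bracket (T * (x - y)) ^ (-2 : ℝ) + bracket (T * x) ^ (-2 : ℝ))))) *
        (T ^ (-(3 / 8) : ℝ) * bracket (T * y) ^ (3 / 8 : ℝ)) := by gcongr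
    _ = C * (T ^ (-(9 / 16) : ℝ) * T ^ (2 : ℝ) * T ^ (-(3 / 8) : ℝ)) *
        (bracket (T * x) ^ (9 / 16 : ℝ) * (bracket (T * y) ^ (-1 : ℝ) * bracket (T * y) ^ (3 / 8 : ℝ)) *
            bracket (T * (x - y)) ^ (-2 : ℝ) +
          bracket (T * x) ^ (9 / 16 : ℝ) * (bracket (T * y) ^ (-1 : ℝ) * bracket (T * y) ^ (3 / 8 : ℝ)) *
            bracket (T * x) ^ (-2 : ℝ)) := by rw [Real.rpow_two]; ring
    _ ≤ C * (T ^ (1 / 16 : ℝ) * T) * (bracket (T * (x - y)) ^ (-(23 / 16) : ℝ) +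
          bracket (T * x) ^ (-(23 / 16) : ℝ) * bracket (T * y) ^ (-(5 / 8) : ℝ)) := by
        rw [hpow, t3, t2]; gcongr
    _ = _ := by ring

theorem integral_comp_mul_of_pos {f : ℝ → ℂ} {T : ℝ} (hT : 0 < T) :
    (T : ℂ) * ∫ x, f (T * x) = ∫ x, f x := by
  rw [Measure.integral_comp_mul_left, abs_of_pos (inv_pos.2 hT), Complex.real_smul, ← mul_assoc,
    ← Complex.ofReal_mul, mul_inv_cancel₀ hT.ne', Complex.ofReal_one, one_mul]

theorem integrable_wave_mul {f : ℝ → ℂ} (hf : Integrable f) (t : ℝ) :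
    Integrable fun x => wave (t * x) * f x :=
  hf.bdd_mul (c := 1) (by fun_prop) (Eventually.of_forall fun x => (norm_wave _).le)

theorem integrable_cutoffHat_comp {T : ℝ} (hT : 0 < T) (y : ℝ) :
    Integrable fun x => cutoffHat (T * (x - y)) :=
  (integrable_cutoffHat.comp_mul_left' hT.ne').comp_sub_right y

/-- The function T · `cutoffHat` (T(x - y)) is the transform in t of `wave (t * y)` times the cutoff
at t/T, and this cutoff is 1 for |t| ≤ T. -/
theorem integral_wave_mul_cutoffHat_comp {T t : ℝ} (hT : 0 < T) (ht : |t| ≤ T) (y : ℝ) :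
    (T : ℂ) * ∫ x, wave (t * x) * cutoffHat (T * (x - y)) = wave (t * y) := by
  have e1 : ∀ x, wave (t * x) * cutoffHat (T * (x - y)) =
      wave (t * y) * (wave (t * (x - y)) * cutoffHat (T * (x - y))) := by
    intro x; rw [← mul_assoc, ← wave_add]; ring_nf
  simp_rw [e1]
  rw [integral_const_mul, integral_sub_right_eq_self (fun x => wave (t * x) * cutoffHat (T * x)) y]
  have e2 : ∀ x, wave (t * x) * cutoffHat (T * x) =
      (fun z => wave (t / T * z) * cutoffHat z) (T * x) := by
    intro x; simp only; rw [show t / T * (T * x) = t * x by field_simp]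
  simp_rw [e2]
  rw [mul_left_comm, integral_comp_mul_of_pos (f := fun z => wave (t / T * z) * cutoffHat z) hT,
    integral_wave_mul_cutoffHat, timeCutoff_eq_one, mul_one]
  rw [abs_div, abs_of_pos hT]; exact div_le_one_of_le₀ ht hT.le

/-- The Duhamel time integral `∫₀ᵗ e^{2πiry} dr`. -/
noncomputable def timeIntegral (t y : ℝ) : ℂ := (wave (t * y) - 1) / (2 * Real.pi * y * Complex.I)

/-- On [-T,T] the localized operator is therefore the true Duhamel integral, and a solution of the
localized equation solves the original one there. At y = 0 both sides have the default value 0. -/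
theorem integral_wave_mul_duhamelKernel {T t : ℝ} (hT : 0 < T) (ht : |t| ≤ T) (y : ℝ) :
    ∫ x, wave (t * x) * duhamelKernel T x y = timeIntegral t y := by
  have e : ∀ x, wave (t * x) * duhamelKernel T x y =
      (T * (wave (t * x) * cutoffHat (T * (x - y))) - T * (wave (t * x) * cutoffHat (T * (x - 0)))) *
        (2 * Real.pi * y * Complex.I)⁻¹ := by
    intro x; unfold duhamelKernel; rw [sub_zero]; ring
  simp_rw [e]
  rw [integral_mul_const, integral_sub, integral_const_mul, integral_const_mul,
    integral_wave_mul_cutoffHat_comp hT ht, integral_wave_mul_cutoffHat_comp hT ht, mul_zero,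
    wave_zero, timeIntegral, div_eq_mul_inv]
  · exact (integrable_wave_mul (integrable_cutoffHat_comp hT y) t).const_mul _
  · exact (integrable_wave_mul (integrable_cutoffHat_comp hT 0) t).const_mul _

noncomputable def weightedDuhamelKernel (T x y : ℝ) : ℝ≥0∞ :=
  ENNReal.ofReal (bracket x ^ (9 / 16 : ℝ) * ‖duhamelKernel T x y‖ * bracket y ^ (3 / 8 : ℝ))

@[fun_prop]
theorem measurable_weightedDuhamelKernel (T : ℝ) :
    Measurable fun p : ℝ × ℝ => weightedDuhamelKernel T p.1 p.2 := by
  unfold weightedDuhamelKernel; fun_prop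

/-- The kernel bound has a convolution part, handled by a Schur test, and a rank one part k(x)b(y),
handled by Cauchy-Schwarz. The norms A and B₁B₂ that enter are invariant under scaling by T, so the
only dependence on T is the square of T^{1/16}. -/
theorem exists_lintegral_duhamelKernel_sq_le : ∃ C : ℝ≥0, ∀ T : ℝ, 0 < T → T ≤ 1 →
    ∀ h : ℝ → ℝ≥0∞, Measurable h →
    ∫⁻ y, (∫⁻ x, weightedDuhamelKernel T x y * h x) ^ 2 ≤
      C * ENNReal.ofReal (T ^ (1 / 8 : ℝ)) * ∫⁻ x, h x ^ 2 := by
  obtain ⟨C, hC, hK⟩ := exists_duhamelKernel_le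
  set A := ∫⁻ x, ENNReal.ofReal (bracket x ^ (-(23 / 16) : ℝ)) with hA
  set B₁ := ∫⁻ x, ENNReal.ofReal (bracket x ^ (-(23 / 16) : ℝ)) ^ 2 with hB₁
  set B₂ := ∫⁻ x, ENNReal.ofReal (bracket x ^ (-(5 / 8) : ℝ)) ^ 2 with hB₂
  have hsq : ∀ p x : ℝ, ENNReal.ofReal (bracket x ^ p) ^ 2 = ENNReal.ofReal (bracket x ^ (p * 2)) := by
    intro p x
    have := bracket_pos x
    rw [← ENNReal.ofReal_pow (by positivity), Real.rpow_mul this.le, Real.rpow_two]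
  have hAf : A ≠ ∞ := (lintegral_bracket_rpow_lt_top (by norm_num)).ne
  have hB₁f : B₁ ≠ ∞ := by
    rw [hB₁]; simp_rw [hsq, neg_mul]
    exact (lintegral_bracket_rpow_lt_top (by norm_num)).ne
  have hB₂f : B₂ ≠ ∞ := by
    rw [hB₂]; simp_rw [hsq, neg_mul]
    exact (lintegral_bracket_rpow_lt_top (by norm_num)).ne
  set D := ENNReal.ofReal C ^ 2 * (2 * (A * A + B₁ * B₂)) with hD
  have hDf : D ≠ ∞ := by rw [hD]; finiteness
  refine ⟨D.toNNReal, fun T hT hT1 h hh => ?_⟩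
  rw [ENNReal.coe_toNNReal hDf]
  set k : ℝ → ℝ≥0∞ := fun z => ENNReal.ofReal T * ENNReal.ofReal (bracket (T * z) ^ (-(23 / 16) : ℝ))
    with hk
  set b : ℝ → ℝ≥0∞ := fun z => ENNReal.ofReal (bracket (T * z) ^ (-(5 / 8) : ℝ)) with hb
  have hkm : Measurable k := by rw [hk]; fun_prop
  have hbm : Measurable b := by rw [hb]; fun_prop
  have hsc : ∀ f : ℝ → ℝ≥0∞, Measurable f → ENNReal.ofReal T * ∫⁻ y, f (T * y) = ∫⁻ y, f y :=
    fun f hf => by simpa [abs_of_pos hT] using ofReal_abs_mul_lintegral_comp_mul hf hT.ne'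
  have hkA : ∫⁻ z, k z = A := by
    rw [hk, lintegral_const_mul' _ _ ENNReal.ofReal_ne_top]
    exact hsc (fun z => ENNReal.ofReal (bracket z ^ (-(23 / 16) : ℝ))) (by fun_prop)
  have hkb : (∫⁻ z, k z ^ 2) * ∫⁻ z, b z ^ 2 = B₁ * B₂ := by
    have e1 := hsc (fun z => ENNReal.ofReal (bracket z ^ (-(23 / 16) : ℝ)) ^ 2) (by fun_prop)
    have e2 := hsc (fun z => ENNReal.ofReal (bracket z ^ (-(5 / 8) : ℝ)) ^ 2) (by fun_prop)
    rw [hB₁, hB₂, ← e1, ← e2, hk, hb]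
    simp_rw [mul_pow]
    rw [lintegral_const_mul' _ _ (by finiteness)]
    ring
  have hpt : ∀ x y, weightedDuhamelKernel T x y ≤
      ENNReal.ofReal C * ENNReal.ofReal (T ^ (1 / 16 : ℝ)) * (k (x - y) + k x * b y) := by
    intro x y
    have h1 := bracket_pos (T * (x - y))
    have h2 := bracket_pos (T * x)
    have h3 := bracket_pos (T * y)
    rw [hk, hb]
    simp (disch := positivity) only [← ENNReal.ofReal_mul, ← ENNReal.ofReal_add]
    refine ENNReal.ofReal_le_ofReal ((hK T hT hT1 x y).trans_eq ?_)
    ring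
  set c := ENNReal.ofReal C * ENNReal.ofReal (T ^ (1 / 16 : ℝ)) with hc
  have hcf : c ≠ ∞ := by rw [hc]; finiteness
  have hc2 : c ^ 2 = ENNReal.ofReal C ^ 2 * ENNReal.ofReal (T ^ (1 / 8 : ℝ)) := by
    rw [hc, mul_pow]
    congr 1
    rw [← ENNReal.ofReal_pow (by positivity), ← Real.rpow_natCast, ← Real.rpow_mul hT.le]
    norm_num
  have hin : ∀ y, (∫⁻ x, weightedDuhamelKernel T x y * h x) ^ 2 ≤
      c ^ 2 * (2 * (A * (∫⁻ x, k (x - y) * h x ^ 2) +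
        b y ^ 2 * ((∫⁻ x, k x ^ 2) * ∫⁻ x, h x ^ 2))) := by
    intro y
    have e1 : ∫⁻ x, weightedDuhamelKernel T x y * h x ≤
        c * ((∫⁻ x, k (x - y) * h x) + b y * ∫⁻ x, k x * h x) := by
      rw [← lintegral_const_mul _ (by fun_prop), ← lintegral_add_left (by fun_prop),
        ← lintegral_const_mul' _ _ hcf]
      refine lintegral_mono fun x => (mul_le_mul' (hpt x y) le_rfl).trans_eq ?_
      ring
    -- Cauchy-Schwarz with k split as k^{1/2} · k^{1/2}.
    have e2 : (∫⁻ x, k (x - y) * h x) ^ 2 ≤ A * ∫⁻ x, k (x - y) * h x ^ 2 := by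
      have := sq_lintegral_mul_le volume (f := fun x => k (x - y) ^ (1 / 2 : ℝ))
        (g := fun x => k (x - y) ^ (1 / 2 : ℝ) * h x) (by fun_prop) (by fun_prop)
      have e3 : ∀ x, (k x ^ (1 / 2 : ℝ)) ^ 2 = k x := fun x => by
        rw [← ENNReal.rpow_natCast, ← ENNReal.rpow_mul]; norm_num
      have e4 : ∀ x, k (x - y) ^ (1 / 2 : ℝ) * (k (x - y) ^ (1 / 2 : ℝ) * h x) = k (x - y) * h x :=
        fun x => by rw [← mul_assoc, ← sq, e3]
      simp_rw [e4, mul_pow, e3] at this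
      rwa [lintegral_sub_right_eq_self k y, hkA] at this
    calc _ ≤ (c * ((∫⁻ x, k (x - y) * h x) + b y * ∫⁻ x, k x * h x)) ^ 2 := by gcongr
      _ = c ^ 2 * ((∫⁻ x, k (x - y) * h x) + b y * ∫⁻ x, k x * h x) ^ 2 := mul_pow _ _ _
      _ ≤ c ^ 2 * (2 * ((∫⁻ x, k (x - y) * h x) ^ 2 + (b y * ∫⁻ x, k x * h x) ^ 2)) := by
          gcongr; exact add_sq_le_two_mul _ _
      _ ≤ _ := by
          rw [mul_pow (b y)]
          gcongr
          exact sq_lintegral_mul_le volume hkm.aemeasurable hh.aemeasurable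
  have hfin : ∫⁻ y, ∫⁻ x, k (x - y) * h x ^ 2 = A * ∫⁻ x, h x ^ 2 := by
    rw [lintegral_lintegral_swap (by fun_prop), ← lintegral_const_mul _ (by fun_prop)]
    refine lintegral_congr fun x => ?_
    rw [lintegral_mul_const _ (by fun_prop), lintegral_sub_left_eq_self k x, hkA]
  have hm1 : Measurable fun y => ∫⁻ x, k (x - y) * h x ^ 2 :=
    Measurable.lintegral_prod_right' (f := fun p : ℝ × ℝ => k (p.2 - p.1) * h p.2 ^ 2) (by fun_prop)
  calc _ ≤ ∫⁻ y, c ^ 2 * (2 * (A * (∫⁻ x, k (x - y) * h x ^ 2) +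
        b y ^ 2 * ((∫⁻ x, k x ^ 2) * ∫⁻ x, h x ^ 2))) := lintegral_mono hin
    _ = c ^ 2 * (2 * (A * (A * ∫⁻ x, h x ^ 2) +
        (∫⁻ y, b y ^ 2) * ((∫⁻ x, k x ^ 2) * ∫⁻ x, h x ^ 2))) := by
        rw [lintegral_const_mul' _ _ (by finiteness), lintegral_const_mul' _ _ (by finiteness),
          lintegral_add_left (by fun_prop), lintegral_const_mul' _ _ hAf, hfin,
          lintegral_mul_const _ (by fun_prop)]
    _ = c ^ 2 * (2 * (A * A + (∫⁻ x, k x ^ 2) * (∫⁻ y, b y ^ 2))) * ∫⁻ x, h x ^ 2 := by ring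
    _ = _ := by rw [hkb, hc2, hD]; ring

/-! ### Estimates for the cubic Duhamel term. -/

/-- Triple convolution. -/
noncomputable def tripleConv (f₁ f₂ f₃ : ℝ × ℝ → ℝ≥0∞) (z : ℝ × ℝ) : ℝ≥0∞ :=
  ∫⁻ z₁, ∫⁻ z₂, f₁ z₁ * f₂ z₂ * f₃ (z - z₁ - z₂)

theorem measurable_tripleConv {f₁ f₂ f₃ : ℝ × ℝ → ℝ≥0∞} (h₁ : Measurable f₁) (h₂ : Measurable f₂)
    (h₃ : Measurable f₃) : Measurable (tripleConv f₁ f₂ f₃) := by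
  unfold tripleConv
  refine Measurable.lintegral_prod_right' (f := fun p : (ℝ × ℝ) × (ℝ × ℝ) =>
    ∫⁻ z₂, f₁ p.2 * f₂ z₂ * f₃ (p.1 - p.2 - z₂)) ?_
  refine Measurable.lintegral_prod_right' (f := fun p : ((ℝ × ℝ) × (ℝ × ℝ)) × (ℝ × ℝ) =>
    f₁ p.1.2 * f₂ p.2 * f₃ (p.1.1 - p.1.2 - p.2)) ?_
  fun_prop

theorem lintegral_mul_tripleConv {g f₁ f₂ f₃ : ℝ × ℝ → ℝ≥0∞} (hg : Measurable g)
    (h₁ : Measurable f₁) (h₂ : Measurable f₂) (h₃ : Measurable f₃) :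
    ∫⁻ z, g z * tripleConv f₁ f₂ f₃ z =
      ∫⁻ z₁, ∫⁻ z₂, ∫⁻ z₃, g (z₁ + z₂ + z₃) * (f₁ z₁ * f₂ z₂ * f₃ z₃) := by
  have hm : Measurable fun p : (ℝ × ℝ) × (ℝ × ℝ) × (ℝ × ℝ) =>
      g p.1 * (f₁ p.2.1 * f₂ p.2.2 * f₃ (p.1 - p.2.1 - p.2.2)) := by fun_prop
  have hm2 : Measurable fun p : (ℝ × ℝ) × (ℝ × ℝ) =>
      ∫⁻ z₂, f₁ p.2 * f₂ z₂ * f₃ (p.1 - p.2 - z₂) :=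
    Measurable.lintegral_prod_right' (f := fun p : ((ℝ × ℝ) × (ℝ × ℝ)) × (ℝ × ℝ) =>
      f₁ p.1.2 * f₂ p.2 * f₃ (p.1.1 - p.1.2 - p.2)) (by fun_prop)
  calc _ = ∫⁻ z, ∫⁻ z₁, ∫⁻ z₂, g z * (f₁ z₁ * f₂ z₂ * f₃ (z - z₁ - z₂)) := by
        refine lintegral_congr fun z => ?_
        unfold tripleConv
        rw [← lintegral_const_mul _ (f := fun z₁ => ∫⁻ z₂, f₁ z₁ * f₂ z₂ * f₃ (z - z₁ - z₂))
          (hm2.comp measurable_prodMk_left)]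
        refine lintegral_congr fun z₁ => ?_
        exact (lintegral_const_mul _ (by fun_prop)).symm
    _ = ∫⁻ z₁, ∫⁻ z, ∫⁻ z₂, g z * (f₁ z₁ * f₂ z₂ * f₃ (z - z₁ - z₂)) :=
        (lintegral_three_swap_left hm).symm
    _ = ∫⁻ z₁, ∫⁻ z₂, ∫⁻ z, g z * (f₁ z₁ * f₂ z₂ * f₃ (z - z₁ - z₂)) := by
        refine lintegral_congr fun z₁ => ?_
        exact lintegral_lintegral_swap (by fun_prop)
    _ = _ := by
        refine lintegral_congr fun z₁ => lintegral_congr fun z₂ => ?_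
        rw [← lintegral_add_right_eq_self _ (z₁ + z₂)]
        refine lintegral_congr fun z => ?_
        rw [show z + (z₁ + z₂) - z₁ - z₂ = z by abel, show z + (z₁ + z₂) = z₁ + z₂ + z by abel]

/-- The absolute kernel version of the localized Duhamel operator applied to `∂ₓ N`. -/
noncomputable def absDuhamel (κ T : ℝ) (N : ℝ × ℝ → ℝ≥0∞) (z : ℝ × ℝ) : ℝ≥0∞ :=
  ∫⁻ θ, ENNReal.ofReal (|z.1| * ‖duhamelKernel T (z.2 - κ * z.1 ^ 3) (θ - κ * z.1 ^ 3)‖) *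
    N (z.1, θ)

theorem measurable_absDuhamel (κ T : ℝ) {N : ℝ × ℝ → ℝ≥0∞} (hN : Measurable N) :
    Measurable (absDuhamel κ T N) := by
  refine Measurable.lintegral_prod_right' (f := fun p : (ℝ × ℝ) × ℝ =>
    ENNReal.ofReal (|p.1.1| * ‖duhamelKernel T (p.1.2 - κ * p.1.1 ^ 3) (p.2 - κ * p.1.1 ^ 3)‖) *
    N (p.1.1, p.2)) ?_
  have := (measurable_duhamelKernel T).comp (by fun_prop :
    Measurable fun p : (ℝ × ℝ) × ℝ => (p.1.2 - κ * p.1.1 ^ 3, p.2 - κ * p.1.1 ^ 3))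
  have h : Measurable fun p : (ℝ × ℝ) × ℝ =>
    duhamelKernel T (p.1.2 - κ * p.1.1 ^ 3) (p.2 - κ * p.1.1 ^ 3) := this
  fun_prop

/-- The weight `ρ L^{9/16}` of the Gevrey-Bourgain space. -/
noncomputable def bourgainWeight (κ σ s : ℝ) (z : ℝ × ℝ) : ℝ :=
  gevreyWeight σ s z.1 * modulation κ z ^ (9 / 16 : ℝ)

theorem bourgainWeight_pos (κ σ s : ℝ) (z : ℝ × ℝ) : 0 < bourgainWeight κ σ s z := by
  have := gevreyWeight_pos σ s z.1
  have := modulation_pos κ z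
  unfold bourgainWeight; positivity

@[fun_prop]
theorem measurable_bourgainWeight (κ σ s : ℝ) : Measurable (bourgainWeight κ σ s) := by
  unfold bourgainWeight; fun_prop

theorem inverseWeight_eq (κ σ s : ℝ) (z : ℝ × ℝ) :
    inverseWeight κ σ s z = ENNReal.ofReal (bourgainWeight κ σ s z)⁻¹ := by
  unfold inverseWeight bourgainWeight
  rw [mul_inv, Real.rpow_neg (modulation_pos κ z).le]

/-- The dual of the localized Duhamel operator. -/
noncomputable def dualDuhamel (κ T : ℝ) (h : ℝ × ℝ → ℝ≥0∞) (z : ℝ × ℝ) : ℝ≥0∞ :=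
  ∫⁻ θ, weightedDuhamelKernel T (θ - κ * z.1 ^ 3) (z.2 - κ * z.1 ^ 3) * h (z.1, θ)

theorem measurable_dualDuhamel (κ T : ℝ) {h : ℝ × ℝ → ℝ≥0∞} (hh : Measurable h) :
    Measurable (dualDuhamel κ T h) := by
  refine Measurable.lintegral_prod_right' (f := fun p : (ℝ × ℝ) × ℝ =>
    weightedDuhamelKernel T (p.2 - κ * p.1.1 ^ 3) (p.1.2 - κ * p.1.1 ^ 3) * h (p.1.1, p.2)) ?_
  have := (measurable_weightedDuhamelKernel T).comp (by fun_prop :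
      Measurable fun p : (ℝ × ℝ) × ℝ => (p.2 - κ * p.1.1 ^ 3, p.1.2 - κ * p.1.1 ^ 3))
  exact Measurable.mul this (by fun_prop)

/-- The operator acts in the time frequency alone; for fixed η the shift by κη³ turns it into the
one-dimensional kernel. -/
theorem exists_lintegral_dualDuhamel_sq_le : ∃ C : ℝ≥0, ∀ κ T : ℝ, 0 < T → T ≤ 1 →
    ∀ h : ℝ × ℝ → ℝ≥0∞, Measurable h → ∫⁻ z, dualDuhamel κ T h z ^ 2 ≤
      C * ENNReal.ofReal (T ^ (1 / 8 : ℝ)) * ∫⁻ z, h z ^ 2 := by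
  obtain ⟨C, hC⟩ := exists_lintegral_duhamelKernel_sq_le
  refine ⟨C, fun κ T hT hT1 h hh => ?_⟩
  have hgm := measurable_dualDuhamel κ T hh
  rw [Measure.volume_eq_prod, lintegral_prod _ (hgm.pow_const 2).aemeasurable,
    lintegral_prod _ (by fun_prop), ← lintegral_const_mul _ (Measurable.lintegral_prod_right'
      (f := fun z => h z ^ 2) (by fun_prop))]
  refine lintegral_mono fun η => ?_
  have e1 : ∫⁻ y, dualDuhamel κ T h (η, y) ^ 2 =
      ∫⁻ y, (∫⁻ x, weightedDuhamelKernel T x y * h (η, x + κ * η ^ 3)) ^ 2 := by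
    rw [← lintegral_add_right_eq_self _ (κ * η ^ 3)]
    refine lintegral_congr fun y => ?_
    unfold dualDuhamel
    simp only
    rw [← lintegral_add_right_eq_self _ (κ * η ^ 3)]
    simp only [add_sub_cancel_right]
  have e2 : ∫⁻ y, h (η, y) ^ 2 = ∫⁻ y, h (η, y + κ * η ^ 3) ^ 2 :=
    (lintegral_add_right_eq_self (fun y => h (η, y) ^ 2) _).symm
  rw [e1, e2]
  exact hC T hT hT1 (fun x => h (η, x + κ * η ^ 3)) (by fun_prop)

/-- The factors L^{-3/8} and L^{3/8} inserted at the inner frequency cancel. They divide the Duhamel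
operator between the trilinear estimate and the kernel estimate. -/
theorem bourgainWeight_mul_norm_duhamelKernel (κ σ s T η θ y : ℝ) :
    ENNReal.ofReal (bourgainWeight κ σ s (η, θ)) *
      ENNReal.ofReal (|η| * ‖duhamelKernel T (θ - κ * η ^ 3) (y - κ * η ^ 3)‖) =
    outputWeight κ σ s (η, y) * weightedDuhamelKernel T (θ - κ * η ^ 3) (y - κ * η ^ 3) := by
  have hρ := gevreyWeight_pos σ s η
  have hm := modulation_pos κ (η, θ)
  have hm' := modulation_pos κ (η, y)
  unfold outputWeight weightedDuhamelKernel bourgainWeight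
  rw [← ENNReal.ofReal_mul (by positivity), ← ENNReal.ofReal_mul (by positivity)]
  congr 1
  have e : modulation κ (η, y) ^ (-(3 / 8) : ℝ) * bracket (y - κ * η ^ 3) ^ (3 / 8 : ℝ) = 1 := by
    change modulation κ (η, y) ^ (-(3 / 8) : ℝ) * modulation κ (η, y) ^ (3 / 8 : ℝ) = 1
    rw [← Real.rpow_add hm']; norm_num
  have e' : modulation κ (η, θ) = bracket (θ - κ * η ^ 3) := rfl
  rw [e']
  linear_combination (-(gevreyWeight σ s η * bracket (θ - κ * η ^ 3) ^ (9 / 16 : ℝ) * |η| *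
    ‖duhamelKernel T (θ - κ * η ^ 3) (y - κ * η ^ 3)‖)) * e

theorem lintegral_absDuhamel_mul (κ σ s T : ℝ) {N h : ℝ × ℝ → ℝ≥0∞} (hN : Measurable N)
    (hh : Measurable h) :
    ∫⁻ z, ENNReal.ofReal (bourgainWeight κ σ s z) * absDuhamel κ T N z * h z =
      ∫⁻ z, outputWeight κ σ s z * dualDuhamel κ T h z * N z := by
  have hA := measurable_absDuhamel κ T hN
  have hg := measurable_dualDuhamel κ T hh
  have hR : Measurable fun z => outputWeight κ σ s z * dualDuhamel κ T h z * N z :=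
    ((measurable_outputWeight κ σ s).mul hg).mul hN
  have hL : Measurable fun z => ENNReal.ofReal (bourgainWeight κ σ s z) * absDuhamel κ T N z * h z :=
    ((measurable_bourgainWeight κ σ s).ennreal_ofReal.mul hA).mul hh
  rw [Measure.volume_eq_prod, lintegral_prod _ hL.aemeasurable, lintegral_prod _ hR.aemeasurable]
  refine lintegral_congr fun η => ?_
  have hsh : Measurable fun p : ℝ × ℝ => (p.1 - κ * η ^ 3, p.2 - κ * η ^ 3) :=
    (measurable_fst.sub_const _).prodMk (measurable_snd.sub_const _)
  have hKm : Measurable fun p : ℝ × ℝ => ENNReal.ofReal (|η| *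
      ‖duhamelKernel T (p.1 - κ * η ^ 3) (p.2 - κ * η ^ 3)‖) := by
    have h1 : Measurable fun q : ℝ × ℝ => ENNReal.ofReal (|η| * ‖duhamelKernel T q.1 q.2‖) :=
      ((measurable_duhamelKernel T).norm.const_mul |η|).ennreal_ofReal
    have h2 := h1.comp hsh
    exact h2
  have hWm : Measurable fun p : ℝ × ℝ =>
      weightedDuhamelKernel T (p.1 - κ * η ^ 3) (p.2 - κ * η ^ 3) := by
    have h2 := (measurable_weightedDuhamelKernel T).comp hsh
    exact h2
  have hNη : Measurable fun y => N (η, y) := hN.comp measurable_prodMk_left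
  have hhη : Measurable fun y => h (η, y) := hh.comp measurable_prodMk_left
  have hbη : Measurable fun y => ENNReal.ofReal (bourgainWeight κ σ s (η, y)) :=
    (measurable_bourgainWeight κ σ s).ennreal_ofReal.comp measurable_prodMk_left
  have hjoint : Measurable fun p : ℝ × ℝ => ENNReal.ofReal (bourgainWeight κ σ s (η, p.1)) *
      (ENNReal.ofReal (|η| * ‖duhamelKernel T (p.1 - κ * η ^ 3) (p.2 - κ * η ^ 3)‖) *
        N (η, p.2)) * h (η, p.1) :=
    ((hbη.comp measurable_fst).mul (hKm.mul (hNη.comp measurable_snd))).mul (hhη.comp measurable_fst)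
  calc _ = ∫⁻ θ, ∫⁻ y, ENNReal.ofReal (bourgainWeight κ σ s (η, θ)) *
        (ENNReal.ofReal (|η| * ‖duhamelKernel T (θ - κ * η ^ 3) (y - κ * η ^ 3)‖) *
          N (η, y)) * h (η, θ) := by
        refine lintegral_congr fun θ => ?_
        have h1 : Measurable fun y => ENNReal.ofReal (|η| *
            ‖duhamelKernel T (θ - κ * η ^ 3) (y - κ * η ^ 3)‖) * N (η, y) :=
          (hKm.comp (measurable_prodMk_left (x := θ))).mul hNη
        rw [lintegral_mul_const _ (h1.const_mul _), lintegral_const_mul _ h1, absDuhamel]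
    _ = ∫⁻ y, ∫⁻ θ, ENNReal.ofReal (bourgainWeight κ σ s (η, θ)) *
        (ENNReal.ofReal (|η| * ‖duhamelKernel T (θ - κ * η ^ 3) (y - κ * η ^ 3)‖) *
          N (η, y)) * h (η, θ) :=
        lintegral_lintegral_swap hjoint.aemeasurable
    _ = _ := by
        refine lintegral_congr fun y => ?_
        have h1 : Measurable fun θ => weightedDuhamelKernel T (θ - κ * η ^ 3) (y - κ * η ^ 3) *
            h (η, θ) :=
          (hWm.comp (measurable_prodMk_right (y := y))).mul hhη
        unfold dualDuhamel
        simp only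
        rw [← lintegral_const_mul _ h1, ← lintegral_mul_const _ (h1.const_mul _)]
        refine lintegral_congr fun θ => ?_
        have key := bourgainWeight_mul_norm_duhamelKernel κ σ s T η θ y
        calc _ = ENNReal.ofReal (bourgainWeight κ σ s (η, θ)) *
            ENNReal.ofReal (|η| * ‖duhamelKernel T (θ - κ * η ^ 3) (y - κ * η ^ 3)‖) *
              (N (η, y) * h (η, θ)) := by ring
          _ = _ := by rw [key]; ring

/-- By duality one tests against `h` and moves the Duhamel kernel onto `h`. The trilinear estimate
then applies with `dualDuhamel κ T h` as its first function, whose norm carries the power of T. -/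
theorem exists_absDuhamel_le : ∃ C : ℝ≥0, ∀ κ σ s T : ℝ, 1 ≤ 3 * κ → 0 ≤ σ → 1 / 4 ≤ s → 0 < T →
    T ≤ 1 → ∀ f₁ f₂ f₃ : ℝ × ℝ → ℝ≥0∞, Measurable f₁ → Measurable f₂ → Measurable f₃ →
    ∫⁻ z, (ENNReal.ofReal (bourgainWeight κ σ s z) * absDuhamel κ T (tripleConv
      (fun z => inverseWeight κ σ s z * f₁ z) (fun z => inverseWeight κ σ s z * f₂ z)
      (fun z => inverseWeight κ σ s z * f₃ z)) z) ^ 2 ≤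
      C * ENNReal.ofReal (T ^ (1 / 8 : ℝ)) *
        ((∫⁻ z, f₁ z ^ 2) * (∫⁻ z, f₂ z ^ 2) * ∫⁻ z, f₃ z ^ 2) := by
  obtain ⟨C₁, hC₁⟩ := exists_trilinear_le
  obtain ⟨C₂, hC₂⟩ := exists_lintegral_dualDuhamel_sq_le
  refine ⟨C₁ * C₂, fun κ σ s T hκ hσ hs hT hT1 f₁ f₂ f₃ h₁ h₂ h₃ => ?_⟩
  have hi := measurable_inverseWeight κ σ s
  have hN := measurable_tripleConv (hi.mul h₁) (hi.mul h₂) (hi.mul h₃)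
  have hAm := measurable_absDuhamel κ T hN
  refine lintegral_sq_le_of_forall volume
    ((measurable_bourgainWeight κ σ s).ennreal_ofReal.mul hAm) fun h hh => ?_
  have hgm := measurable_dualDuhamel κ T hh
  have e := (lintegral_absDuhamel_mul κ σ s T hN hh).trans
    (lintegral_mul_tripleConv (g := fun z => outputWeight κ σ s z * dualDuhamel κ T h z)
      ((measurable_outputWeight κ σ s).mul hgm) (hi.mul h₁) (hi.mul h₂) (hi.mul h₃))
  refine (pow_le_pow_left' e.le 2).trans ?_
  refine (hC₁ κ σ s hκ hσ hs (dualDuhamel κ T h) f₁ f₂ f₃ hgm h₁ h₂ h₃).trans ?_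
  have h2 := hC₂ κ T hT hT1 h hh
  calc _ ≤ C₁ * ((C₂ * ENNReal.ofReal (T ^ (1 / 8 : ℝ)) * ∫⁻ z, h z ^ 2) * (∫⁻ z, f₁ z ^ 2) *
        (∫⁻ z, f₂ z ^ 2) * ∫⁻ z, f₃ z ^ 2) := by gcongr
    _ = _ := by push_cast; ring

/-- The coefficient of the cubic phase in the frequency variable `η = ξ / 2π`. -/
noncomputable def dispersion : ℝ := 4 * Real.pi ^ 2

theorem one_le_three_mul_dispersion : 1 ≤ 3 * dispersion := by
  unfold dispersion; nlinarith [Real.pi_gt_three]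

/-- The integrand of the localized Duhamel term, for three different factors. -/
noncomputable def duhamelIntegrand (T : ℝ) (c : ℂ) (A B D : ℝ × ℝ → ℂ) (z : ℝ × ℝ)
    (p : ℝ × (ℝ × ℝ) × (ℝ × ℝ)) : ℂ :=
  duhamelKernel T (z.2 - dispersion * z.1 ^ 3) (p.1 - dispersion * z.1 ^ 3) * (c * z.1) *
    (A p.2.1 * B p.2.2 * D ((z.1, p.1) - p.2.1 - p.2.2))

/-- The localized Duhamel term of the cubic nonlinearity, on the Fourier side. -/
noncomputable def duhamelTerm (T : ℝ) (c : ℂ) (F : ℝ × ℝ → ℂ) (z : ℝ × ℝ) : ℂ :=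
  ∫ p, duhamelIntegrand T c F F F z p

theorem measurable_duhamelIntegrand (T : ℝ) (c : ℂ) {A B D : ℝ × ℝ → ℂ} (hA : Measurable A)
    (hB : Measurable B) (hD : Measurable D) :
    Measurable fun q : (ℝ × ℝ) × ℝ × (ℝ × ℝ) × (ℝ × ℝ) => duhamelIntegrand T c A B D q.1 q.2 := by
  have h1 : Measurable fun q : (ℝ × ℝ) × ℝ × (ℝ × ℝ) × (ℝ × ℝ) =>
      (q.1.2 - dispersion * q.1.1 ^ 3, q.2.1 - dispersion * q.1.1 ^ 3) := by fun_prop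
  have h2 := (measurable_duhamelKernel T).comp h1
  have h3 : Measurable fun q : (ℝ × ℝ) × ℝ × (ℝ × ℝ) × (ℝ × ℝ) =>
      (q.1.1, q.2.1) - q.2.2.1 - q.2.2.2 := by fun_prop
  have h4 := hD.comp h3
  unfold duhamelIntegrand
  exact (h2.mul (by fun_prop)).mul ((by fun_prop : Measurable fun q : (ℝ × ℝ) × ℝ × (ℝ × ℝ) × (ℝ × ℝ) =>
    A q.2.2.1 * B q.2.2.2).mul h4)

theorem stronglyMeasurable_duhamelTerm (T : ℝ) (c : ℂ) {F : ℝ × ℝ → ℂ} (hF : Measurable F) :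
    StronglyMeasurable (duhamelTerm T c F) :=
  (measurable_duhamelIntegrand T c hF hF hF).stronglyMeasurable.integral_prod_right'

theorem lintegral_duhamelIntegrand (T : ℝ) (c : ℂ) {A B D : ℝ × ℝ → ℂ} (hA : Measurable A)
    (hB : Measurable B) (hD : Measurable D) (z : ℝ × ℝ) :
    ∫⁻ p, ‖duhamelIntegrand T c A B D z p‖ₑ = ‖c‖ₑ * absDuhamel dispersion T
      (tripleConv (fun w => ‖A w‖ₑ) (fun w => ‖B w‖ₑ) (fun w => ‖D w‖ₑ)) z := by
  have hm := (measurable_duhamelIntegrand T c hA hB hD).comp (measurable_prodMk_left (x := z))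
  have hm' : Measurable fun p => ‖duhamelIntegrand T c A B D z p‖ₑ := hm.enorm
  have he : ∀ p, ‖duhamelIntegrand T c A B D z p‖ₑ = ‖c‖ₑ * (ENNReal.ofReal (|z.1| *
      ‖duhamelKernel T (z.2 - dispersion * z.1 ^ 3) (p.1 - dispersion * z.1 ^ 3)‖) *
      (‖A p.2.1‖ₑ * ‖B p.2.2‖ₑ * ‖D ((z.1, p.1) - p.2.1 - p.2.2)‖ₑ)) := by
    intro p
    unfold duhamelIntegrand
    rw [ENNReal.ofReal_mul (abs_nonneg _), ofReal_norm, ← Real.norm_eq_abs, ofReal_norm]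
    simp only [enorm_mul]
    have : ‖(z.1 : ℂ)‖ₑ = ‖z.1‖ₑ := by rw [← ofReal_norm, ← ofReal_norm, Complex.norm_real]
    rw [this]; ring
  rw [Measure.volume_eq_prod, lintegral_prod _ hm'.aemeasurable]
  unfold absDuhamel tripleConv
  rw [← lintegral_const_mul' _ _ enorm_ne_top]
  refine lintegral_congr fun θ => ?_
  have hm2 : Measurable fun q : (ℝ × ℝ) × (ℝ × ℝ) =>
      ‖A q.1‖ₑ * ‖B q.2‖ₑ * ‖D ((z.1, θ) - q.1 - q.2)‖ₑ := by fun_prop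
  simp_rw [he]
  rw [lintegral_const_mul' _ _ enorm_ne_top, lintegral_const_mul' _ _ ENNReal.ofReal_ne_top,
    Measure.volume_eq_prod, lintegral_prod _ hm2.aemeasurable]

theorem tripleConv_mono {f₁ f₂ f₃ g₁ g₂ g₃ : ℝ × ℝ → ℝ≥0∞} (h₁ : f₁ ≤ g₁) (h₂ : f₂ ≤ g₂)
    (h₃ : f₃ ≤ g₃) : tripleConv f₁ f₂ f₃ ≤ tripleConv g₁ g₂ g₃ := fun _ =>
  lintegral_mono fun z₁ => lintegral_mono fun z₂ =>
    mul_le_mul' (mul_le_mul' (h₁ z₁) (h₂ z₂)) (h₃ _)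

theorem absDuhamel_mono (κ T : ℝ) {N N' : ℝ × ℝ → ℝ≥0∞} (h : N ≤ N') :
    absDuhamel κ T N ≤ absDuhamel κ T N' := fun _ =>
  lintegral_mono fun _ => mul_le_mul' le_rfl (h _)

/-- The absolute Duhamel term of three amplitudes. -/
noncomputable def absTerm (T : ℝ) (f₁ f₂ f₃ : ℝ × ℝ → ℝ≥0∞) (z : ℝ × ℝ) : ℝ≥0∞ :=
  absDuhamel dispersion T (tripleConv f₁ f₂ f₃) z

theorem measurable_absTerm (T : ℝ) {f₁ f₂ f₃ : ℝ × ℝ → ℝ≥0∞} (h₁ : Measurable f₁)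
    (h₂ : Measurable f₂) (h₃ : Measurable f₃) : Measurable (absTerm T f₁ f₂ f₃) :=
  measurable_absDuhamel _ T (measurable_tripleConv h₁ h₂ h₃)

theorem absTerm_mono (T : ℝ) {f₁ f₂ f₃ g₁ g₂ g₃ : ℝ × ℝ → ℝ≥0∞} (h₁ : f₁ ≤ g₁) (h₂ : f₂ ≤ g₂)
    (h₃ : f₃ ≤ g₃) : absTerm T f₁ f₂ f₃ ≤ absTerm T g₁ g₂ g₃ :=
  absDuhamel_mono _ T (tripleConv_mono h₁ h₂ h₃)

/-- The cubic difference telescopes: FFF - GGG = (F-G)FF + G(F-G)F + GG(F-G). The hypothesis `hfin`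
makes both integrals absolutely convergent at `z`, so that neither takes the default value 0. -/
theorem enorm_duhamelTerm_sub_le (T : ℝ) (c : ℂ) {F G : ℝ × ℝ → ℂ} (hF : Measurable F)
    (hG : Measurable G) {S D : ℝ × ℝ → ℝ≥0∞} (hFS : ∀ z, ‖F z‖ₑ ≤ S z) (hGS : ∀ z, ‖G z‖ₑ ≤ S z)
    (hD : ∀ z, ‖F z - G z‖ₑ ≤ D z) {z : ℝ × ℝ} (hfin : absTerm T S S S z ≠ ∞) :
    ‖duhamelTerm T c F z - duhamelTerm T c G z‖ₑ ≤
      ‖c‖ₑ * (absTerm T D S S z + absTerm T S D S z + absTerm T S S D z) := by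
  have hint : ∀ {H : ℝ × ℝ → ℂ}, Measurable H → (∀ z, ‖H z‖ₑ ≤ S z) →
      Integrable (duhamelIntegrand T c H H H z) := by
    intro H hH hHS
    refine ⟨((measurable_duhamelIntegrand T c hH hH hH).comp
      (measurable_prodMk_left (x := z))).aestronglyMeasurable, ?_⟩
    rw [hasFiniteIntegral_iff_enorm, lintegral_duhamelIntegrand T c hH hH hH]
    exact ENNReal.mul_lt_top enorm_lt_top
      ((absTerm_mono T hHS hHS hHS z).trans_lt hfin.lt_top)
  unfold duhamelTerm
  rw [← integral_sub (hint hF hFS) (hint hG hGS)]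
  have hFG : Measurable fun w => F w - G w := hF.sub hG
  have e : ∀ p, duhamelIntegrand T c F F F z p - duhamelIntegrand T c G G G z p =
      duhamelIntegrand T c (fun w => F w - G w) F F z p +
      duhamelIntegrand T c G (fun w => F w - G w) F z p +
      duhamelIntegrand T c G G (fun w => F w - G w) z p := by
    intro p; unfold duhamelIntegrand; ring
  simp_rw [e]
  have hm : ∀ {A B D : ℝ × ℝ → ℂ}, Measurable A → Measurable B → Measurable D →
      Measurable fun p => ‖duhamelIntegrand T c A B D z p‖ₑ := fun hA hB hD =>
    ((measurable_duhamelIntegrand T c hA hB hD).comp (measurable_prodMk_left (x := z))).enorm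
  calc _ ≤ ∫⁻ p, ‖duhamelIntegrand T c (fun w => F w - G w) F F z p +
      duhamelIntegrand T c G (fun w => F w - G w) F z p +
      duhamelIntegrand T c G G (fun w => F w - G w) z p‖ₑ := enorm_integral_le_lintegral_enorm _
    _ ≤ ∫⁻ p, (‖duhamelIntegrand T c (fun w => F w - G w) F F z p‖ₑ +
      ‖duhamelIntegrand T c G (fun w => F w - G w) F z p‖ₑ +
      ‖duhamelIntegrand T c G G (fun w => F w - G w) z p‖ₑ) := by
        refine lintegral_mono fun p => (enorm_add_le _ _).trans ?_
        gcongr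
        exact enorm_add_le _ _
    _ = ‖c‖ₑ * absTerm T (fun w => ‖F w - G w‖ₑ) (fun w => ‖F w‖ₑ) (fun w => ‖F w‖ₑ) z +
        ‖c‖ₑ * absTerm T (fun w => ‖G w‖ₑ) (fun w => ‖F w - G w‖ₑ) (fun w => ‖F w‖ₑ) z +
        ‖c‖ₑ * absTerm T (fun w => ‖G w‖ₑ) (fun w => ‖G w‖ₑ) (fun w => ‖F w - G w‖ₑ) z := by
        have h12 : Measurable fun p =>
            ‖duhamelIntegrand T c (fun w => F w - G w) F F z p‖ₑ +
              ‖duhamelIntegrand T c G (fun w => F w - G w) F z p‖ₑ :=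
          (hm hFG hF hF).add (hm hG hFG hF)
        rw [lintegral_add_left (f := fun p =>
            ‖duhamelIntegrand T c (fun w => F w - G w) F F z p‖ₑ +
              ‖duhamelIntegrand T c G (fun w => F w - G w) F z p‖ₑ) h12,
          lintegral_add_left (hm hFG hF hF),
          lintegral_duhamelIntegrand T c hFG hF hF, lintegral_duhamelIntegrand T c hG hFG hF,
          lintegral_duhamelIntegrand T c hG hG hFG]
        rfl
    _ ≤ _ := by
        rw [← mul_add, ← mul_add]
        gcongr
        · exact absTerm_mono T hD hFS hFS z
        · exact absTerm_mono T hGS hD hFS z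
        · exact absTerm_mono T hGS hGS hD z

theorem eLpNorm_two_sq {α E : Type*} [MeasurableSpace α] {ν : Measure α} [NormedAddCommGroup E]
    (f : α → E) : eLpNorm f 2 ν ^ 2 = ∫⁻ x, ‖f x‖ₑ ^ 2 ∂ν := by
  have h := eLpNorm_nnreal_pow_eq_lintegral (p := 2) (f := f) (μ := ν) (by norm_num)
  simpa using h

/-- Contraction estimate for the Duhamel term in the Gevrey-Bourgain norm. -/
theorem exists_eLpNorm_duhamelTerm_sub_le : ∃ C : ℝ≥0, ∀ σ s T : ℝ, 0 ≤ σ → 1 / 4 ≤ s → 0 < T →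
    T ≤ 1 → ∀ c : ℂ, ‖c‖ ≤ 3 → ∀ F G : ℝ × ℝ → ℂ, Measurable F → Measurable G →
    MemLp (fun z => (bourgainWeight dispersion σ s z : ℂ) * F z) 2 →
    MemLp (fun z => (bourgainWeight dispersion σ s z : ℂ) * G z) 2 →
    eLpNorm (fun z => (bourgainWeight dispersion σ s z : ℂ) *
      (duhamelTerm T c F z - duhamelTerm T c G z)) 2 ≤
    C * ENNReal.ofReal (T ^ (1 / 16 : ℝ)) *
      (eLpNorm (fun z => (bourgainWeight dispersion σ s z : ℂ) * F z) 2 +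
        eLpNorm (fun z => (bourgainWeight dispersion σ s z : ℂ) * G z) 2) ^ 2 *
      eLpNorm (fun z => (bourgainWeight dispersion σ s z : ℂ) * (F z - G z)) 2 := by
  obtain ⟨C, hC⟩ := exists_absDuhamel_le
  refine ⟨18 * NNReal.sqrt C, fun σ s T hσ hs hT hT1 c hc F G hF hG hF2 hG2 => ?_⟩
  set W := bourgainWeight dispersion σ s with hW
  have hW0 : ∀ z, 0 < W z := bourgainWeight_pos dispersion σ s
  have hWm : Measurable W := measurable_bourgainWeight dispersion σ s
  -- One majorant serves for both functions, so that all mixed terms are controlled by the same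
  -- three quantities.
  set f : ℝ × ℝ → ℝ≥0∞ := fun z => ‖(W z : ℂ) * F z‖ₑ + ‖(W z : ℂ) * G z‖ₑ with hf
  set d : ℝ × ℝ → ℝ≥0∞ := fun z => ‖(W z : ℂ) * (F z - G z)‖ₑ with hd
  have hfm : Measurable f := by rw [hf]; fun_prop
  have hdm : Measurable d := by rw [hd]; fun_prop
  have hWe : ∀ z, ‖(W z : ℂ)‖ₑ = ENNReal.ofReal (W z) := fun z => by
    rw [← ofReal_norm, Complex.norm_real, Real.norm_of_nonneg (hW0 z).le]
  have hinv : ∀ z, inverseWeight dispersion σ s z * ENNReal.ofReal (W z) = 1 := fun z => by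
    rw [inverseWeight_eq, ← ENNReal.ofReal_mul (inv_nonneg.2 (hW0 z).le), inv_mul_cancel₀ (hW0 z).ne',
      ENNReal.ofReal_one]
  set i := inverseWeight dispersion σ s with hi
  have him : Measurable i := measurable_inverseWeight dispersion σ s
  set S : ℝ × ℝ → ℝ≥0∞ := fun z => i z * f z with hS
  set D : ℝ × ℝ → ℝ≥0∞ := fun z => i z * d z with hD
  have hSm : Measurable S := him.mul hfm
  have hDm : Measurable D := him.mul hdm
  have hSe : ∀ z, S z = ‖F z‖ₑ + ‖G z‖ₑ := fun z => by
    simp only [hS, hf, enorm_mul, hWe]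
    rw [← mul_add, ← mul_assoc, hinv, one_mul]
  have hDe : ∀ z, D z = ‖F z - G z‖ₑ := fun z => by
    simp only [hD, hd, enorm_mul, hWe]
    rw [← mul_assoc, hinv, one_mul]
  set Nf := eLpNorm (fun z => (W z : ℂ) * F z) 2 with hNf
  set Ng := eLpNorm (fun z => (W z : ℂ) * G z) 2 with hNg
  set Nd := eLpNorm (fun z => (W z : ℂ) * (F z - G z)) 2 with hNd
  have hf2 : ∫⁻ z, f z ^ 2 ≤ (Nf + Ng) ^ 2 := by
    have e1 : ∫⁻ z, f z ^ 2 = eLpNorm (fun z => ‖(W z : ℂ) * F z‖ + ‖(W z : ℂ) * G z‖) 2 ^ 2 := by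
      rw [eLpNorm_two_sq]
      refine lintegral_congr fun z => ?_
      congr 1
      rw [Real.enorm_of_nonneg (by positivity), ENNReal.ofReal_add (norm_nonneg _) (norm_nonneg _),
        ofReal_norm, ofReal_norm]
    rw [e1]
    gcongr
    refine (eLpNorm_add_le hF2.1.norm hG2.1.norm (by norm_num)).trans ?_
    rw [eLpNorm_norm, eLpNorm_norm]
  have hd2 : ∫⁻ z, d z ^ 2 = Nd ^ 2 := (eLpNorm_two_sq _).symm
  have hkey := hC dispersion σ s T one_le_three_mul_dispersion hσ hs hT hT1
  have hNfin : (Nf + Ng) ^ 2 ≠ ∞ := by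
    have := hF2.2.ne
    have := hG2.2.ne
    finiteness
  -- The weighted square integral is finite, so the Duhamel integrals converge absolutely at almost
  -- every frequency.
  have hae : ∀ᵐ z, absTerm T S S S z ≠ ∞ := by
    have h1 := hkey f f f hfm hfm hfm
    have h2 : ∫⁻ z, (ENNReal.ofReal (W z) * absTerm T S S S z) ^ 2 ≠ ∞ := by
      refine ne_top_of_le_ne_top ?_ h1
      have := ne_top_of_le_ne_top hNfin hf2
      finiteness
    have hmm : Measurable fun z => (ENNReal.ofReal (W z) * absTerm T S S S z) ^ 2 :=
      (hWm.ennreal_ofReal.mul (measurable_absTerm T hSm hSm hSm)).pow_const 2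
    filter_upwards [ae_lt_top hmm h2] with z hz h
    rw [h, ENNReal.mul_top (by simpa using hW0 z)] at hz
    simp at hz
  set a := fun z => ENNReal.ofReal (W z) * absTerm T D S S z with ha
  set b := fun z => ENNReal.ofReal (W z) * absTerm T S D S z with hb
  set e := fun z => ENNReal.ofReal (W z) * absTerm T S S D z with he
  have ham : Measurable a := hWm.ennreal_ofReal.mul (measurable_absTerm T hDm hSm hSm)
  have hbm : Measurable b := hWm.ennreal_ofReal.mul (measurable_absTerm T hSm hDm hSm)
  have hem : Measurable e := hWm.ennreal_ofReal.mul (measurable_absTerm T hSm hSm hDm)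
  set Q := C * ENNReal.ofReal (T ^ (1 / 8 : ℝ)) * ((Nf + Ng) ^ 2 * (Nf + Ng) ^ 2 * Nd ^ 2) with hQ
  have ha2 : ∫⁻ z, a z ^ 2 ≤ Q := by
    refine (hkey d f f hdm hfm hfm).trans ?_
    rw [hd2, hQ]
    calc _ ≤ C * ENNReal.ofReal (T ^ (1 / 8 : ℝ)) * (Nd ^ 2 * (Nf + Ng) ^ 2 * (Nf + Ng) ^ 2) := by
          gcongr
      _ = _ := by ring
  have hb2 : ∫⁻ z, b z ^ 2 ≤ Q := by
    refine (hkey f d f hfm hdm hfm).trans ?_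
    rw [hd2, hQ]
    calc _ ≤ C * ENNReal.ofReal (T ^ (1 / 8 : ℝ)) * ((Nf + Ng) ^ 2 * Nd ^ 2 * (Nf + Ng) ^ 2) := by
          gcongr
      _ = _ := by ring
  have he2 : ∫⁻ z, e z ^ 2 ≤ Q := by
    refine (hkey f f d hfm hfm hdm).trans ?_
    rw [hd2, hQ]
    gcongr
  have hc3 : ‖c‖ₑ ≤ 3 := by
    rw [← ofReal_norm]
    calc _ ≤ ENNReal.ofReal 3 := ENNReal.ofReal_le_ofReal hc
      _ = 3 := by norm_num
  have hpt : ∀ᵐ z, ‖(W z : ℂ) * (duhamelTerm T c F z - duhamelTerm T c G z)‖ₑ ^ 2 ≤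
      9 * (4 * (a z ^ 2 + b z ^ 2 + e z ^ 2)) := by
    filter_upwards [hae] with z hz
    have h1 := enorm_duhamelTerm_sub_le T c hF hG (fun z => by rw [hSe]; exact le_self_add)
      (fun z => by rw [hSe]; exact le_add_self) (fun z => (hDe z).ge) hz
    have h2 : ‖(W z : ℂ) * (duhamelTerm T c F z - duhamelTerm T c G z)‖ₑ ≤ 3 * (a z + b z + e z) := by
      rw [enorm_mul, hWe]
      calc _ ≤ ENNReal.ofReal (W z) * (3 * (absTerm T D S S z + absTerm T S D S z + absTerm T S S D z)) := by
            gcongr; exact h1.trans (by gcongr)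
        _ = _ := by simp only [ha, hb, he]; ring
    calc _ ≤ (3 * (a z + b z + e z)) ^ 2 := by gcongr
      _ = 9 * (a z + b z + e z) ^ 2 := by ring
      _ ≤ 9 * (2 * (2 * (a z ^ 2 + b z ^ 2) + e z ^ 2)) := by
          gcongr
          refine (add_sq_le_two_mul _ _).trans ?_
          gcongr
          exact add_sq_le_two_mul _ _
      _ = 9 * (4 * (a z ^ 2 + b z ^ 2) + 2 * e z ^ 2) := by ring
      _ ≤ 9 * (4 * (a z ^ 2 + b z ^ 2) + 4 * e z ^ 2) := by gcongr; norm_num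
      _ = _ := by ring
  have hsq : eLpNorm (fun z => (W z : ℂ) * (duhamelTerm T c F z - duhamelTerm T c G z)) 2 ^ 2 ≤
      81 * 4 * Q := by
    rw [eLpNorm_two_sq]
    calc _ ≤ ∫⁻ z, 9 * (4 * (a z ^ 2 + b z ^ 2 + e z ^ 2)) := lintegral_mono_ae hpt
      _ = 9 * (4 * ((∫⁻ z, a z ^ 2) + (∫⁻ z, b z ^ 2) + ∫⁻ z, e z ^ 2)) := by
          rw [lintegral_const_mul' _ _ (by norm_num), lintegral_const_mul' _ _ (by norm_num),
            lintegral_add_left (by fun_prop), lintegral_add_left (by fun_prop)]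
      _ ≤ 9 * (4 * (Q + Q + Q)) := by gcongr
      _ = 108 * Q := by ring
      -- The factor 108 is raised to 81 · 4 = 18², a perfect square.
      _ ≤ _ := by gcongr; norm_num
  have hroot : 81 * 4 * Q = ((18 * NNReal.sqrt C : ℝ≥0) * ENNReal.ofReal (T ^ (1 / 16 : ℝ)) *
      (Nf + Ng) ^ 2 * Nd) ^ 2 := by
    have e1 : (C : ℝ≥0∞) = (NNReal.sqrt C : ℝ≥0∞) ^ 2 := by
      rw [← ENNReal.coe_pow, NNReal.sq_sqrt]
    have e2 : ENNReal.ofReal (T ^ (1 / 8 : ℝ)) = ENNReal.ofReal (T ^ (1 / 16 : ℝ)) ^ 2 := by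
      rw [← ENNReal.ofReal_pow (by positivity), ← Real.rpow_natCast, ← Real.rpow_mul hT.le]
      norm_num
    rw [hQ, e1, e2]; push_cast; ring
  rw [hroot] at hsq
  exact (ENNReal.pow_le_pow_left_iff two_ne_zero).1 hsq

/-! ### The contraction argument. -/

/-- On the ball of radius 2r the Lipschitz factor ε(‖f‖ + ‖g‖)² is at most 16εr² ≤ 1/2, so the ball
is preserved and the map contracts by 1/2. -/
theorem exists_fixed_point_of_cubic {E : Type*} [NormedAddCommGroup E] [CompleteSpace E]
    {N : E → E} (h0 : N 0 = 0) {ε r : ℝ} (hε : 0 ≤ ε) (hr : 0 ≤ r) (hεr : ε * (16 * r ^ 2) ≤ 1 / 2)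
    (hN : ∀ f g, ‖N f - N g‖ ≤ ε * (‖f‖ + ‖g‖) ^ 2 * ‖f - g‖) {a : E} (ha : ‖a‖ ≤ r) :
    ∃ f, ‖f‖ ≤ 2 * r ∧ f = a + N f := by
  have hmaps : MapsTo (fun f => a + N f) (Metric.closedBall 0 (2 * r)) (Metric.closedBall 0 (2 * r)) := by
    intro f hf
    rw [mem_closedBall_zero_iff] at hf ⊢
    have h1 := hN f 0
    rw [h0, sub_zero, sub_zero, norm_zero, add_zero] at h1
    have h2 : ε * ‖f‖ ^ 2 * ‖f‖ ≤ ε * (2 * r) ^ 2 * (2 * r) := by gcongr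
    calc ‖a + N f‖ ≤ ‖a‖ + ‖N f‖ := norm_add_le _ _
      _ ≤ 2 * r := by nlinarith
  have hcontr : ContractingWith (1 / 2 : ℝ≥0) (hmaps.restrict (fun f => a + N f) _ _) := by
    refine ⟨by norm_num, LipschitzWith.of_dist_le_mul fun f g => ?_⟩
    have hf := mem_closedBall_zero_iff.1 f.2
    have hg := mem_closedBall_zero_iff.1 g.2
    rw [Subtype.dist_eq, Subtype.dist_eq, MapsTo.val_restrict_apply, MapsTo.val_restrict_apply,
      dist_add_left, dist_eq_norm, dist_eq_norm]
    refine (hN _ _).trans (mul_le_mul_of_nonneg_right ?_ (norm_nonneg _))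
    calc ε * (‖(f : E)‖ + ‖(g : E)‖) ^ 2 ≤ ε * (2 * r + 2 * r) ^ 2 := by gcongr
      _ = ε * (16 * r ^ 2) := by ring
      _ ≤ _ := by simpa using hεr
  obtain ⟨f, hf, hfix, -⟩ := hcontr.exists_fixedPoint' Metric.isClosed_closedBall.isComplete hmaps
    (x := 0) (by simpa using hr) (edist_ne_top _ _)
  exact ⟨f, mem_closedBall_zero_iff.1 hf, hfix.symm⟩

/-- The free evolution, cut off in time, on the Fourier side. -/
noncomputable def freeTerm (φ : ℝ → ℂ) (z : ℝ × ℝ) : ℂ :=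
  φ z.1 * cutoffHat (z.2 - dispersion * z.1 ^ 3)

theorem measurable_freeTerm {φ : ℝ → ℂ} (hφ : Measurable φ) : Measurable (freeTerm φ) := by
  unfold freeTerm; fun_prop

/-- In the modulation variable the integrand separates into the weighted datum and a fixed function
of rapid decay. The cutoff of the free term has unit length, independent of T, so `A` does not
depend on T. -/
theorem exists_eLpNorm_freeTerm_le : ∃ A : ℝ≥0, ∀ σ s : ℝ, ∀ φ : ℝ → ℂ, Measurable φ →
    eLpNorm (fun z => (bourgainWeight dispersion σ s z : ℂ) * freeTerm φ z) 2 ≤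
      A * eLpNorm (fun η => (gevreyWeight σ s η : ℂ) * φ η) 2 := by
  obtain ⟨C, hC, h⟩ := exists_norm_schwartz_le (𝓕 timeCutoff)
  set B := ∫⁻ x, ‖((bracket x ^ (9 / 16 : ℝ) : ℝ) : ℂ) * cutoffHat x‖ₑ ^ 2 with hB
  have hBfin : B < ∞ := by
    calc B ≤ ∫⁻ x, ENNReal.ofReal (C ^ 2) * ENNReal.ofReal (bracket x ^ (-(23 / 8) : ℝ)) := by
          refine lintegral_mono fun x => ?_
          have hb := bracket_pos x
          rw [← ofReal_norm, ← ENNReal.ofReal_pow (norm_nonneg _), ← ENNReal.ofReal_mul (by positivity),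
            norm_mul, Complex.norm_real, Real.norm_of_nonneg (by positivity)]
          refine ENNReal.ofReal_le_ofReal ?_
          have h1 : ‖cutoffHat x‖ ≤ C * bracket x ^ (-2 : ℝ) := (h x).1
          calc (bracket x ^ (9 / 16 : ℝ) * ‖cutoffHat x‖) ^ 2
              ≤ (bracket x ^ (9 / 16 : ℝ) * (C * bracket x ^ (-2 : ℝ))) ^ 2 := by gcongr
            _ = C ^ 2 * (bracket x ^ (9 / 16 : ℝ) * bracket x ^ (-2 : ℝ)) ^ 2 := by ring
            _ = _ := by
              rw [← Real.rpow_add hb, ← Real.rpow_mul_natCast hb.le]; norm_num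
      _ < ∞ := by
          rw [lintegral_const_mul' _ _ ENNReal.ofReal_ne_top]
          exact ENNReal.mul_lt_top ENNReal.ofReal_lt_top (lintegral_bracket_rpow_lt_top (by norm_num))
  refine ⟨NNReal.sqrt B.toNNReal, fun σ s φ hφ => ?_⟩
  refine (ENNReal.pow_le_pow_left_iff two_ne_zero).1 ?_
  rw [mul_pow, ← ENNReal.coe_pow, NNReal.sq_sqrt, ENNReal.coe_toNNReal hBfin.ne, eLpNorm_two_sq,
    eLpNorm_two_sq]
  have hm := measurable_freeTerm hφ
  rw [Measure.volume_eq_prod, lintegral_prod _ (by fun_prop), ← lintegral_const_mul' _ _ hBfin.ne]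
  refine lintegral_mono fun η => le_of_eq ?_
  have e : ∀ θ, ‖(bourgainWeight dispersion σ s (η, θ) : ℂ) * freeTerm φ (η, θ)‖ₑ ^ 2 =
      ‖(gevreyWeight σ s η : ℂ) * φ η‖ₑ ^ 2 *
      (fun x => ‖((bracket x ^ (9 / 16 : ℝ) : ℝ) : ℂ) * cutoffHat x‖ₑ ^ 2)
        (θ - dispersion * η ^ 3) := by
    intro θ
    simp only [bourgainWeight, freeTerm, modulation, ← mul_pow, ← enorm_mul]
    push_cast; ring_nf
  simp_rw [e]
  have hm2 : Measurable fun x => ‖((bracket x ^ (9 / 16 : ℝ) : ℝ) : ℂ) * cutoffHat x‖ₑ ^ 2 := by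
    fun_prop
  rw [lintegral_const_mul _ (f := fun θ => ‖((bracket (θ - dispersion * η ^ 3) ^ (9 / 16 : ℝ) : ℝ) : ℂ) *
    cutoffHat (θ - dispersion * η ^ 3)‖ₑ ^ 2) (hm2.comp (measurable_id.sub_const _)),
    lintegral_sub_right_eq_self (fun x => ‖((bracket x ^ (9 / 16 : ℝ) : ℝ) : ℂ) * cutoffHat x‖ₑ ^ 2), mul_comm]

/-- `F` is a solution of the localized integral equation with datum `φ`, on the Fourier side. -/
structure IsAmplitude (σ s T : ℝ) (c : ℂ) (φ : ℝ → ℂ) (r : ℝ≥0) (F : ℝ × ℝ → ℂ) : Prop where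
  measurable : Measurable F
  eLpNorm_le : eLpNorm (fun z => (bourgainWeight dispersion σ s z : ℂ) * F z) 2 ≤ r
  eq : F =ᵐ[volume] fun z => freeTerm φ z + duhamelTerm T c F z

theorem IsAmplitude.memLp {σ s T : ℝ} {c : ℂ} {φ : ℝ → ℂ} {r : ℝ≥0} {F : ℝ × ℝ → ℂ}
    (h : IsAmplitude σ s T c φ r F) :
    MemLp (fun z => (bourgainWeight dispersion σ s z : ℂ) * F z) 2 := by
  have := h.measurable
  exact ⟨by fun_prop, h.eLpNorm_le.trans_lt ENNReal.coe_lt_top⟩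

/-- The length of the existence interval is small in terms of the datum. -/
theorem exists_amplitude : ∃ A : ℝ≥0, ∃ T₀ : ℝ≥0 → ℝ, (∀ R, 0 < T₀ R ∧ T₀ R ≤ 1) ∧
    ∀ σ s : ℝ, 0 ≤ σ → 1 / 4 ≤ s → ∀ R : ℝ≥0, ∀ c : ℂ, ‖c‖ ≤ 3 →
    (∀ φ : ℝ → ℂ, Measurable φ → eLpNorm (fun η => (gevreyWeight σ s η : ℂ) * φ η) 2 ≤ R →
      ∃ F, IsAmplitude σ s (T₀ R) c φ (2 * A * R) F) ∧
    ∀ φ φ' : ℝ → ℂ, Measurable φ → Measurable φ' → ∀ F F' : ℝ × ℝ → ℂ,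
      IsAmplitude σ s (T₀ R) c φ (2 * A * R) F → IsAmplitude σ s (T₀ R) c φ' (2 * A * R) F' →
      eLpNorm (fun z => (bourgainWeight dispersion σ s z : ℂ) * (F z - F' z)) 2 ≤
        2 * A * eLpNorm (fun η => (gevreyWeight σ s η : ℂ) * (φ η - φ' η)) 2 := by
  obtain ⟨A, hA⟩ := exists_eLpNorm_freeTerm_le
  obtain ⟨C, hC⟩ := exists_eLpNorm_duhamelTerm_sub_le
  -- The choice makes T₀^{1/16} = 1/(32C(AR)² + 1), which is the smallness condition C T₀^{1/16} ·
  -- 16(AR)² ≤ 1/2; the added 1 keeps T₀ ≤ 1.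
  obtain ⟨T₀, hT₀⟩ : ∃ T₀ : ℝ≥0 → ℝ, ∀ R, T₀ R = ((32 * C * (A * R) ^ 2 + 1 : ℝ)⁻¹) ^ 16 :=
    ⟨_, fun _ => rfl⟩
  have hT : ∀ R, 0 < T₀ R ∧ T₀ R ≤ 1 := fun R => by
    rw [hT₀]
    exact ⟨by positivity, pow_le_one₀ (by positivity) (inv_le_one_of_one_le₀ (by
      have : (0 : ℝ) ≤ 32 * C * (A * R) ^ 2 := by positivity
      linarith))⟩
  have hroot : ∀ R, T₀ R ^ (1 / 16 : ℝ) = (32 * C * (A * R) ^ 2 + 1 : ℝ)⁻¹ := fun R => by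
    rw [hT₀, ← Real.rpow_natCast, ← Real.rpow_mul (by positivity)]
    norm_num
  have hsmall : ∀ R, C * T₀ R ^ (1 / 16 : ℝ) * (16 * ((A : ℝ) * R) ^ 2) ≤ 1 / 2 := fun R => by
    rw [hroot, mul_assoc, mul_comm, mul_assoc, inv_mul_le_iff₀ (by positivity)]
    nlinarith
  refine ⟨A, T₀, hT, fun σ s hσ hs R c hc => ⟨fun φ hφ hφR => ?_,
    fun φ φ' hφ hφ' F F' hF hF' => ?_⟩⟩
  · obtain ⟨T, hTe⟩ : ∃ T, T = T₀ R := ⟨_, rfl⟩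
    obtain ⟨W, hW⟩ : ∃ W, W = bourgainWeight dispersion σ s := ⟨_, rfl⟩
    have hW0 : ∀ z, 0 < W z := hW ▸ bourgainWeight_pos dispersion σ s
    have hWm : Measurable W := hW ▸ measurable_bourgainWeight dispersion σ s
    have hCσ := hC σ s T hσ hs (hTe ▸ (hT R).1) (hTe ▸ (hT R).2) c hc
    rw [← hW] at hCσ
    -- Division by the weight carries the weighted space to L², which is complete; the fixed point
    -- is sought there.
    obtain ⟨P, hP⟩ : ∃ P : Lp ℂ 2 (volume : Measure (ℝ × ℝ)) → ℝ × ℝ → ℂ,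
      ∀ f z, P f z = ((W z)⁻¹ : ℂ) * f z := ⟨fun f z => ((W z)⁻¹ : ℂ) * f z, fun _ _ => rfl⟩
    have hPm : ∀ f, Measurable (P f) := fun f => by
      have := (Lp.stronglyMeasurable f).measurable
      rw [show P f = fun z => ((W z)⁻¹ : ℂ) * f z from funext (hP f)]
      fun_prop
    have hWP : ∀ f z, (W z : ℂ) * P f z = f z := fun f z => by
      have : (W z : ℂ) ≠ 0 := Complex.ofReal_ne_zero.2 (hW0 z).ne'
      rw [hP, ← mul_assoc, mul_inv_cancel₀ this, one_mul]
    have hWPf : ∀ f, (fun z => (W z : ℂ) * P f z) = f := fun f => funext (hWP f)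
    have hdiff : ∀ f g : Lp ℂ 2 (volume : Measure (ℝ × ℝ)),
        eLpNorm (fun z => (W z : ℂ) * (duhamelTerm T c (P f) z - duhamelTerm T c (P g) z)) 2 ≤
        C * ENNReal.ofReal (T ^ (1 / 16 : ℝ)) * (‖f‖ₑ + ‖g‖ₑ) ^ 2 * ‖f - g‖ₑ := fun f g => by
      have h := hCσ (P f) (P g) (hPm f) (hPm g) (by rw [hWPf]; exact Lp.memLp f)
        (by rw [hWPf]; exact Lp.memLp g)
      rw [hWPf, hWPf] at h
      refine h.trans (le_of_eq ?_)
      rw [Lp.enorm_def, Lp.enorm_def, Lp.enorm_def]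
      congr 1
      refine eLpNorm_congr_ae ?_
      filter_upwards [Lp.coeFn_sub f g] with z hz
      rw [mul_sub, hWP, hWP, hz, Pi.sub_apply]
    have hzero : ∀ z, duhamelTerm T c (fun _ => 0) z = 0 := fun z => by
      simp [duhamelTerm, duhamelIntegrand]
    have hPz : ∀ᵐ z, P 0 z = 0 := by
      filter_upwards [Lp.coeFn_zero ℂ 2 (volume : Measure (ℝ × ℝ))] with z hz
      rw [hP, hz]; simp
    have hmem : ∀ f, MemLp (fun z => (W z : ℂ) * duhamelTerm T c (P f) z) 2 := fun f => by
      have h := hCσ (P f) (fun _ => 0) (hPm f) measurable_const (by rw [hWPf]; exact Lp.memLp f)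
        (by simp)
      simp only [hzero, sub_zero, hWPf, mul_zero] at h
      have hm := (stronglyMeasurable_duhamelTerm T c (hPm f)).measurable
      refine ⟨by fun_prop, h.trans_lt ?_⟩
      have := (Lp.memLp f).2.ne
      rw [eLpNorm_zero', add_zero]
      finiteness
    obtain ⟨N, hN⟩ : ∃ N : Lp ℂ 2 (volume : Measure (ℝ × ℝ)) → Lp ℂ 2 (volume : Measure (ℝ × ℝ)),
      ∀ f, N f = (hmem f).toLp := ⟨fun f => (hmem f).toLp, fun _ => rfl⟩
    have hNsub : ∀ f g, ‖N f - N g‖ ≤ C * T ^ (1 / 16 : ℝ) * (‖f‖ + ‖g‖) ^ 2 * ‖f - g‖ := by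
      intro f g
      have hT0 : 0 < T := hTe ▸ (hT R).1
      rw [← ENNReal.ofReal_le_ofReal_iff (by positivity), ofReal_norm, hN, hN, ← MemLp.toLp_sub,
        Lp.enorm_toLp, ENNReal.ofReal_mul (by positivity), ENNReal.ofReal_mul (by positivity),
        ENNReal.ofReal_pow (by positivity), ENNReal.ofReal_add (norm_nonneg _) (norm_nonneg _),
        ofReal_norm, ofReal_norm, ofReal_norm, ENNReal.ofReal_mul (by positivity),
        ENNReal.ofReal_coe_nnreal]
      refine (le_of_eq ?_).trans (hdiff f g)
      congr 1
      funext z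
      simp only [Pi.sub_apply, mul_sub]
    have hN0 : N 0 = 0 := by
      have h := hCσ (P 0) (fun _ => 0) (hPm 0) measurable_const (by rw [hWPf]; exact Lp.memLp 0)
        (by simp)
      simp only [hzero, sub_zero, hWPf, mul_zero] at h
      rw [eLpNorm_congr_ae (Lp.coeFn_zero ℂ 2 (volume : Measure (ℝ × ℝ)))] at h
      rw [← norm_eq_zero, ← toReal_enorm, hN, Lp.enorm_toLp]
      have h0 : eLpNorm (0 : ℝ × ℝ → ℂ) 2 volume = 0 := eLpNorm_zero
      rw [h0, mul_zero] at h
      rw [le_antisymm h zero_le, ENNReal.toReal_zero]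
    have hfree := hA σ s φ hφ
    rw [← hW] at hfree
    have hmemfree : MemLp (fun z => (W z : ℂ) * freeTerm φ z) 2 := by
      have := measurable_freeTerm hφ
      exact ⟨by fun_prop, hfree.trans_lt (ENNReal.mul_lt_top ENNReal.coe_lt_top
        (hφR.trans_lt ENNReal.coe_lt_top))⟩
    obtain ⟨f, hfr, hf⟩ := exists_fixed_point_of_cubic hN0 (ε := C * T ^ (1 / 16 : ℝ))
      (r := A * R) (by have := (hT R).1; rw [← hTe] at this; positivity) (by positivity)
      (hTe ▸ hsmall R) hNsub (a := hmemfree.toLp) (by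
        rw [← ENNReal.ofReal_le_ofReal_iff (by positivity), ofReal_norm, Lp.enorm_toLp,
          ENNReal.ofReal_mul (by positivity), ENNReal.ofReal_coe_nnreal, ENNReal.ofReal_coe_nnreal]
        exact hfree.trans (by gcongr))
    refine ⟨P f, hPm f, ?_, ?_⟩
    · rw [← hW, hWPf, ← Lp.enorm_def, ← ofReal_norm]
      refine (ENNReal.ofReal_le_ofReal hfr).trans (le_of_eq ?_)
      rw [← ENNReal.ofReal_coe_nnreal]; push_cast; ring_nf
    · rw [← hTe]
      have h1 := Lp.coeFn_add hmemfree.toLp (N f)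
      rw [← hf, hN] at h1
      filter_upwards [h1, hmemfree.coeFn_toLp, (hmem f).coeFn_toLp] with z h1 h2 h3
      rw [Pi.add_apply, h2, h3, ← mul_add] at h1
      rw [hP, h1, ← mul_assoc, inv_mul_cancel₀ (Complex.ofReal_ne_zero.2 (hW0 z).ne'), one_mul]
  · have h1 := hC σ s (T₀ R) hσ hs (hT R).1 (hT R).2 c hc F F' hF.measurable hF'.measurable
      hF.memLp hF'.memLp
    have h2 := hA σ s (fun η => φ η - φ' η) (hφ.sub hφ')
    obtain ⟨W, hW⟩ : ∃ W, W = bourgainWeight dispersion σ s := ⟨_, rfl⟩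
    have hWm : Measurable W := hW ▸ measurable_bourgainWeight dispersion σ s
    have hFr := hF.eLpNorm_le
    have hFr' := hF'.eLpNorm_le
    have hL := hF.memLp
    have hL' := hF'.memLp
    rw [← hW] at h1 h2 hFr hFr' hL hL' ⊢
    have hm : Measurable (freeTerm fun η => φ η - φ' η) := measurable_freeTerm (hφ.sub hφ')
    have hd := (stronglyMeasurable_duhamelTerm (T₀ R) c hF.measurable).measurable
    have hd' := (stronglyMeasurable_duhamelTerm (T₀ R) c hF'.measurable).measurable
    set X := eLpNorm (fun z => (W z : ℂ) * (F z - F' z)) 2 with hX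
    have hXfin : X ≠ ∞ := by
      have := (hL.sub hL').2.ne
      refine ne_of_eq_of_ne ?_ this
      rw [hX]; congr 1; funext z; simp only [Pi.sub_apply, mul_sub]
    have hhalf : C * ENNReal.ofReal (T₀ R ^ (1 / 16 : ℝ)) *
        (eLpNorm (fun z => (W z : ℂ) * F z) 2 + eLpNorm (fun z => (W z : ℂ) * F' z) 2) ^ 2 ≤ 1 / 2 := by
      calc _ ≤ C * ENNReal.ofReal (T₀ R ^ (1 / 16 : ℝ)) * ((2 * A * R : ℝ≥0) + (2 * A * R : ℝ≥0)) ^ 2 := by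
            gcongr
        _ = ENNReal.ofReal (C * T₀ R ^ (1 / 16 : ℝ) * (16 * ((A : ℝ) * R) ^ 2)) := by
            have := (hT R).1
            rw [ENNReal.ofReal_mul (by positivity), ENNReal.ofReal_mul (by positivity),
              ENNReal.ofReal_coe_nnreal]
            congr 1
            rw [← ENNReal.coe_add, ← ENNReal.coe_pow, ← ENNReal.ofReal_coe_nnreal]
            push_cast; ring_nf
        _ ≤ ENNReal.ofReal (1 / 2) := ENNReal.ofReal_le_ofReal (hsmall R)
        _ = 1 / 2 := by
            rw [ENNReal.ofReal_div_of_pos two_pos]; simp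
    -- The two integral equations are subtracted. The Duhamel difference is at most half of `X`, and
    -- since `X` is finite it can be absorbed on the left.
    have hle : X ≤ A * eLpNorm (fun η => (gevreyWeight σ s η : ℂ) * (φ η - φ' η)) 2 + 1 / 2 * X := by
      calc X = eLpNorm (fun z => (W z : ℂ) * freeTerm (fun η => φ η - φ' η) z +
            (W z : ℂ) * (duhamelTerm (T₀ R) c F z - duhamelTerm (T₀ R) c F' z)) 2 := by
            refine eLpNorm_congr_ae ?_
            filter_upwards [hF.eq, hF'.eq] with z h h'
            rw [h, h']; unfold freeTerm; ring
        _ ≤ _ := eLpNorm_add_le (by fun_prop) (by fun_prop) (by norm_num)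
        _ ≤ _ := by
            refine add_le_add h2 (h1.trans ?_)
            gcongr
    have hX2 : X = 1 / 2 * X + 1 / 2 * X := by
      rw [← add_mul, ENNReal.add_halves, one_mul]
    have hfin : 1 / 2 * X ≠ ∞ := by finiteness
    have h3 : 1 / 2 * X ≤ A * eLpNorm (fun η => (gevreyWeight σ s η : ℂ) * (φ η - φ' η)) 2 := by
      refine (ENNReal.add_le_add_iff_right hfin).1 ?_
      rw [← hX2]; exact hle
    calc X = 2 * (1 / 2 * X) := by
          rw [← mul_assoc, one_div, ENNReal.mul_inv_cancel two_ne_zero ENNReal.ofNat_ne_top, one_mul]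
      _ ≤ 2 * (A * eLpNorm (fun η => (gevreyWeight σ s η : ℂ) * (φ η - φ' η)) 2) := by gcongr
      _ = _ := by ring

/-! ### Plancherel transform, Fourier integral and the Gevrey norm. -/

theorem continuous_neg_innerₗ (V : Type*) [NormedAddCommGroup V] [InnerProductSpace ℝ V] :
    Continuous fun p : V × V => (-innerₗ V) p.1 p.2 := by
  change Continuous fun p : V × V => -inner ℝ p.1 p.2
  fun_prop

section Bridge

variable {V : Type*} [NormedAddCommGroup V] [InnerProductSpace ℝ V] [FiniteDimensional ℝ V]
  [MeasurableSpace V] [BorelSpace V]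

theorem continuous_fourierInv_of_integrable {g : V → ℂ} (hg : Integrable g) : Continuous (𝓕⁻ g) :=
  VectorFourier.fourierIntegral_continuous Real.continuous_fourierChar
    (L := -innerₗ V) (continuous_neg_innerₗ V) hg

theorem integral_fourierInv_mul_eq {f g : V → ℂ} (hf : Integrable f) (hg : Integrable g) :
    ∫ x, 𝓕⁻ f x * g x = ∫ x, f x * 𝓕⁻ g x := by
  have h := VectorFourier.integral_fourierIntegral_smul_eq_flip (μ := (volume : Measure V))
    (ν := (volume : Measure V)) (L := -innerₗ V)
    Real.continuous_fourierChar (continuous_neg_innerₗ V) hf hg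
  have hL : (-innerₗ V).flip = -innerₗ V := by
    ext x y; simp [real_inner_comm]
  rw [hL] at h
  exact h

/-- The Plancherel inverse Fourier transform of an integrable square integrable function is given
by the inverse Fourier integral. -/
theorem fourierInv_toLp_ae_eq {g : V → ℂ} (h1 : Integrable g) (h2 : MemLp g 2 (volume : Measure V)) :
    ((𝓕⁻ (h2.toLp g) : Lp ℂ 2 (volume : Measure V)) : V → ℂ) =ᵐ[volume] 𝓕⁻ g := by
  -- Both sides are tested against smooth functions of compact support: the Plancherel transform is
  -- the distributional one, and the inverse Fourier integral is moved onto the test function by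
  -- Fubini.
  refine ae_eq_of_integral_contDiff_smul_eq
    ((Lp.memLp _).locallyIntegrable (by norm_num))
    (continuous_fourierInv_of_integrable h1).locallyIntegrable fun χ hχ hχs => ?_
  have hs : HasCompactSupport fun x => (χ x : ℂ) := hχs.comp_left Complex.ofReal_zero
  obtain ⟨f, hf⟩ : ∃ f : SchwartzMap V ℂ, ∀ x, f x = χ x :=
    ⟨hs.toSchwartzMap (Complex.ofRealCLM.contDiff.comp hχ), fun _ => rfl⟩
  have e := congrArg (fun S : TemperedDistribution V ℂ => S f)
    (Lp.fourierInv_toTemperedDistribution_eq (h2.toLp g))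
  simp only [TemperedDistribution.fourierInv_apply, Lp.toTemperedDistribution_apply] at e
  calc ∫ x, χ x • (𝓕⁻ (h2.toLp g) : Lp ℂ 2 (volume : Measure V)) x
      = ∫ x, f x • (𝓕⁻ (h2.toLp g) : Lp ℂ 2 (volume : Measure V)) x := by
        simp only [hf]; rfl
    _ = ∫ x, (𝓕⁻ f) x • (h2.toLp g) x := e.symm
    _ = ∫ x, 𝓕⁻ (f : V → ℂ) x * g x := by
        refine integral_congr_ae ?_
        filter_upwards [h2.coeFn_toLp] with x hx
        rw [hx, SchwartzMap.fourierInv_coe, smul_eq_mul]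
    _ = ∫ x, f x * 𝓕⁻ g x := integral_fourierInv_mul_eq f.integrable h1
    _ = _ := by simp only [hf]; rfl

theorem fourier_toLp_ae_eq {w g : V → ℂ} (hw : MemLp w 2 (volume : Measure V)) (h1 : Integrable g)
    (h2 : MemLp g 2 (volume : Measure V)) (h : w =ᵐ[volume] 𝓕⁻ g) :
    𝓕 (hw.toLp w) = h2.toLp g := by
  have : hw.toLp w = 𝓕⁻ (h2.toLp g) := by
    refine Lp.ext ?_
    filter_upwards [hw.coeFn_toLp, fourierInv_toLp_ae_eq h1 h2, h] with x h1 h2 h3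
    rw [h1, h2, h3]
  rw [this, FourierTransform.fourier_fourierInv_eq]

theorem memLp_fourierInv {g : V → ℂ} (h1 : Integrable g) (h2 : MemLp g 2 (volume : Measure V)) :
    MemLp (𝓕⁻ g) 2 (volume : Measure V) :=
  (memLp_congr_ae (fourierInv_toLp_ae_eq h1 h2)).1 (Lp.memLp _)

end Bridge

/-- The Plancherel-Fourier transform of a real square integrable function. -/
noncomputable def symbol (f : ℝ → ℝ) : ℝ → ℂ := by
  classical
  exact if hf : MemLp (fun x => (f x : ℂ)) 2 (volume : Measure ℝ) then
    (𝓕 (hf.toLp (fun x => (f x : ℂ))) : Lp ℂ 2 (volume : Measure ℝ)) else 0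

theorem symbol_of_memLp {f : ℝ → ℝ} (hf : MemLp (fun x => (f x : ℂ)) 2 (volume : Measure ℝ)) :
    symbol f = (𝓕 (hf.toLp (fun x => (f x : ℂ))) : Lp ℂ 2 (volume : Measure ℝ)) := dif_pos hf

theorem measurable_symbol (f : ℝ → ℝ) : Measurable (symbol f) := by
  by_cases hf : MemLp (fun x => (f x : ℂ)) 2 (volume : Measure ℝ)
  · rw [symbol_of_memLp hf]; exact (Lp.stronglyMeasurable _).measurable
  · unfold symbol; rw [dif_neg hf]; exact measurable_const

theorem gevreyENorm_eq {f : ℝ → ℝ} (hf : MemLp (fun x => (f x : ℂ)) 2 (volume : Measure ℝ))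
    (σ s : ℝ) :
    gevreyENorm σ s f = eLpNorm (fun η => (gevreyWeight σ s η : ℂ) * symbol f η) 2 := by
  unfold gevreyENorm
  rw [iInf_pos hf, symbol_of_memLp hf]; rfl

/-- Outside L² the norm is an infimum over an empty family, hence ∞. -/
theorem MemGevrey.memLp {σ s : ℝ} {f : ℝ → ℝ} (hf : MemGevrey σ s f) :
    MemLp (fun x => (f x : ℂ)) 2 (volume : Measure ℝ) := by
  by_contra h
  unfold MemGevrey gevreyENorm at hf
  rw [iInf_neg h] at hf
  exact lt_irrefl _ hf

theorem MemGevrey.memLp_symbol {σ s : ℝ} {f : ℝ → ℝ} (hf : MemGevrey σ s f) :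
    MemLp (fun η => (gevreyWeight σ s η : ℂ) * symbol f η) 2 := by
  have := measurable_symbol f
  refine ⟨by fun_prop, ?_⟩
  rw [← gevreyENorm_eq hf.memLp]; exact hf

theorem symbol_sub {f g : ℝ → ℝ} (hf : MemLp (fun x => (f x : ℂ)) 2 (volume : Measure ℝ))
    (hg : MemLp (fun x => (g x : ℂ)) 2 (volume : Measure ℝ)) :
    symbol (f - g) =ᵐ[volume] fun η => symbol f η - symbol g η := by
  have hfg : MemLp (fun x => ((f - g) x : ℂ)) 2 (volume : Measure ℝ) := by
    simpa only [Pi.sub_apply, Complex.ofReal_sub] using! hf.sub hg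
  have e : hfg.toLp = hf.toLp - hg.toLp := by
    rw [← MemLp.toLp_sub]
    congr 1
    funext x; simp
  have e2 : 𝓕 (hf.toLp - hg.toLp) = 𝓕 hf.toLp - 𝓕 hg.toLp :=
    (Lp.fourierTransformₗᵢ ℝ ℂ).map_sub _ _
  rw [symbol_of_memLp hf, symbol_of_memLp hg, symbol_of_memLp hfg, e, e2]
  exact Lp.coeFn_sub _ _

theorem gevreyENorm_sub_eq {f g : ℝ → ℝ} {σ s : ℝ} (hf : MemGevrey σ s f) (hg : MemGevrey σ s g) :
    gevreyENorm σ s (f - g) =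
      eLpNorm (fun η => (gevreyWeight σ s η : ℂ) * (symbol f η - symbol g η)) 2 := by
  have hfg : MemLp (fun x => ((f - g) x : ℂ)) 2 (volume : Measure ℝ) := by
    simpa only [Pi.sub_apply, Complex.ofReal_sub] using! hf.memLp.sub hg.memLp
  rw [gevreyENorm_eq hfg]
  refine eLpNorm_congr_ae ?_
  filter_upwards [symbol_sub hf.memLp hg.memLp] with η h
  rw [h]

theorem MemGevrey.sub {f g : ℝ → ℝ} {σ s : ℝ} (hf : MemGevrey σ s f) (hg : MemGevrey σ s g) :
    MemGevrey σ s (f - g) := by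
  unfold MemGevrey
  rw [gevreyENorm_sub_eq hf hg]
  simp only [mul_sub]
  exact (hf.memLp_symbol.sub hg.memLp_symbol).2

theorem gevreyENorm_le_add {f g : ℝ → ℝ} {σ s : ℝ} (hf : MemGevrey σ s f) (hg : MemGevrey σ s g) :
    gevreyENorm σ s f ≤ gevreyENorm σ s (f - g) + gevreyENorm σ s g := by
  rw [gevreyENorm_sub_eq hf hg, gevreyENorm_eq hf.memLp, gevreyENorm_eq hg.memLp]
  have hf' := measurable_symbol f
  have hg' := measurable_symbol g
  refine le_trans (le_of_eq ?_) (eLpNorm_add_le (by fun_prop) (by fun_prop) (by norm_num))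
  congr 1; funext η; simp only [Pi.add_apply]; ring

/-! ### Smoothness and analyticity of Gevrey functions. -/

theorem integrable_exp_neg_mul_abs {a : ℝ} (ha : 0 < a) :
    Integrable fun x : ℝ => Real.exp (-a * |x|) := by
  rw [← integrableOn_univ, ← Iic_union_Ioi (a := (0 : ℝ)), integrableOn_union]
  refine ⟨(integrableOn_exp_mul_Iic ha 0).congr_fun (fun x hx => ?_) measurableSet_Iic,
    (exp_neg_integrableOn_Ioi 0 ha).congr_fun (fun x hx => ?_) measurableSet_Ioi⟩
  · simp only [abs_of_nonpos (mem_Iic.1 hx)]; congr 1; ring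
  · simp only [abs_of_pos (mem_Ioi.1 hx)]

/-- Exponential weights of smaller radius are controlled by the Gevrey weight in `L¹`. -/
theorem exists_lintegral_exp_mul_le {σ' σ : ℝ} (h : σ' < σ) : ∃ C : ℝ≥0, ∀ s : ℝ, 0 ≤ s →
    ∀ φ : ℝ → ℂ, Measurable φ → ∫⁻ η, ‖(Real.exp (σ' * |2 * Real.pi * η|) : ℂ) * φ η‖ₑ ≤
      C * eLpNorm (fun η => (gevreyWeight σ s η : ℂ) * φ η) 2 := by
  set B := ∫⁻ η : ℝ, ENNReal.ofReal (Real.exp (-((σ - σ') * 2 * (2 * Real.pi)) * |η|)) with hB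
  have hBfin : B < ∞ :=
    (integrable_exp_neg_mul_abs (by have := Real.pi_pos; have := sub_pos.2 h; positivity)).lintegral_lt_top
  refine ⟨NNReal.sqrt B.toNNReal, fun s hs φ hφ => ?_⟩
  have hsq : (∫⁻ η, ‖(Real.exp (σ' * |2 * Real.pi * η|) : ℂ) * φ η‖ₑ) ^ 2 ≤
      B * ∫⁻ η, ‖(gevreyWeight σ s η : ℂ) * φ η‖ₑ ^ 2 := by
    calc _ ≤ (∫⁻ η, ENNReal.ofReal (Real.exp (-((σ - σ') * |2 * Real.pi * η|))) *
          ‖(gevreyWeight σ s η : ℂ) * φ η‖ₑ) ^ 2 := by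
          gcongr with η
          have hw := gevreyWeight_pos σ s η
          have h1 : 1 ≤ bracket (2 * Real.pi * η) ^ s := Real.one_le_rpow (one_le_bracket _) hs
          rw [enorm_mul, enorm_mul, ← mul_assoc, ← ofReal_norm (Complex.ofReal _),
            ← ofReal_norm (Complex.ofReal (gevreyWeight σ s η)), ← ENNReal.ofReal_mul (by positivity)]
          gcongr
          rw [Complex.norm_real, Complex.norm_real, Real.norm_of_nonneg (by positivity),
            Real.norm_of_nonneg hw.le]
          unfold gevreyWeight
          rw [← mul_assoc, ← Real.exp_add]
          calc _ = Real.exp (σ' * |2 * Real.pi * η|) * 1 := (mul_one _).symm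
            _ ≤ _ := by gcongr; linarith
      _ ≤ _ := by
          refine (sq_lintegral_mul_le volume (by fun_prop) (by fun_prop)).trans ?_
          rw [hB]
          gcongr with η
          rw [← ENNReal.ofReal_pow (Real.exp_pos _).le, ← Real.exp_nat_mul]
          refine ENNReal.ofReal_le_ofReal (le_of_eq ?_)
          rw [abs_mul, abs_of_pos (by positivity : 0 < 2 * Real.pi)]
          congr 1; push_cast; ring
  refine (ENNReal.pow_le_pow_left_iff two_ne_zero).1 ?_
  rw [mul_pow, ← ENNReal.coe_pow, NNReal.sq_sqrt, ENNReal.coe_toNNReal hBfin.ne, eLpNorm_two_sq]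
  exact hsq

theorem integrable_exp_mul_of_memLp {σ' σ s : ℝ} (h : σ' < σ) (hs : 0 ≤ s) {φ : ℝ → ℂ}
    (hφ : Measurable φ) (h2 : MemLp (fun η => (gevreyWeight σ s η : ℂ) * φ η) 2) :
    Integrable fun η => (Real.exp (σ' * |2 * Real.pi * η|) : ℂ) * φ η := by
  obtain ⟨C, hC⟩ := exists_lintegral_exp_mul_le h
  exact ⟨by fun_prop, (hC s hs φ hφ).trans_lt (ENNReal.mul_lt_top ENNReal.coe_lt_top h2.2)⟩

theorem integrable_of_memLp_gevreyWeight {σ s : ℝ} (hσ : 0 < σ) (hs : 0 ≤ s) {φ : ℝ → ℂ}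
    (hφ : Measurable φ) (h2 : MemLp (fun η => (gevreyWeight σ s η : ℂ) * φ η) 2) : Integrable φ := by
  simpa using integrable_exp_mul_of_memLp hσ hs hφ h2

theorem one_le_gevreyWeight {σ s : ℝ} (hσ : 0 ≤ σ) (hs : 0 ≤ s) (η : ℝ) :
    1 ≤ gevreyWeight σ s η := by
  have h1 : 1 ≤ bracket (2 * Real.pi * η) ^ s := Real.one_le_rpow (one_le_bracket _) hs
  have h2 : 1 ≤ Real.exp (σ * |2 * Real.pi * η|) := Real.one_le_exp (by positivity)
  exact one_le_mul_of_one_le_of_one_le h2 h1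

theorem memLp_of_memLp_gevreyWeight {σ s : ℝ} (hσ : 0 ≤ σ) (hs : 0 ≤ s) {φ : ℝ → ℂ}
    (hφ : Measurable φ) (h2 : MemLp (fun η => (gevreyWeight σ s η : ℂ) * φ η) 2) :
    MemLp φ 2 (volume : Measure ℝ) := by
  refine h2.mono hφ.aestronglyMeasurable (Eventually.of_forall fun η => ?_)
  rw [norm_mul, Complex.norm_real, Real.norm_of_nonneg (gevreyWeight_pos _ _ _).le]
  exact le_mul_of_one_le_left (norm_nonneg _) (one_le_gevreyWeight hσ hs η)

theorem MemGevrey.integrable_symbol {σ s : ℝ} (hσ : 0 < σ) (hs : 0 ≤ s) {f : ℝ → ℝ}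
    (hf : MemGevrey σ s f) : Integrable (symbol f) :=
  integrable_of_memLp_gevreyWeight hσ hs (measurable_symbol f) hf.memLp_symbol

theorem MemGevrey.ae_eq_fourierInv {σ s : ℝ} (hσ : 0 < σ) (hs : 0 ≤ s) {f : ℝ → ℝ}
    (hf : MemGevrey σ s f) : (fun x => (f x : ℂ)) =ᵐ[volume] 𝓕⁻ (symbol f) := by
  have h2 := memLp_of_memLp_gevreyWeight hσ.le hs (measurable_symbol f) hf.memLp_symbol
  have h := fourierInv_toLp_ae_eq (hf.integrable_symbol hσ hs) h2
  have e : h2.toLp = 𝓕 hf.memLp.toLp := by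
    refine Lp.ext ?_
    filter_upwards [h2.coeFn_toLp] with x hx
    rw [hx, symbol_of_memLp hf.memLp]
  rw [e, FourierTransform.fourierInv_fourier_eq] at h
  exact hf.memLp.coeFn_toLp.symm.trans h

/-- Any integrable and square integrable function that represents `f` by the inverse Fourier
integral is its symbol. This identifies the symbols of the constructed time slices. -/
theorem symbol_ae_eq {f : ℝ → ℝ} {φ : ℝ → ℂ} (h1 : Integrable φ) (h2 : MemLp φ 2 (volume : Measure ℝ))
    (h : (fun x => (f x : ℂ)) =ᵐ[volume] 𝓕⁻ φ) :
    MemLp (fun x => (f x : ℂ)) 2 (volume : Measure ℝ) ∧ symbol f =ᵐ[volume] φ := by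
  have hf := (memLp_congr_ae h).2 (memLp_fourierInv h1 h2)
  refine ⟨hf, ?_⟩
  rw [symbol_of_memLp hf, fourier_toLp_ae_eq hf h1 h2 h]
  exact h2.coeFn_toLp

theorem gevreyENorm_of_ae_eq_fourierInv {σ s : ℝ} (hσ : 0 < σ) (hs : 0 ≤ s) {f : ℝ → ℝ} {φ : ℝ → ℂ}
    (hφ : Measurable φ) (hρ : MemLp (fun η => (gevreyWeight σ s η : ℂ) * φ η) 2)
    (h : (fun x => (f x : ℂ)) =ᵐ[volume] 𝓕⁻ φ) :
    gevreyENorm σ s f = eLpNorm (fun η => (gevreyWeight σ s η : ℂ) * φ η) 2 := by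
  obtain ⟨hf, e⟩ := symbol_ae_eq (integrable_of_memLp_gevreyWeight hσ hs hφ hρ)
    (memLp_of_memLp_gevreyWeight hσ.le hs hφ hρ) h
  rw [gevreyENorm_eq hf]
  refine eLpNorm_congr_ae ?_
  filter_upwards [e] with η h
  rw [h]

/-- Conjugating the inversion formula of a real function shows that the reflected conjugate symbol
represents the same function; uniqueness of the symbol concludes. -/
theorem MemGevrey.conj_symbol {σ s : ℝ} (hσ : 0 < σ) (hs : 0 ≤ s) {f : ℝ → ℝ}
    (hf : MemGevrey σ s f) : ∀ᵐ η, (starRingEnd ℂ) (symbol f (-η)) = symbol f η := by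
  have h1 := hf.integrable_symbol hσ hs
  have h2 := memLp_of_memLp_gevreyWeight hσ.le hs (measurable_symbol f) hf.memLp_symbol
  have h1' : Integrable fun η => (starRingEnd ℂ) (symbol f (-η)) :=
    Complex.conjCLE.toContinuousLinearMap.integrable_comp h1.comp_neg
  have h2' : MemLp (fun η => (starRingEnd ℂ) (symbol f (-η))) 2 (volume : Measure ℝ) := by
    have := h2.comp_measurePreserving (Measure.measurePreserving_neg (volume : Measure ℝ))
    exact this.star
  refine ((symbol_ae_eq h1' h2' ?_).2).symm
  filter_upwards [hf.ae_eq_fourierInv hσ hs] with x hx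
  have h3 := congrArg (starRingEnd ℂ) hx
  rw [Complex.conj_ofReal, fourierInv_eq_integral_wave, ← integral_conj] at h3
  rw [h3, fourierInv_eq_integral_wave, ← integral_neg_eq_self]
  refine integral_congr_ae (Eventually.of_forall fun η => ?_)
  simp only [map_mul, conj_wave, mul_neg, neg_neg]

theorem eLpNorm_fourierInv {V : Type*} [NormedAddCommGroup V] [InnerProductSpace ℝ V]
    [FiniteDimensional ℝ V] [MeasurableSpace V] [BorelSpace V] {g : V → ℂ} (h1 : Integrable g)
    (h2 : MemLp g 2 (volume : Measure V)) : eLpNorm (𝓕⁻ g) 2 volume = eLpNorm g 2 volume := by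
  rw [← eLpNorm_congr_ae (fourierInv_toLp_ae_eq h1 h2), ← Lp.enorm_def, ← Lp.enorm_toLp h2,
    ← ofReal_norm, ← ofReal_norm]
  congr 1
  exact (Lp.fourierTransformₗᵢ V ℂ).symm.norm_map _

theorem eLpNorm_real_fourierInv {g : ℝ → ℂ} (h1 : Integrable g)
    (h2 : MemLp g 2 (volume : Measure ℝ)) : eLpNorm (𝓕⁻ g) 2 volume = eLpNorm g 2 volume :=
  eLpNorm_fourierInv h1 h2

/-- The symbol of the `k`-th derivative. -/
noncomputable def derivSymbol (k : ℕ) (φ : ℝ → ℂ) (η : ℝ) : ℂ :=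
  (2 * Real.pi * Complex.I * η) ^ k * φ η

theorem norm_derivSymbol (k : ℕ) (φ : ℝ → ℂ) (η : ℝ) :
    ‖derivSymbol k φ η‖ = |2 * Real.pi * η| ^ k * ‖φ η‖ := by
  unfold derivSymbol
  rw [norm_mul, norm_pow]
  congr 2
  simp [abs_mul]

theorem derivSymbol_zero (φ : ℝ → ℂ) : derivSymbol 0 φ = φ := by
  funext η; simp [derivSymbol]

@[fun_prop]
theorem measurable_derivSymbol (k : ℕ) {φ : ℝ → ℂ} (hφ : Measurable φ) :
    Measurable (derivSymbol k φ) := by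
  unfold derivSymbol; fun_prop

theorem pow_le_mul_exp {a : ℝ} (ha : 0 < a) (k : ℕ) (y : ℝ) :
    |y| ^ k ≤ (k.factorial / a ^ k) * Real.exp (a * |y|) := by
  have h := Real.pow_div_factorial_le_exp (a * |y|) (by positivity) k
  rw [div_le_iff₀ (by positivity), mul_pow] at h
  rw [div_mul_eq_mul_div, le_div_iff₀ (by positivity)]
  linarith

/-- Any small exponential absorbs the polynomial factor, by y^k/k! ≤ e^y. -/
theorem norm_derivSymbol_le {a : ℝ} (ha : 0 < a) (k : ℕ) (φ : ℝ → ℂ) (η : ℝ) :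
    ‖derivSymbol k φ η‖ ≤ (k.factorial / a ^ k) * ‖(Real.exp (a * |2 * Real.pi * η|) : ℂ) * φ η‖ := by
  rw [norm_derivSymbol, norm_mul, Complex.norm_real, Real.norm_of_nonneg (Real.exp_pos _).le,
    ← mul_assoc]
  gcongr
  exact pow_le_mul_exp ha k _

theorem hasDerivAt_fourierInv {φ : ℝ → ℂ} (h0 : Integrable φ) (h1 : Integrable (derivSymbol 1 φ))
    (x : ℝ) : HasDerivAt (𝓕⁻ φ) (𝓕⁻ (derivSymbol 1 φ) x) x := by
  have hm : Integrable fun η : ℝ => η • φ η := by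
    refine (h1.const_mul (2 * Real.pi * Complex.I)⁻¹).congr (Eventually.of_forall fun η => ?_)
    have : (2 * Real.pi * Complex.I : ℂ) ≠ 0 := Complex.two_pi_I_ne_zero
    simp only [derivSymbol, pow_one, Complex.real_smul]
    rw [← mul_assoc, ← mul_assoc, inv_mul_cancel₀ this, one_mul]
  have h := (Real.hasDerivAt_fourier h0 hm (-x)).scomp x (hasDerivAt_neg x)
  have e : (𝓕 φ ∘ fun y => -y) = 𝓕⁻ φ := by
    funext y; rw [Real.fourierInv_eq_fourier_neg]; rfl
  rw [show Neg.neg = fun y : ℝ => -y from rfl, e] at h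
  convert! h using 1
  rw [Real.fourierInv_eq_fourier_neg, fourier_eq_integral_wave, fourier_eq_integral_wave,
    ← integral_smul]
  refine integral_congr_ae (Eventually.of_forall fun η => ?_)
  simp only [derivSymbol, pow_one, smul_eq_mul, Complex.real_smul]
  push_cast; ring

theorem derivSymbol_one_derivSymbol (k : ℕ) (φ : ℝ → ℂ) :
    derivSymbol 1 (derivSymbol k φ) = derivSymbol (k + 1) φ := by
  funext η; unfold derivSymbol; ring

section ExponentialDecay

variable {a : ℝ} {φ : ℝ → ℂ}

theorem integrable_derivSymbol (ha : 0 < a) (hφ : Measurable φ)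
    (h : Integrable fun η => (Real.exp (a * |2 * Real.pi * η|) : ℂ) * φ η) (k : ℕ) :
    Integrable (derivSymbol k φ) :=
  (h.norm.const_mul (k.factorial / a ^ k)).mono' (by fun_prop)
    (Eventually.of_forall fun η => norm_derivSymbol_le ha k φ η)

theorem hasDerivAt_fourierInv_derivSymbol (ha : 0 < a) (hφ : Measurable φ)
    (h : Integrable fun η => (Real.exp (a * |2 * Real.pi * η|) : ℂ) * φ η) (k : ℕ) (x : ℝ) :
    HasDerivAt (𝓕⁻ (derivSymbol k φ)) (𝓕⁻ (derivSymbol (k + 1) φ) x) x := by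
  rw [← derivSymbol_one_derivSymbol]
  refine hasDerivAt_fourierInv (integrable_derivSymbol ha hφ h k) ?_ x
  rw [derivSymbol_one_derivSymbol]
  exact integrable_derivSymbol ha hφ h (k + 1)

/-- It transfers derivatives from the complex Fourier integral to the real function it represents,
and shows that the complex derivative is real. -/
theorem hasDerivAt_of_ofReal_eq {f : ℝ → ℝ} {g : ℝ → ℂ} {g' : ℂ} {x : ℝ} (h : ∀ y, (f y : ℂ) = g y)
    (hg : HasDerivAt g g' x) : HasDerivAt f g'.re x ∧ (g'.re : ℂ) = g' := by
  have h1 : HasDerivAt f g'.re x := by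
    have h2 := Complex.reCLM.hasFDerivAt.comp_hasDerivAt x hg
    refine (HasDerivAt.congr_of_eventuallyEq h2 (Eventually.of_forall fun y => ?_))
    simp [← h]
  refine ⟨h1, ?_⟩
  have h3 := h1.ofReal_comp
  rw [show (fun y => (f y : ℂ)) = g from funext h] at h3
  exact h3.unique hg

theorem iteratedDeriv_eq_fourierInv (ha : 0 < a) (hφ : Measurable φ)
    (h : Integrable fun η => (Real.exp (a * |2 * Real.pi * η|) : ℂ) * φ η) {f : ℝ → ℝ}
    (hf : ∀ x, (f x : ℂ) = 𝓕⁻ φ x) (k : ℕ) :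
    (∀ x, ((iteratedDeriv k f x : ℝ) : ℂ) = 𝓕⁻ (derivSymbol k φ) x) ∧
      ∀ x, HasDerivAt (iteratedDeriv k f) (iteratedDeriv (k + 1) f x) x := by
  have step : ∀ k, (∀ x, ((iteratedDeriv k f x : ℝ) : ℂ) = 𝓕⁻ (derivSymbol k φ) x) →
      ∀ x, HasDerivAt (iteratedDeriv k f) (iteratedDeriv (k + 1) f x) x ∧
        ((iteratedDeriv (k + 1) f x : ℝ) : ℂ) = 𝓕⁻ (derivSymbol (k + 1) φ) x := by
    intro k hk x
    obtain ⟨h1, h2⟩ := hasDerivAt_of_ofReal_eq hk (hasDerivAt_fourierInv_derivSymbol ha hφ h k x)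
    rw [iteratedDeriv_succ, h1.deriv]
    exact ⟨h1, h2⟩
  have all : ∀ k, ∀ x, ((iteratedDeriv k f x : ℝ) : ℂ) = 𝓕⁻ (derivSymbol k φ) x := by
    intro k
    induction k with
    | zero => intro x; rw [iteratedDeriv_zero, derivSymbol_zero, hf]
    | succ k ih => exact fun x => (step k ih x).2
  exact ⟨all k, fun x => (step k (all k) x).1⟩

theorem contDiff_of_eq_fourierInv (ha : 0 < a) (hφ : Measurable φ)
    (h : Integrable fun η => (Real.exp (a * |2 * Real.pi * η|) : ℂ) * φ η) {f : ℝ → ℝ}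
    (hf : ∀ x, (f x : ℂ) = 𝓕⁻ φ x) (n : ℕ) : ContDiff ℝ n f := by
  refine contDiff_of_differentiable_iteratedDeriv fun m _ => fun x =>
    ((iteratedDeriv_eq_fourierInv ha hφ h hf m).2 x).differentiableAt

end ExponentialDecay

/-- The inverse Fourier integral of a symbol of Gevrey class is holomorphic in the strip. -/
theorem extendsToStrip_of_eq_fourierInv {σ : ℝ} {φ : ℝ → ℂ} (hφ : Measurable φ)
    (h : ∀ a < σ, Integrable fun η => (Real.exp (a * |2 * Real.pi * η|) : ℂ) * φ η) {f : ℝ → ℝ}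
    (hf : ∀ x, (f x : ℂ) = 𝓕⁻ φ x) : ExtendsToStrip σ f := by
  refine ⟨fun z => ∫ η : ℝ, Complex.exp (2 * Real.pi * Complex.I * η * z) * φ η, fun z hz => ?_, fun x => ?_⟩
  · rw [mem_ofPred_eq] at hz
    -- One ε is spent on moving inside a disc around `z`, the other on absorbing the linear factor
    -- produced by differentiation.
    obtain ⟨ε, hε, hεσ⟩ : ∃ ε, 0 < ε ∧ |z.im| + ε + ε < σ := ⟨(σ - |z.im|) / 3, by linarith, by linarith⟩
    have hnorm : ∀ (w : ℂ) (η : ℝ), ‖w.im‖ ≤ |z.im| + ε →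
        ‖Complex.exp (2 * Real.pi * Complex.I * η * w)‖ ≤
          Real.exp ((|z.im| + ε) * |2 * Real.pi * η|) := by
      intro w η hw
      rw [Complex.norm_exp]
      refine Real.exp_le_exp.2 ?_
      have e : (2 * Real.pi * Complex.I * η * w : ℂ).re = -(w.im * (2 * Real.pi * η)) := by
        have : (2 * Real.pi * Complex.I * η * w : ℂ) = ((2 * Real.pi * η : ℝ) : ℂ) * (Complex.I * w) := by
          push_cast; ring
        rw [this, Complex.re_ofReal_mul]; simp; ring
      rw [e]
      refine (neg_le_abs _).trans ?_
      rw [abs_mul]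
      gcongr
      exact hw
    have hball : ∀ w ∈ Metric.ball z ε, ‖w.im‖ ≤ |z.im| + ε := by
      intro w hw
      have h1 : |(w - z).im| ≤ ‖w - z‖ := Complex.abs_im_le_norm _
      rw [Metric.mem_ball, dist_eq_norm] at hw
      calc ‖w.im‖ = |z.im + (w - z).im| := by simp
        _ ≤ |z.im| + |(w - z).im| := abs_add_le _ _
        _ ≤ _ := by linarith
    have hd := hasDerivAt_integral_of_dominated_loc_of_deriv_le (𝕜 := ℂ) (μ := (volume : Measure ℝ))
      (F := fun (w : ℂ) (η : ℝ) => Complex.exp (2 * Real.pi * Complex.I * η * w) * φ η)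
      (F' := fun (w : ℂ) (η : ℝ) => 2 * Real.pi * Complex.I * η *
        Complex.exp (2 * Real.pi * Complex.I * η * w) * φ η) (x₀ := z)
      (bound := fun η => (1 / ε) * ‖(Real.exp ((|z.im| + ε + ε) * |2 * Real.pi * η|) : ℂ) * φ η‖)
      (Metric.ball_mem_nhds z hε)
      (Eventually.of_forall fun w => by fun_prop) ?_ (by fun_prop) ?_
      ((h _ hεσ).norm.const_mul _) ?_
    · exact hd.2.differentiableAt.differentiableWithinAt
    · refine (h (|z.im| + ε) (by linarith)).mono (by fun_prop) (Eventually.of_forall fun η => ?_)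
      rw [norm_mul, norm_mul, Complex.norm_real, Real.norm_of_nonneg (Real.exp_pos _).le]
      gcongr
      exact hnorm z η (hball z (Metric.mem_ball_self hε))
    · refine Eventually.of_forall fun η w hw => ?_
      have h1 : ‖(2 * Real.pi * Complex.I * η : ℂ)‖ = |2 * Real.pi * η| := by simp [abs_mul]
      have h2 := pow_le_mul_exp hε 1 (2 * Real.pi * η)
      simp only [pow_one, Nat.factorial_one, Nat.cast_one] at h2
      rw [norm_mul, norm_mul, h1, norm_mul, Complex.norm_real, Real.norm_of_nonneg (Real.exp_pos _).le,
        ← mul_assoc]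
      refine mul_le_mul_of_nonneg_right ?_ (norm_nonneg _)
      calc _ ≤ 1 / ε * Real.exp (ε * |2 * Real.pi * η|) * Real.exp ((|z.im| + ε) * |2 * Real.pi * η|) := by
            gcongr
            exact hnorm w η (hball w hw)
        _ = _ := by rw [mul_assoc, ← Real.exp_add]; ring_nf
    · refine Eventually.of_forall fun η w hw => ?_
      have h1 : HasDerivAt (fun w : ℂ => 2 * Real.pi * Complex.I * η * w) (2 * Real.pi * Complex.I * η) w := by
        simpa using (hasDerivAt_id w).const_mul (2 * Real.pi * Complex.I * η : ℂ)
      have h2 := (h1.cexp).mul_const (φ η)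
      convert! h2 using 1
      ring
  · rw [hf, fourierInv_eq_integral_wave]
    refine integral_congr_ae (Eventually.of_forall fun η => ?_)
    simp only [wave]
    congr 2
    push_cast; ring

/-- A continuous function of Gevrey class is smooth, and its derivatives are controlled. -/
theorem exists_iteratedDeriv_le {σ : ℝ} (hσ : 0 < σ) (k : ℕ) : ∃ C : ℝ≥0, ∀ s : ℝ, 0 ≤ s →
    ∀ f : ℝ → ℝ, Continuous f → MemGevrey σ s f →
      (∀ x, HasDerivAt (iteratedDeriv k f) (iteratedDeriv (k + 1) f x) x) ∧
      (∀ x, ‖iteratedDeriv k f x‖ₑ ≤ C * gevreyENorm σ s f) ∧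
      eLpNorm (iteratedDeriv k f) 2 ≤ C * gevreyENorm σ s f := by
  obtain ⟨C₁, hC₁⟩ := exists_lintegral_exp_mul_le (half_lt_self hσ)
  have hσ2 := half_pos hσ
  -- The supremum bound needs an integrable symbol and therefore gives up half the radius. The L²
  -- bound can use the full radius, whence the two constants.
  set K₁ : ℝ := k.factorial / (σ / 2) ^ k with hK₁
  set K₂ : ℝ := k.factorial / σ ^ k with hK₂
  have hK₁0 : 0 ≤ K₁ := by positivity
  refine ⟨K₁.toNNReal * C₁ + K₂.toNNReal,
    fun s hs f hf hG => ?_⟩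
  have hm := measurable_symbol f
  have hint := integrable_exp_mul_of_memLp (half_lt_self hσ) hs hm hG.memLp_symbol
  -- Continuity of both sides upgrades the almost everywhere inversion formula to every point.
  have hfe : ∀ x, (f x : ℂ) = 𝓕⁻ (symbol f) x := by
    have hc1 : Continuous fun x => (f x : ℂ) := by fun_prop
    exact congrFun ((hc1.ae_eq_iff_eq volume (continuous_fourierInv_of_integrable
      (hG.integrable_symbol hσ hs))).1 (hG.ae_eq_fourierInv hσ hs))
  obtain ⟨h1, h2⟩ := iteratedDeriv_eq_fourierInv hσ2 hm hint hfe k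
  have hik := integrable_derivSymbol hσ2 hm hint k
  have hle : ∀ η, ‖derivSymbol k (symbol f) η‖ ≤ K₂ *
      ‖(gevreyWeight σ s η : ℂ) * symbol f η‖ := fun η => by
    refine (norm_derivSymbol_le hσ k _ η).trans ?_
    rw [norm_mul, norm_mul, Complex.norm_real, Complex.norm_real,
      Real.norm_of_nonneg (Real.exp_pos _).le, Real.norm_of_nonneg (gevreyWeight_pos _ _ _).le]
    gcongr
    unfold gevreyWeight
    exact le_mul_of_one_le_right (Real.exp_pos _).le (Real.one_le_rpow (one_le_bracket _) hs)
  have hle₁ : ∀ η, ‖derivSymbol k (symbol f) η‖ ≤ K₁ *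
      ‖(Real.exp (σ / 2 * |2 * Real.pi * η|) : ℂ) * symbol f η‖ := norm_derivSymbol_le hσ2 k _
  clear_value K₁ K₂
  refine ⟨h2, fun x => ?_, ?_⟩
  · have e : ‖iteratedDeriv k f x‖ₑ = ‖((iteratedDeriv k f x : ℝ) : ℂ)‖ₑ := by
      rw [← ofReal_norm, ← ofReal_norm, Complex.norm_real]
    rw [e, h1, fourierInv_eq_integral_wave]
    calc _ ≤ ∫⁻ η, ‖wave (x * η) * derivSymbol k (symbol f) η‖ₑ := enorm_integral_le_lintegral_enorm _
      _ ≤ ∫⁻ η, ENNReal.ofReal K₁ *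
          ‖(Real.exp (σ / 2 * |2 * Real.pi * η|) : ℂ) * symbol f η‖ₑ := by
          gcongr with η
          rw [← ofReal_norm, ← ofReal_norm, ← ENNReal.ofReal_mul (by positivity), norm_mul, norm_wave,
            one_mul]
          exact ENNReal.ofReal_le_ofReal (hle₁ η)
      _ ≤ ENNReal.ofReal K₁ * (C₁ * gevreyENorm σ s f) := by
          rw [lintegral_const_mul' _ _ ENNReal.ofReal_ne_top, gevreyENorm_eq hG.memLp]
          gcongr
          exact hC₁ s hs _ hm
      _ ≤ _ := by
          rw [← mul_assoc, ENNReal.coe_add, ENNReal.coe_mul]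
          gcongr
          exact le_self_add
  · have hL : MemLp (derivSymbol k (symbol f)) 2 (volume : Measure ℝ) :=
      MemLp.of_le_mul hG.memLp_symbol (by fun_prop) (Eventually.of_forall hle)
    have e1 : eLpNorm (iteratedDeriv k f) 2 volume =
        eLpNorm (𝓕⁻ (derivSymbol k (symbol f)) : ℝ → ℂ) 2 volume :=
      eLpNorm_congr_norm_ae (Eventually.of_forall fun x => by rw [← h1, Complex.norm_real])
    have e2 : eLpNorm (derivSymbol k (symbol f)) 2 volume ≤
        ENNReal.ofReal K₂ * gevreyENorm σ s f := by
      rw [gevreyENorm_eq hG.memLp]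
      exact eLpNorm_le_mul_eLpNorm_of_ae_le_mul (Eventually.of_forall hle) 2
    rw [e1, eLpNorm_real_fourierInv hik hL]
    refine e2.trans ?_
    rw [ENNReal.coe_add, ENNReal.coe_mul]
    gcongr
    exact le_add_self

/-! ### Uniqueness by the energy method. -/

/-- Gronwall's inequality by iteration: inserting the bound into itself n times gives M(Ct)^n/n!,
which tends to 0. No regularity of `E` or `h` is needed, since only the majorants are integrated. -/
theorem eq_zero_of_le_integral {E h : ℝ → ℝ} {C M T : ℝ} (hC : 0 ≤ C)
    (hM : ∀ t ∈ Icc 0 T, |E t| ≤ M) (hE : ∀ t ∈ Icc 0 T, E t = ∫ r in 0..t, h r)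
    (hh : ∀ t ∈ Icc 0 T, |h t| ≤ C * |E t|) : ∀ t ∈ Icc 0 T, E t = 0 := by
  have key : ∀ n : ℕ, ∀ t ∈ Icc 0 T, |E t| ≤ M * ((C * t) ^ n / n.factorial) := by
    intro n
    induction n with
    | zero => intro t ht; simpa using hM t ht
    | succ n ih =>
      intro t ht
      rw [hE t ht]
      have hint : ∀ a b : ℝ, IntervalIntegrable
          (fun r : ℝ => C * (M * ((C * r) ^ n / n.factorial))) volume a b := fun a b =>
        (by fun_prop : Continuous fun r : ℝ => C * (M * ((C * r) ^ n / n.factorial))).intervalIntegrable a b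
      have h1 := intervalIntegral.norm_integral_le_of_norm_le (f := h) ht.1
        (Eventually.of_forall fun r hr => by
          have hrT : r ∈ Icc 0 T := ⟨hr.1.le, hr.2.trans ht.2⟩
          exact (hh r hrT).trans (mul_le_mul_of_nonneg_left (ih r hrT) hC)) (hint 0 t)
      refine h1.trans (le_of_eq ?_)
      have e : ∀ r : ℝ, C * (M * ((C * r) ^ n / n.factorial)) = (C ^ (n + 1) * M / n.factorial) * r ^ n := by
        intro r; rw [mul_pow]; ring
      simp_rw [e]
      rw [intervalIntegral.integral_const_mul, integral_pow, Nat.factorial_succ]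
      push_cast
      have : (n.factorial : ℝ) ≠ 0 := by positivity
      field_simp
      ring
  intro t ht
  have hlim : Tendsto (fun n : ℕ => M * ((C * t) ^ n / n.factorial)) atTop (𝓝 (M * 0)) :=
    (FloorSemiring.tendsto_pow_div_factorial_atTop (C * t)).const_mul M
  rw [mul_zero] at hlim
  exact abs_nonpos_iff.1 (ge_of_tendsto' hlim fun n => key n t ht)

theorem eq_zero_of_le_integral_symm {E h : ℝ → ℝ} {C M T : ℝ} (hC : 0 ≤ C)
    (hM : ∀ t ∈ Icc (-T) T, |E t| ≤ M) (hE : ∀ t ∈ Icc (-T) T, E t = ∫ r in 0..t, h r)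
    (hh : ∀ t ∈ Icc (-T) T, |h t| ≤ C * |E t|) : ∀ t ∈ Icc (-T) T, E t = 0 := by
  have hpos : ∀ t ∈ Icc 0 T, t ∈ Icc (-T) T := fun t ht => ⟨by linarith [ht.1, ht.2], ht.2⟩
  have hneg : ∀ t ∈ Icc 0 T, -t ∈ Icc (-T) T := fun t ht => ⟨by linarith [ht.1, ht.2], by linarith [ht.1, ht.2]⟩
  intro t ht
  rcases le_total 0 t with h0 | h0
  · exact eq_zero_of_le_integral hC (fun t h => hM t (hpos t h)) (fun t h => hE t (hpos t h))
      (fun t h => hh t (hpos t h)) t ⟨h0, ht.2⟩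
  · have := eq_zero_of_le_integral (E := fun t => E (-t)) (h := fun t => -h (-t)) hC
      (fun t h => hM _ (hneg t h)) (fun t ht => ?_) (fun t h => by
        rw [abs_neg]; exact hh _ (hneg t h)) (-t) ⟨by linarith, by linarith [ht.1]⟩
    · simpa using this
    · rw [hE _ (hneg t ht), intervalIntegral.integral_neg, intervalIntegral.integral_comp_neg,
        intervalIntegral.integral_symm]
      simp

/-- A family of functions that is measurable in both variables and bounded in `L²`. -/
def BoundedL2 (g : ℝ → ℝ → ℝ) : Prop :=
  Measurable (Function.uncurry g) ∧ ∃ B : ℝ≥0, ∀ r, eLpNorm (g r) 2 volume ≤ B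

theorem BoundedL2.measurable {g : ℝ → ℝ → ℝ} (hg : BoundedL2 g) (r : ℝ) : Measurable (g r) :=
  hg.1.comp measurable_prodMk_left

theorem BoundedL2.memLp {g : ℝ → ℝ → ℝ} (hg : BoundedL2 g) (r : ℝ) : MemLp (g r) 2 :=
  ⟨(hg.measurable r).aestronglyMeasurable,
    (hg.2.choose_spec r).trans_lt ENNReal.coe_lt_top⟩

theorem BoundedL2.add {f g : ℝ → ℝ → ℝ} (hf : BoundedL2 f) (hg : BoundedL2 g) :
    BoundedL2 fun r x => f r x + g r x := by
  have hm := hf.measurable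
  have hm' := hg.measurable
  obtain ⟨h1, B, hB⟩ := hf
  obtain ⟨h2, B', hB'⟩ := hg
  refine ⟨h1.add h2, B + B', fun r => ?_⟩
  refine (eLpNorm_add_le (hm r).aestronglyMeasurable (hm' r).aestronglyMeasurable (by norm_num)).trans ?_
  push_cast
  exact add_le_add (hB r) (hB' r)

theorem BoundedL2.mul_bdd {f g : ℝ → ℝ → ℝ} (hf : BoundedL2 f)
    (hg : Measurable (Function.uncurry g)) {K : ℝ} (hK : ∀ r x, |g r x| ≤ K) :
    BoundedL2 fun r x => g r x * f r x := by
  obtain ⟨h1, B, hB⟩ := hf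
  refine ⟨hg.mul h1, K.toNNReal * B, fun r => ?_⟩
  refine (eLpNorm_le_mul_eLpNorm_of_ae_le_mul (c := K) (g := f r) (Eventually.of_forall fun x => ?_) 2).trans ?_
  · rw [norm_mul]
    exact mul_le_mul_of_nonneg_right (hK r x) (norm_nonneg _)
  · push_cast
    exact mul_le_mul' le_rfl (hB r)

theorem BoundedL2.const_mul {f : ℝ → ℝ → ℝ} (hf : BoundedL2 f) (c : ℝ) :
    BoundedL2 fun r x => c * f r x :=
  hf.mul_bdd (g := fun _ _ => c) measurable_const (K := |c|) fun _ _ => le_rfl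

theorem BoundedL2.integrable_mul {f g : ℝ → ℝ → ℝ} (hf : BoundedL2 f) (hg : BoundedL2 g) (r : ℝ) :
    Integrable fun x => f r x * g r x :=
  (hf.memLp r).integrable_mul (hg.memLp r)

theorem BoundedL2.exists_lintegral_mul_le {f g : ℝ → ℝ → ℝ} (hf : BoundedL2 f) (hg : BoundedL2 g) :
    ∃ B : ℝ≥0, ∀ r, ∫⁻ x, ‖f r x * g r x‖ₑ ≤ B := by
  have hm := hf.measurable
  have hm' := hg.measurable
  obtain ⟨h1, B, hB⟩ := hf
  obtain ⟨h2, B', hB'⟩ := hg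
  refine ⟨B * B', fun r => (ENNReal.pow_le_pow_left_iff two_ne_zero).1 ?_⟩
  simp_rw [enorm_mul]
  refine (sq_lintegral_mul_le volume (hm r).enorm.aemeasurable (hm' r).enorm.aemeasurable).trans ?_
  rw [← eLpNorm_two_sq, ← eLpNorm_two_sq, ← mul_pow]
  push_cast
  gcongr
  · exact hB r
  · exact hB' r

theorem BoundedL2.integrable_prod {f g : ℝ → ℝ → ℝ} (hf : BoundedL2 f) (hg : BoundedL2 g)
    (a b : ℝ) : Integrable (Function.uncurry fun r x => f r x * g r x)
      ((volume.restrict (uIoc a b)).prod volume) := by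
  obtain ⟨B, hB⟩ := hf.exists_lintegral_mul_le hg
  have hm : Measurable (Function.uncurry fun r x => f r x * g r x) := hf.1.mul hg.1
  refine ⟨hm.aestronglyMeasurable, ?_⟩
  rw [hasFiniteIntegral_iff_enorm, lintegral_prod _ hm.enorm.aemeasurable]
  calc _ ≤ ∫⁻ r in uIoc a b, (B : ℝ≥0∞) := lintegral_mono fun r => hB r
    _ < ∞ := by
      rw [setLIntegral_const]
      exact ENNReal.mul_lt_top ENNReal.coe_lt_top (by rw [Real.volume_uIoc]; exact ENNReal.ofReal_lt_top)

/-- The regularity of a solution that the energy estimate needs; `a k` is the `k`-th space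
derivative. -/
structure EnergyClass (a : ℕ → ℝ → ℝ → ℝ) : Prop where
  continuous : ∀ k ≤ 3, ∀ x, Continuous fun r => a k r x
  hasDerivAt : ∀ k r x, HasDerivAt (a k r) (a (k + 1) r x) x
  bounded : ∀ k, ∃ B : ℝ, ∀ r x, |a k r x| ≤ B
  boundedL2 : ∀ k ≤ 3, BoundedL2 (a k)

/-- With w = v - u one has v³ - u³ = qw, so v²v₁ - u²u₁ is a third of the derivative of qw. The left
integrand plus (μ/3)q'w² is then the exact derivative of -2w w₂ + w₁² - (μ/3)qw², whose integral
vanishes. No derivative of w is left on the right. -/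
theorem energy_identity {μ : ℝ} {u v w q q' : ℝ → ℝ → ℝ} {u₁ v₁ w₁ w₂ w₃ : ℝ → ℝ → ℝ}
    (hw : ∀ r x, w r x = v r x - u r x) (hw₁ : ∀ r x, w₁ r x = v₁ r x - u₁ r x)
    (hq : ∀ r x, q r x = v r x ^ 2 + u r x * v r x + u r x ^ 2)
    (hq' : ∀ r x, q' r x = 2 * v r x * v₁ r x + (u₁ r x * v r x + u r x * v₁ r x) + 2 * u r x * u₁ r x)
    {r : ℝ} (dw : ∀ x, HasDerivAt (w r) (w₁ r x) x) (dw₁ : ∀ x, HasDerivAt (w₁ r) (w₂ r x) x)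
    (dw₂ : ∀ x, HasDerivAt (w₂ r) (w₃ r x) x) (dq : ∀ x, HasDerivAt (q r) (q' r x) x)
    (i1 : Integrable fun x => w r x * w₂ r x) (i2 : Integrable fun x => w₁ r x * w₁ r x)
    (i3 : Integrable fun x => w r x * (q r x * w r x))
    (i4 : Integrable fun x => 2 * w r x * (-w₃ r x - μ * (v r x ^ 2 * v₁ r x - u r x ^ 2 * u₁ r x)))
    (i5 : Integrable fun x => q' r x * (w r x * w r x)) :
    ∫ x, 2 * w r x * (-w₃ r x - μ * (v r x ^ 2 * v₁ r x - u r x ^ 2 * u₁ r x)) =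
      -(μ / 3) * ∫ x, q' r x * (w r x * w r x) := by
  have hd : ∀ x, HasDerivAt
      (fun x => -2 * (w r x * w₂ r x) + w₁ r x * w₁ r x - μ / 3 * (w r x * (q r x * w r x)))
      (2 * w r x * (-w₃ r x - μ * (v r x ^ 2 * v₁ r x - u r x ^ 2 * u₁ r x)) +
        μ / 3 * (q' r x * (w r x * w r x))) x := by
    intro x
    have h := ((((dw x).mul (dw₂ x)).const_mul (-2)).add ((dw₁ x).mul (dw₁ x))).sub
      (((dw x).mul ((dq x).mul (dw x))).const_mul (μ / 3))
    convert! h using 1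
    simp only [Pi.mul_apply]
    rw [hw, hw₁, hq, hq']
    ring
  have h0 := integral_eq_zero_of_hasDerivAt_of_integrable hd (i4.add (i5.const_mul _))
    (((i1.const_mul _).add i2).sub (i3.const_mul _))
  rw [integral_add i4 (i5.const_mul _), integral_const_mul] at h0
  linarith

/-- The energy E(t) = ∫ w² of the difference satisfies |E'| ≤ K E, because q' is bounded. The
inequality is used in integrated form: the fundamental theorem of calculus for each fixed x, then
Fubini, so nothing is differentiated under the integral. -/
theorem EnergyClass.eq {μ T : ℝ} (hμ : |μ| = 1) (hT : 0 < T) {a b : ℕ → ℝ → ℝ → ℝ}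
    (ha : EnergyClass a) (hb : EnergyClass b)
    (ea : ∀ r ∈ Ioo (-T) T, ∀ x, HasDerivAt (fun r => a 0 r x) (-a 3 r x - μ * a 0 r x ^ 2 * a 1 r x) r)
    (eb : ∀ r ∈ Ioo (-T) T, ∀ x, HasDerivAt (fun r => b 0 r x) (-b 3 r x - μ * b 0 r x ^ 2 * b 1 r x) r)
    (h0 : ∀ x, a 0 0 x = b 0 0 x) : ∀ t ∈ Icc (-T) T, ∀ x, a 0 t x = b 0 t x := by
  obtain ⟨K₀, hK₀⟩ := ha.bounded 0
  obtain ⟨L₀, hL₀⟩ := hb.bounded 0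
  obtain ⟨K₁, hK₁⟩ := ha.bounded 1
  obtain ⟨L₁, hL₁⟩ := hb.bounded 1
  have hm : ∀ k ≤ 3, Measurable (Function.uncurry (a k)) := fun k hk => (ha.boundedL2 k hk).1
  have hm' : ∀ k ≤ 3, Measurable (Function.uncurry (b k)) := fun k hk => (hb.boundedL2 k hk).1
  obtain ⟨w, hw⟩ : ∃ w : ℕ → ℝ → ℝ → ℝ, ∀ k r x, w k r x = b k r x - a k r x := ⟨_, fun _ _ _ => rfl⟩
  have hwf : ∀ k, w k = fun r x => b k r x + (-1) * a k r x := fun k => by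
    funext r x; rw [hw]; ring
  have dw : ∀ k r x, HasDerivAt (w k r) (w (k + 1) r x) x := fun k r x => by
    rw [show w k r = fun x => b k r x - a k r x from funext (hw k r), hw]
    exact (hb.hasDerivAt k r x).sub (ha.hasDerivAt k r x)
  have bw : ∀ k ≤ 3, BoundedL2 (w k) := fun k hk => by
    rw [hwf]; exact (hb.boundedL2 k hk).add ((ha.boundedL2 k hk).const_mul _)
  obtain ⟨q, hq⟩ : ∃ q : ℝ → ℝ → ℝ, ∀ r x, q r x = b 0 r x ^ 2 + a 0 r x * b 0 r x + a 0 r x ^ 2 :=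
    ⟨_, fun _ _ => rfl⟩
  obtain ⟨q', hq'⟩ : ∃ q' : ℝ → ℝ → ℝ, ∀ r x, q' r x = 2 * b 0 r x * b 1 r x +
    (a 1 r x * b 0 r x + a 0 r x * b 1 r x) + 2 * a 0 r x * a 1 r x := ⟨_, fun _ _ => rfl⟩
  have ma0 := hm 0 (by norm_num)
  have ma1 := hm 1 (by norm_num)
  have mb0 := hm' 0 (by norm_num)
  have mb1 := hm' 1 (by norm_num)
  have mq : Measurable (Function.uncurry q) := by
    rw [show Function.uncurry q = fun p => Function.uncurry (b 0) p ^ 2 +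
      Function.uncurry (a 0) p * Function.uncurry (b 0) p + Function.uncurry (a 0) p ^ 2 from
      funext fun p => hq p.1 p.2]
    fun_prop
  have mq' : Measurable (Function.uncurry q') := by
    rw [show Function.uncurry q' = fun p => 2 * Function.uncurry (b 0) p * Function.uncurry (b 1) p +
      (Function.uncurry (a 1) p * Function.uncurry (b 0) p +
        Function.uncurry (a 0) p * Function.uncurry (b 1) p) +
      2 * Function.uncurry (a 0) p * Function.uncurry (a 1) p from funext fun p => hq' p.1 p.2]
    fun_prop
  obtain ⟨Kq, hKq⟩ : ∃ K : ℝ, ∀ r x, |q r x| ≤ K := by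
    refine ⟨L₀ ^ 2 + K₀ * L₀ + K₀ ^ 2, fun r x => ?_⟩
    rw [hq]
    refine (abs_add_three _ _ _).trans ?_
    rw [abs_pow, abs_pow, abs_mul]
    have h1 := hK₀ r x
    have h2 := hL₀ r x
    have := (abs_nonneg _).trans h1
    gcongr
  obtain ⟨Kq', hKq'0, hKq'⟩ : ∃ K : ℝ, 0 ≤ K ∧ ∀ r x, |q' r x| ≤ K := by
    have h10 := (abs_nonneg _).trans (hK₀ 0 0)
    have h20 := (abs_nonneg _).trans (hL₀ 0 0)
    have h30 := (abs_nonneg _).trans (hK₁ 0 0)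
    have h40 := (abs_nonneg _).trans (hL₁ 0 0)
    refine ⟨2 * L₀ * L₁ + (K₁ * L₀ + K₀ * L₁) + 2 * K₀ * K₁, by positivity, fun r x => ?_⟩
    rw [hq']
    refine (abs_add_three _ _ _).trans ?_
    have h1 := hK₀ r x
    have h2 := hL₀ r x
    have h3 := hK₁ r x
    have h4 := hL₁ r x
    have h5 := abs_add_le (a 1 r x * b 0 r x) (a 0 r x * b 1 r x)
    rw [abs_mul, abs_mul] at h5
    rw [abs_mul, abs_mul, abs_mul, abs_mul, abs_two]
    have h6 : |a 1 r x * b 0 r x + a 0 r x * b 1 r x| ≤ K₁ * L₀ + K₀ * L₁ := h5.trans (by gcongr)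
    gcongr
  obtain ⟨wt, hwt⟩ : ∃ wt : ℝ → ℝ → ℝ, ∀ r x, wt r x =
      -w 3 r x - μ * (b 0 r x ^ 2 * b 1 r x - a 0 r x ^ 2 * a 1 r x) := ⟨_, fun _ _ => rfl⟩
  have bwt : BoundedL2 wt := by
    have e : wt = fun r x => (-1) * w 3 r x + ((-μ) * (b 0 r x ^ 2 * b 1 r x) + μ * (a 0 r x ^ 2 * a 1 r x)) := by
      funext r x; rw [hwt]; ring
    rw [e]
    refine ((bw 3 le_rfl).const_mul _).add ((((hb.boundedL2 1 (by norm_num)).mul_bdd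
      (g := fun r x => b 0 r x ^ 2) (mb0.pow_const 2) (K := L₀ ^ 2) fun r x => ?_).const_mul _).add
      (((ha.boundedL2 1 (by norm_num)).mul_bdd (g := fun r x => a 0 r x ^ 2) (ma0.pow_const 2)
        (K := K₀ ^ 2) fun r x => ?_).const_mul _))
    · rw [abs_pow]; exact pow_le_pow_left₀ (abs_nonneg _) (hL₀ r x) 2
    · rw [abs_pow]; exact pow_le_pow_left₀ (abs_nonneg _) (hK₀ r x) 2
  have b2w : BoundedL2 fun r x => 2 * w 0 r x := (bw 0 (by norm_num)).const_mul 2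
  have dt : ∀ r ∈ Ioo (-T) T, ∀ x, HasDerivAt (fun r => w 0 r x) (wt r x) r := by
    intro r hr x
    rw [show (fun r => w 0 r x) = fun r => b 0 r x - a 0 r x from funext fun r => hw 0 r x]
    convert! (eb r hr x).sub (ea r hr x) using 1
    rw [hwt, hw]; ring
  have cw : ∀ k ≤ 3, ∀ x, Continuous fun r => w k r x := fun k hk x => by
    simp only [hw]; exact (hb.continuous k hk x).sub (ha.continuous k hk x)
  have cwt : ∀ x, Continuous fun r => wt r x := fun x => by
    have c1 := cw 3 le_rfl x
    have c2 := hb.continuous 0 (by norm_num) x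
    have c3 := hb.continuous 1 (by norm_num) x
    have c4 := ha.continuous 0 (by norm_num) x
    have c5 := ha.continuous 1 (by norm_num) x
    simp only [hwt]
    fun_prop
  have pointwise : ∀ t ∈ Icc (-T) T, ∀ x, w 0 t x * w 0 t x = ∫ r in 0..t, 2 * w 0 r x * wt r x := by
    intro t ht x
    have c0 := cw 0 (by norm_num) x
    have ct := cwt x
    -- The equation is needed only in the open interval; at the end points continuity suffices.
    rw [intervalIntegral.integral_eq_sub_of_hasDeriv_right (f := fun r => w 0 r x * w 0 r x)
      (by fun_prop) (fun r hr => ?_) ((by fun_prop :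
        Continuous fun r => 2 * w 0 r x * wt r x).intervalIntegrable _ _)]
    · have : w 0 0 x = 0 := by rw [hw, h0, sub_self]
      simp [this]
    · have hr' : r ∈ Ioo (-T) T := by
        have h1 := hr.1
        have h2 := hr.2
        rcases le_total 0 t with h | h
        · rw [min_eq_left h] at h1; rw [max_eq_right h] at h2
          exact ⟨by linarith, by linarith [ht.2]⟩
        · rw [min_eq_right h] at h1; rw [max_eq_left h] at h2
          exact ⟨by linarith [ht.1], by linarith⟩
      have := (dt r hr' x).mul (dt r hr' x)
      convert! this.hasDerivWithinAt using 1
      ring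
  have swap : ∀ t ∈ Icc (-T) T, ∫ x, w 0 t x * w 0 t x =
      ∫ r in 0..t, ∫ x, 2 * w 0 r x * wt r x := by
    intro t ht
    simp_rw [pointwise t ht]
    exact (intervalIntegral_integral_swap (b2w.integrable_prod bwt 0 t)).symm
  have hww : ∀ r, Integrable fun x => w 0 r x * w 0 r x := fun r =>
    (bw 0 (by norm_num)).integrable_mul (bw 0 (by norm_num)) r
  have i5 : ∀ r, Integrable fun x => q' r x * (w 0 r x * w 0 r x) := fun r =>
    (hww r).bdd_mul (c := Kq') (mq'.comp measurable_prodMk_left).aestronglyMeasurable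
      (Eventually.of_forall fun x => hKq' r x)
  have spatial : ∀ r, ∫ x, 2 * w 0 r x * wt r x = -(μ / 3) * ∫ x, q' r x * (w 0 r x * w 0 r x) := by
    intro r
    have i4 := b2w.integrable_mul bwt r
    simp only [hwt] at i4 ⊢
    refine energy_identity (hw 0) (hw 1) hq hq' (w₂ := w 2) (w₃ := w 3) (dw 0 r) (dw 1 r) (dw 2 r)
      (fun x => ?_)
      ((bw 0 (by norm_num)).integrable_mul (bw 2 (by norm_num)) r)
      ((bw 1 (by norm_num)).integrable_mul (bw 1 (by norm_num)) r)
      ((bw 0 (by norm_num)).integrable_mul ((bw 0 (by norm_num)).mul_bdd mq hKq) r)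
      i4 (i5 r)
    rw [show q r = fun x => b 0 r x ^ 2 + a 0 r x * b 0 r x + a 0 r x ^ 2 from funext (hq r), hq']
    have da := ha.hasDerivAt 0 r x
    have db := hb.hasDerivAt 0 r x
    convert! ((db.pow 2).add (da.mul db)).add (da.pow 2) using 1
    simp
  obtain ⟨E, hE⟩ : ∃ E : ℝ → ℝ, ∀ t, E t = ∫ x, w 0 t x * w 0 t x := ⟨_, fun _ => rfl⟩
  have hE0 : ∀ t, 0 ≤ E t := fun t => by rw [hE]; exact integral_nonneg fun x => mul_self_nonneg _
  obtain ⟨B, hB⟩ := (bw 0 (by norm_num)).exists_lintegral_mul_le (bw 0 (by norm_num))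
  have hEM : ∀ t ∈ Icc (-T) T, |E t| ≤ B := fun t _ => by
    have h1 := enorm_integral_le_lintegral_enorm (μ := volume) (fun x => w 0 t x * w 0 t x)
    rw [← hE, ← ofReal_norm] at h1
    have h2 := h1.trans (hB t)
    rw [← ENNReal.ofReal_coe_nnreal] at h2
    exact (ENNReal.ofReal_le_ofReal_iff B.2).1 h2
  -- The factor 1/3 of the energy identity is not needed and is given up in the bound by `Kq'`.
  have hzero := eq_zero_of_le_integral_symm (E := E) (h := fun r => ∫ x, 2 * w 0 r x * wt r x)
    (C := Kq') hKq'0 hEM (fun t ht => by rw [hE, swap t ht]) (fun t _ => by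
      rw [spatial, abs_mul, abs_neg, abs_div, hμ, abs_of_pos (by norm_num : (0 : ℝ) < 3),
        abs_of_nonneg (hE0 t), hE, ← integral_const_mul]
      have h1 : |∫ x, q' t x * (w 0 t x * w 0 t x)| ≤ ∫ x, Kq' * (w 0 t x * w 0 t x) := by
        refine (norm_integral_le_integral_norm _).trans (integral_mono (i5 t).norm ((hww t).const_mul _) fun x => ?_)
        simp only [norm_mul, Real.norm_eq_abs]
        rw [abs_mul_abs_self]
        exact mul_le_mul_of_nonneg_right (hKq' t x) (mul_self_nonneg _)
      have h2 := abs_nonneg (∫ x, q' t x * (w 0 t x * w 0 t x))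
      linarith)
  intro t ht x
  have h1 := hzero t ht
  rw [hE, integral_eq_zero_iff_of_nonneg (fun x => mul_self_nonneg _) (hww t)] at h1
  have hcw : Continuous (w 0 t) := continuous_iff_continuousAt.2 fun x => (dw 0 t x).continuousAt
  have h2 : (fun x => w 0 t x * w 0 t x) = 0 :=
    ((hcw.mul hcw).ae_eq_iff_eq volume continuous_zero).1 h1
  have h3 := mul_self_eq_zero.1 (congrFun h2 x)
  rw [hw] at h3
  linarith

/-- Time restricted to `[-T,T]`. -/
noncomputable def clamp (T r : ℝ) : ℝ := max (-T) (min r T)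

theorem clamp_mem {T : ℝ} (hT : 0 < T) (r : ℝ) : clamp T r ∈ Icc (-T) T :=
  ⟨le_max_left _ _, max_le (by linarith) (min_le_right _ _)⟩

theorem clamp_of_mem {T r : ℝ} (hr : r ∈ Icc (-T) T) : clamp T r = r := by
  unfold clamp; rw [min_eq_left hr.2, max_eq_right hr.1]

theorem continuous_clamp (T : ℝ) : Continuous (clamp T) := by unfold clamp; fun_prop

theorem ContinuousInGevrey.exists_bound {σ s T : ℝ} {u : ℝ → ℝ → ℝ} (hu : ContinuousInGevrey σ s T u) :
    ∃ M : ℝ≥0, ∀ r ∈ Icc (-T) T, gevreyENorm σ s (u r) ≤ M := by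
  refine isCompact_Icc.induction_on (p := fun S => ∃ M : ℝ≥0, ∀ r ∈ S, gevreyENorm σ s (u r) ≤ M)
    ⟨0, by simp⟩ (fun S S' h ⟨M, hM⟩ => ⟨M, fun r hr => hM r (h hr)⟩)
    (fun S S' ⟨M, hM⟩ ⟨M', hM'⟩ => ⟨M + M', fun r hr => ?_⟩) fun t ht => ?_
  · push_cast
    rcases hr with h | h
    · exact (hM r h).trans le_self_add
    · exact (hM' r h).trans le_add_self
  · have h1 := (hu.2 t ht).eventually (gt_mem_nhds (show (0 : ℝ≥0∞) < 1 by norm_num))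
    refine ⟨{r | gevreyENorm σ s (u r - u t) < 1} ∩ Icc (-T) T,
      inter_mem h1 self_mem_nhdsWithin, 1 + (gevreyENorm σ s (u t)).toNNReal, fun r hr => ?_⟩
    refine (gevreyENorm_le_add (hu.1 r hr.2) (hu.1 t ht)).trans ?_
    rw [ENNReal.coe_add, ENNReal.coe_one, ENNReal.coe_toNNReal (hu.1 t ht).ne]
    gcongr
    exact (show gevreyENorm σ s (u r - u t) < 1 from hr.1).le

/-- Time is frozen outside [-T,T], so that continuity and all bounds hold for every real time. The
embedding of the Gevrey norm into sup and L² norms of derivatives turns norm continuity into the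
required regularity. -/
theorem ContinuousInGevrey.energyClass {σ s T : ℝ} (hσ : 0 < σ) (hs : 0 ≤ s) (hT : 0 < T)
    {u : ℝ → ℝ → ℝ} (hu : ContinuousInGevrey σ s T u) (hc : ∀ t ∈ Icc (-T) T, ContDiff ℝ 3 (u t)) :
    EnergyClass fun k r x => iteratedDeriv k (u (clamp T r)) x := by
  obtain ⟨M, hM⟩ := hu.exists_bound
  have hcl := fun r => clamp_mem hT r
  have cont : ∀ k ≤ 3, ∀ x, Continuous fun r => iteratedDeriv k (u (clamp T r)) x := by
    intro k hk x
    obtain ⟨C, hC⟩ := exists_iteratedDeriv_le hσ k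
    have hcd : ∀ t ∈ Icc (-T) T, ContDiffAt ℝ k (u t) x := fun t ht =>
      ((hc t ht).of_le (by exact_mod_cast hk)).contDiffAt
    have h1 : ContinuousOn (fun r => iteratedDeriv k (u r) x) (Icc (-T) T) := by
      intro t ht
      rw [ContinuousWithinAt, tendsto_iff_edist_tendsto_0]
      have h2 : Tendsto (fun r => C * gevreyENorm σ s (u r - u t)) (𝓝[Icc (-T) T] t) (𝓝 0) := by
        have := ENNReal.Tendsto.const_mul (hu.2 t ht) (Or.inr (ENNReal.coe_ne_top (r := C)))
        rwa [mul_zero] at this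
      refine tendsto_of_tendsto_of_tendsto_of_le_of_le' tendsto_const_nhds h2
        (Eventually.of_forall fun _ => zero_le) ?_
      filter_upwards [self_mem_nhdsWithin] with r hr
      rw [edist_eq_enorm_sub, ← iteratedDeriv_sub (hcd r hr) (hcd t ht)]
      exact (hC s hs (u r - u t) ((hc r hr).continuous.sub (hc t ht).continuous)
        ((hu.1 r hr).sub (hu.1 t ht))).2.1 x
    exact h1.comp_continuous (continuous_clamp T) hcl
  have deriv : ∀ k r x, HasDerivAt (iteratedDeriv k (u (clamp T r)))
      (iteratedDeriv (k + 1) (u (clamp T r)) x) x := by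
    intro k r x
    obtain ⟨C, hC⟩ := exists_iteratedDeriv_le hσ k
    exact (hC s hs _ (hc _ (hcl r)).continuous (hu.1 _ (hcl r))).1 x
  refine ⟨cont, deriv, fun k => ?_, fun k hk => ⟨?_, ?_⟩⟩
  · obtain ⟨C, hC⟩ := exists_iteratedDeriv_le hσ k
    refine ⟨(C * M : ℝ≥0), fun r x => ?_⟩
    have h1 := ((hC s hs _ (hc _ (hcl r)).continuous (hu.1 _ (hcl r))).2.1 x).trans
      (mul_le_mul' le_rfl (hM _ (hcl r)))
    rw [← ofReal_norm, ← ENNReal.coe_mul, ← ENNReal.ofReal_coe_nnreal] at h1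
    exact (ENNReal.ofReal_le_ofReal_iff (C * M).2).1 h1
  · refine measurable_uncurry_of_continuous_of_measurable (cont k hk) fun r => ?_
    exact (continuous_iff_continuousAt.2 fun x => (deriv k r x).continuousAt).measurable
  · obtain ⟨C, hC⟩ := exists_iteratedDeriv_le hσ k
    refine ⟨C * M, fun r => ?_⟩
    rw [ENNReal.coe_mul]
    exact (hC s hs _ (hc _ (hcl r)).continuous (hu.1 _ (hcl r))).2.2.trans
      (mul_le_mul' le_rfl (hM _ (hcl r)))

/-- Unconditional uniqueness in `C([-T,T]; G^{σ,s})`. -/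
theorem SolvesIVP.unique {μ σ s T : ℝ} (hμ : μ = 1 ∨ μ = -1) (hσ : 0 < σ) (hs : 0 ≤ s) (hT : 0 < T)
    {u₀ : ℝ → ℝ} {u v : ℝ → ℝ → ℝ} (hu : SolvesIVP μ T u₀ u) (hv : SolvesIVP μ T u₀ v)
    (hu' : ContinuousInGevrey σ s T u) (hv' : ContinuousInGevrey σ s T v) :
    EqOn u v (Icc (-T) T) := by
  have eqn : ∀ {u : ℝ → ℝ → ℝ}, SolvesIVP μ T u₀ u → ∀ r ∈ Ioo (-T) T, ∀ x,
      HasDerivAt (fun r => iteratedDeriv 0 (u (clamp T r)) x)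
        (-iteratedDeriv 3 (u (clamp T r)) x - μ * iteratedDeriv 0 (u (clamp T r)) x ^ 2 *
          iteratedDeriv 1 (u (clamp T r)) x) r := by
    intro u hu r hr x
    have hr' := Ioo_subset_Icc_self hr
    obtain ⟨ut, h1, h2⟩ := hu.equation r hr' x
    have h3 := h1.hasDerivAt (Icc_mem_nhds hr.1 hr.2)
    rw [clamp_of_mem hr', iteratedDeriv_zero, iteratedDeriv_one]
    rw [show -iteratedDeriv 3 (u r) x - μ * u r x ^ 2 * deriv (u r) x = ut by linarith]
    refine h3.congr_of_eventuallyEq ?_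
    filter_upwards [Icc_mem_nhds hr.1 hr.2] with y hy
    rw [clamp_of_mem hy, iteratedDeriv_zero]
  have hT0 : (0 : ℝ) ∈ Icc (-T) T := ⟨by linarith, hT.le⟩
  have h0 : u 0 = v 0 := ((hu.contDiff 0 hT0).continuous.ae_eq_iff_eq volume
    (hv.contDiff 0 hT0).continuous).1 (hu.initial.trans hv.initial.symm)
  have h := EnergyClass.eq (by rcases hμ with h | h <;> simp [h]) hT
    (hu'.energyClass hσ hs hT hu.contDiff) (hv'.energyClass hσ hs hT hv.contDiff)
    (eqn hu) (eqn hv) (fun x => by rw [clamp_of_mem hT0, h0])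
  intro t ht
  funext x
  have := h t ht x
  rwa [clamp_of_mem ht, iteratedDeriv_zero, iteratedDeriv_zero] at this

/-! ### From the integral equation to the differential equation. -/

theorem lintegral_modulation_rpow_lt_top {p : ℝ} (hp : 1 < p) : ∃ C : ℝ≥0, ∀ η : ℝ,
    ∫⁻ θ, ENNReal.ofReal (modulation dispersion (η, θ) ^ (-p)) ≤ C := by
  have h := lintegral_bracket_rpow_lt_top hp
  refine ⟨(∫⁻ x, ENNReal.ofReal (bracket x ^ (-p))).toNNReal, fun η => ?_⟩
  rw [ENNReal.coe_toNNReal h.ne]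
  exact (lintegral_sub_right_eq_self (fun x => ENNReal.ofReal (bracket x ^ (-p)))
    (dispersion * η ^ 3)).le

/-- Here b > 1/2 is used: L^{-9/8} is integrable in the time frequency, so the space norm of the L¹
norm in time frequency is controlled. This embeds the Bourgain space into continuous functions of
time. -/
theorem exists_sq_lintegral_time_le : ∃ C : ℝ≥0, ∀ σ s : ℝ, ∀ f : ℝ × ℝ → ℝ≥0∞, Measurable f →
    ∫⁻ η, (ENNReal.ofReal (gevreyWeight σ s η) * ∫⁻ θ, f (η, θ)) ^ 2 ≤
      C * ∫⁻ z, (ENNReal.ofReal (bourgainWeight dispersion σ s z) * f z) ^ 2 := by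
  obtain ⟨C, hC⟩ := lintegral_modulation_rpow_lt_top (p := 9 / 8) (by norm_num)
  refine ⟨C, fun σ s f hf => ?_⟩
  have hm : Measurable fun z => (ENNReal.ofReal (bourgainWeight dispersion σ s z) * f z) ^ 2 := by
    fun_prop
  rw [Measure.volume_eq_prod, lintegral_prod _ hm.aemeasurable,
    ← lintegral_const_mul' _ _ ENNReal.coe_ne_top]
  refine lintegral_mono fun η => ?_
  have hpos := gevreyWeight_pos σ s η
  have hmod : ∀ θ, 0 < modulation dispersion (η, θ) := fun θ => modulation_pos _ _
  have e : ∀ θ, ENNReal.ofReal (gevreyWeight σ s η) * f (η, θ) =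
      ENNReal.ofReal (modulation dispersion (η, θ) ^ (-(9 / 16) : ℝ)) *
        (ENNReal.ofReal (bourgainWeight dispersion σ s (η, θ)) * f (η, θ)) := fun θ => by
    rw [← mul_assoc, ← ENNReal.ofReal_mul (Real.rpow_nonneg (hmod θ).le _)]
    congr 2
    unfold bourgainWeight
    rw [mul_left_comm, ← Real.rpow_add (hmod θ)]
    simp
  rw [← lintegral_const_mul' _ _ ENNReal.ofReal_ne_top]
  simp_rw [e]
  refine (sq_lintegral_mul_le volume (by fun_prop) (by fun_prop)).trans ?_
  gcongr
  refine le_trans (le_of_eq (lintegral_congr fun θ => ?_)) (hC η)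
  rw [← ENNReal.ofReal_pow (Real.rpow_nonneg (hmod θ).le _), ← Real.rpow_mul_natCast (hmod θ).le]
  norm_num

/-- Giving up a little radius makes the amplitude integrable in both frequencies, by Cauchy-Schwarz
with the spare exponential. -/
theorem exists_sq_lintegral_exp_mul_le {a σ : ℝ} (h : a < σ) : ∃ C : ℝ≥0, ∀ s : ℝ, 0 ≤ s →
    ∀ f : ℝ × ℝ → ℝ≥0∞, Measurable f →
      (∫⁻ z, ENNReal.ofReal (Real.exp (a * |2 * Real.pi * z.1|)) * f z) ^ 2 ≤
        C * ∫⁻ z, (ENNReal.ofReal (bourgainWeight dispersion σ s z) * f z) ^ 2 := by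
  obtain ⟨C, hC⟩ := exists_sq_lintegral_time_le
  set B := ∫⁻ η : ℝ, ENNReal.ofReal (Real.exp (-((σ - a) * 2 * (2 * Real.pi)) * |η|)) with hB
  have hBfin : B < ∞ :=
    (integrable_exp_neg_mul_abs (by have := Real.pi_pos; have := sub_pos.2 h; positivity)).lintegral_lt_top
  refine ⟨B.toNNReal * C, fun s hs f hf => ?_⟩
  have hm : Measurable fun z : ℝ × ℝ => ENNReal.ofReal (Real.exp (a * |2 * Real.pi * z.1|)) * f z := by
    fun_prop
  have hmi : Measurable fun η => ∫⁻ θ, f (η, θ) := hf.lintegral_prod_right'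
  calc (∫⁻ z, ENNReal.ofReal (Real.exp (a * |2 * Real.pi * z.1|)) * f z) ^ 2
      = (∫⁻ η, ENNReal.ofReal (Real.exp (a * |2 * Real.pi * η|)) * ∫⁻ θ, f (η, θ)) ^ 2 := by
        rw [Measure.volume_eq_prod, lintegral_prod _ hm.aemeasurable]
        simp_rw [lintegral_const_mul' _ _ ENNReal.ofReal_ne_top]
    _ ≤ (∫⁻ η, ENNReal.ofReal (Real.exp (-((σ - a) * |2 * Real.pi * η|))) *
          (ENNReal.ofReal (gevreyWeight σ s η) * ∫⁻ θ, f (η, θ))) ^ 2 := by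
        refine pow_le_pow_left' (lintegral_mono fun η => ?_) 2
        have h1 : 1 ≤ bracket (2 * Real.pi * η) ^ s := Real.one_le_rpow (one_le_bracket _) hs
        rw [← mul_assoc, ← ENNReal.ofReal_mul (Real.exp_pos _).le]
        refine mul_le_mul_left (ENNReal.ofReal_le_ofReal ?_) _
        unfold gevreyWeight
        rw [← mul_assoc, ← Real.exp_add]
        calc _ = Real.exp (a * |2 * Real.pi * η|) * 1 := (mul_one _).symm
          _ ≤ _ := by gcongr; linarith
    _ ≤ B * ∫⁻ η, (ENNReal.ofReal (gevreyWeight σ s η) * ∫⁻ θ, f (η, θ)) ^ 2 := by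
        refine (sq_lintegral_mul_le volume (by fun_prop) (by fun_prop)).trans ?_
        rw [hB]
        gcongr with η
        rw [← ENNReal.ofReal_pow (Real.exp_pos _).le, ← Real.exp_nat_mul]
        refine ENNReal.ofReal_le_ofReal (le_of_eq ?_)
        rw [abs_mul, abs_of_pos (by positivity : 0 < 2 * Real.pi)]
        congr 1; push_cast; ring
    _ ≤ B * (C * ∫⁻ z, (ENNReal.ofReal (bourgainWeight dispersion σ s z) * f z) ^ 2) := by
        gcongr; exact hC σ s f hf
    _ = _ := by rw [ENNReal.coe_mul, ENNReal.coe_toNNReal hBfin.ne, mul_assoc]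

theorem lintegral_weight_mul_enorm_sq {σ s : ℝ} (F : ℝ × ℝ → ℂ) :
    ∫⁻ z, (ENNReal.ofReal (bourgainWeight dispersion σ s z) * ‖F z‖ₑ) ^ 2 =
      eLpNorm (fun z => (bourgainWeight dispersion σ s z : ℂ) * F z) 2 ^ 2 := by
  rw [eLpNorm_two_sq]
  refine lintegral_congr fun z => ?_
  rw [enorm_mul, ← ofReal_norm (Complex.ofReal _), Complex.norm_real,
    Real.norm_of_nonneg (bourgainWeight_pos _ _ _ _).le]

theorem integrable_mul_of_memLp {a σ s K : ℝ} (h : a < σ) (hs : 0 ≤ s) {F : ℝ × ℝ → ℂ}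
    (hF : Measurable F) (h2 : MemLp (fun z => (bourgainWeight dispersion σ s z : ℂ) * F z) 2)
    {m : ℝ × ℝ → ℂ} (hm : Measurable m)
    (hmK : ∀ z, ‖m z‖ ≤ K * Real.exp (a * |2 * Real.pi * z.1|)) :
    Integrable fun z => m z * F z := by
  obtain ⟨C, hC⟩ := exists_sq_lintegral_exp_mul_le h
  have h1 := hC s hs (fun z => ‖F z‖ₑ) hF.enorm
  rw [lintegral_weight_mul_enorm_sq] at h1
  have h3 := h2.2.ne
  have h4 : ∫⁻ z, ENNReal.ofReal (Real.exp (a * |2 * Real.pi * z.1|)) * ‖F z‖ₑ < ∞ := by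
    have : (∫⁻ z, ENNReal.ofReal (Real.exp (a * |2 * Real.pi * z.1|)) * ‖F z‖ₑ) ^ 2 < ∞ :=
      h1.trans_lt (by finiteness)
    by_contra h
    rw [not_lt, top_le_iff] at h
    rw [h] at this
    simp at this
  refine ⟨by fun_prop, ?_⟩
  rw [hasFiniteIntegral_iff_enorm]
  calc _ ≤ ∫⁻ z, ENNReal.ofReal K * (ENNReal.ofReal (Real.exp (a * |2 * Real.pi * z.1|)) * ‖F z‖ₑ) := by
        refine lintegral_mono fun z => ?_
        have hK : 0 ≤ K := by
          have := (norm_nonneg _).trans (hmK z)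
          exact nonneg_of_mul_nonneg_left this (Real.exp_pos _)
        rw [← mul_assoc, ← ENNReal.ofReal_mul hK, enorm_mul, ← ofReal_norm (m z)]
        gcongr
        exact hmK z
    _ < ∞ := by
        rw [lintegral_const_mul' _ _ ENNReal.ofReal_ne_top]
        exact ENNReal.mul_lt_top ENNReal.ofReal_lt_top h4

/-- The sum of three frequencies. -/
def total (y : ((ℝ × ℝ) × (ℝ × ℝ)) × (ℝ × ℝ)) : ℝ × ℝ := y.1.1 + y.1.2 + y.2

/-- The change of variables that separates the output modulation from the input frequencies. -/
theorem measurePreserving_total : MeasurePreserving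
    (fun q : ℝ × ((ℝ × ℝ) × (ℝ × ℝ)) × (ℝ × ℝ) =>
      ((((total q.2).1, q.1), ((total q.2).2, q.2.1)) : (ℝ × ℝ) × ℝ × (ℝ × ℝ) × (ℝ × ℝ))) := by
  have h1 : MeasurePreserving (fun y : ((ℝ × ℝ) × (ℝ × ℝ)) × (ℝ × ℝ) => (y.1, total y)) :=
    (MeasurePreserving.id volume).skew_product (g := fun (p : (ℝ × ℝ) × (ℝ × ℝ)) (w : ℝ × ℝ) => p.1 + p.2 + w)
      (by unfold Function.uncurry; fun_prop)
      (Eventually.of_forall fun p => map_add_left_eq_self _ _)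
  have h2 : MeasurePreserving (fun y : ((ℝ × ℝ) × (ℝ × ℝ)) × (ℝ × ℝ) => (total y, y.1)) :=
    Measure.measurePreserving_swap.comp h1
  have h3 : MeasurePreserving (fun y : ((ℝ × ℝ) × (ℝ × ℝ)) × (ℝ × ℝ) =>
      ((total y).1, ((total y).2, y.1))) := volume_preserving_prodAssoc.comp h2
  have h4 : MeasurePreserving (fun q : ℝ × ((ℝ × ℝ) × (ℝ × ℝ)) × (ℝ × ℝ) =>
      (q.1, (total q.2).1, ((total q.2).2, q.2.1))) := (MeasurePreserving.id volume).prod h3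
  have h5 : MeasurePreserving (fun q : ℝ × ((ℝ × ℝ) × (ℝ × ℝ)) × (ℝ × ℝ) =>
      ((q.1, (total q.2).1), ((total q.2).2, q.2.1))) := (volume_preserving_prodAssoc.symm _).comp h4
  exact (Measure.measurePreserving_swap.prod (MeasurePreserving.id volume)).comp h5

theorem lt_top_of_sq_lt_top {x : ℝ≥0∞} (h : x ^ 2 < ∞) : x < ∞ := by
  by_contra hx
  rw [not_lt, top_le_iff] at hx
  rw [hx] at h
  simp at h

/-- Absolute convergence of the full multiple integral, which justifies Fubini. It comes from the
absolute form `exists_absDuhamel_le` of the trilinear estimate, applied to |F|. -/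
theorem integrable_mul_duhamelIntegrand {σ s T a K : ℝ} (hσ : 0 ≤ σ) (hs : 1 / 4 ≤ s) (hT : 0 < T)
    (hT1 : T ≤ 1) (h : a < σ) (c : ℂ) {F : ℝ × ℝ → ℂ} (hF : Measurable F)
    (h2 : MemLp (fun z => (bourgainWeight dispersion σ s z : ℂ) * F z) 2) {m : ℝ × ℝ → ℂ}
    (hm : Measurable m) (hmK : ∀ z, ‖m z‖ ≤ K * Real.exp (a * |2 * Real.pi * z.1|)) :
    Integrable fun q : (ℝ × ℝ) × ℝ × (ℝ × ℝ) × (ℝ × ℝ) =>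
      m q.1 * duhamelIntegrand T c F F F q.1 q.2 := by
  have hK : 0 ≤ K := nonneg_of_mul_nonneg_left ((norm_nonneg _).trans (hmK 0)) (Real.exp_pos _)
  have hd := measurable_duhamelIntegrand T c hF hF hF
  have hm1 : Measurable fun q : (ℝ × ℝ) × ℝ × (ℝ × ℝ) × (ℝ × ℝ) => m q.1 := hm.comp measurable_fst
  have hmm : Measurable fun q : (ℝ × ℝ) × ℝ × (ℝ × ℝ) × (ℝ × ℝ) =>
      m q.1 * duhamelIntegrand T c F F F q.1 q.2 := hm1.mul hd
  refine ⟨hmm.aestronglyMeasurable, ?_⟩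
  obtain ⟨C₁, hC₁⟩ := exists_sq_lintegral_exp_mul_le h
  obtain ⟨C₂, hC₂⟩ := exists_absDuhamel_le
  have hWm := measurable_bourgainWeight dispersion σ s
  have hW0 := bourgainWeight_pos dispersion σ s
  have hinv : (fun z => inverseWeight dispersion σ s z *
      (ENNReal.ofReal (bourgainWeight dispersion σ s z) * ‖F z‖ₑ)) = fun z => ‖F z‖ₑ := by
    funext z
    rw [inverseWeight_eq, ← mul_assoc, ← ENNReal.ofReal_mul (inv_nonneg.2 (hW0 z).le),
      inv_mul_cancel₀ (hW0 z).ne', ENNReal.ofReal_one, one_mul]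
  have hfm : Measurable fun z => ENNReal.ofReal (bourgainWeight dispersion σ s z) * ‖F z‖ₑ := by
    fun_prop
  have hb := hC₂ dispersion σ s T one_le_three_mul_dispersion hσ hs hT hT1 _ _ _ hfm hfm hfm
  rw [hinv, lintegral_weight_mul_enorm_sq] at hb
  have hN := h2.2.ne
  have hA : Measurable (absDuhamel dispersion T
      (tripleConv (fun w => ‖F w‖ₑ) (fun w => ‖F w‖ₑ) (fun w => ‖F w‖ₑ))) :=
    measurable_absDuhamel _ T (measurable_tripleConv hF.enorm hF.enorm hF.enorm)
  have hb2 := hC₁ s (by linarith) _ hA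
  have hfin : ∫⁻ z, ENNReal.ofReal (Real.exp (a * |2 * Real.pi * z.1|)) * absDuhamel dispersion T
      (tripleConv (fun w => ‖F w‖ₑ) (fun w => ‖F w‖ₑ) (fun w => ‖F w‖ₑ)) z < ∞ := by
    refine lt_top_of_sq_lt_top (hb2.trans_lt (ENNReal.mul_lt_top ENNReal.coe_lt_top
      (hb.trans_lt ?_)))
    finiteness
  rw [hasFiniteIntegral_iff_enorm, Measure.volume_eq_prod, lintegral_prod _ hmm.enorm.aemeasurable]
  calc _ = ∫⁻ z, ‖m z‖ₑ * (‖c‖ₑ * absDuhamel dispersion T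
      (tripleConv (fun w => ‖F w‖ₑ) (fun w => ‖F w‖ₑ) (fun w => ‖F w‖ₑ)) z) := by
        refine lintegral_congr fun z => ?_
        simp_rw [enorm_mul]
        rw [lintegral_const_mul' _ _ enorm_ne_top, lintegral_duhamelIntegrand T c hF hF hF]
    _ ≤ ∫⁻ z, ENNReal.ofReal K * ‖c‖ₑ * (ENNReal.ofReal (Real.exp (a * |2 * Real.pi * z.1|)) *
        absDuhamel dispersion T
          (tripleConv (fun w => ‖F w‖ₑ) (fun w => ‖F w‖ₑ) (fun w => ‖F w‖ₑ)) z) := by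
        refine lintegral_mono fun z => ?_
        have h1 : ‖m z‖ₑ ≤ ENNReal.ofReal K * ENNReal.ofReal (Real.exp (a * |2 * Real.pi * z.1|)) := by
          rw [← ENNReal.ofReal_mul hK, ← ofReal_norm]
          exact ENNReal.ofReal_le_ofReal (hmK z)
        refine (mul_le_mul_left h1 _).trans (le_of_eq ?_)
        ring
    _ < ∞ := by
        rw [lintegral_const_mul' _ _ (by finiteness)]
        exact ENNReal.mul_lt_top (by finiteness) hfin

/-- The product of the amplitudes at three frequencies. -/
def cubicProd (F : ℝ × ℝ → ℂ) (y : ((ℝ × ℝ) × (ℝ × ℝ)) × (ℝ × ℝ)) : ℂ := F y.1.1 * F y.1.2 * F y.2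

theorem measurable_cubicProd {F : ℝ × ℝ → ℂ} (hF : Measurable F) : Measurable (cubicProd F) := by
  unfold cubicProd; fun_prop

/-- The modulation of the sum of three frequencies. -/
noncomputable def phaseDefect (y : ((ℝ × ℝ) × (ℝ × ℝ)) × (ℝ × ℝ)) : ℝ :=
  (total y).2 - dispersion * (total y).1 ^ 3

@[fun_prop]
theorem measurable_phaseDefect : Measurable phaseDefect := by unfold phaseDefect; fun_prop

@[fun_prop]
theorem measurable_timeIntegral (t : ℝ) : Measurable (timeIntegral t) := by
  unfold timeIntegral; fun_prop

/-- Integrating out the time frequency inverts the Fourier transform of the cutoff, which is 1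
because |t| ≤ T ≤ 1. -/
theorem integral_mul_freeTerm {σ s T t : ℝ} (hs : 0 ≤ s)
    (hT1 : T ≤ 1) (ht : |t| ≤ T) {φ : ℝ → ℂ} (hφ : Measurable φ)
    (hρ : MemLp (fun η => (gevreyWeight σ s η : ℂ) * φ η) 2) {m : ℝ → ℂ}
    (hm : Measurable m) {a K : ℝ} (h : a < σ)
    (hmK : ∀ η, ‖m η‖ ≤ K * Real.exp (a * |2 * Real.pi * η|)) :
    Integrable (fun z : ℝ × ℝ => m z.1 * wave (t * z.2) * freeTerm φ z) ∧
    ∫ z : ℝ × ℝ, m z.1 * wave (t * z.2) * freeTerm φ z =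
      ∫ η, m η * wave (t * (dispersion * η ^ 3)) * φ η := by
  obtain ⟨A, hA⟩ := exists_eLpNorm_freeTerm_le
  have hfm := measurable_freeTerm hφ
  have hfree : MemLp (fun z => (bourgainWeight dispersion σ s z : ℂ) * freeTerm φ z) 2 :=
    ⟨by fun_prop, (hA σ s φ hφ).trans_lt (ENNReal.mul_lt_top ENNReal.coe_lt_top hρ.2)⟩
  have hint : Integrable (fun z : ℝ × ℝ => m z.1 * wave (t * z.2) * freeTerm φ z) :=
    integrable_mul_of_memLp h hs hfm hfree (m := fun z => m z.1 * wave (t * z.2)) (by fun_prop)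
      fun z => by rw [norm_mul, norm_wave, mul_one]; exact hmK z.1
  refine ⟨hint, ?_⟩
  rw [Measure.volume_eq_prod, integral_prod _ hint]
  refine integral_congr_ae (Eventually.of_forall fun η => ?_)
  have e : ∀ θ, m η * wave (t * θ) * freeTerm φ (η, θ) =
      m η * wave (t * (dispersion * η ^ 3)) * φ η *
        (fun x => wave (t * x) * cutoffHat x) (θ - dispersion * η ^ 3) := by
    intro θ
    simp only [freeTerm]
    rw [show t * θ = t * (dispersion * η ^ 3) + t * (θ - dispersion * η ^ 3) by ring, wave_add]
    ring
  simp_rw [e]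
  rw [integral_const_mul, integral_sub_right_eq_self (fun x => wave (t * x) * cutoffHat x),
    integral_wave_mul_cutoffHat, timeCutoff_eq_one (ht.trans hT1), mul_one]

/-- With the three input frequencies fixed, the output modulation is integrated first. By
`integral_wave_mul_duhamelKernel` the kernel becomes the exact time integral at the modulation of
the sum, and the dependence on T disappears. -/
theorem integral_mul_duhamelTerm {σ s T t : ℝ} (hσ : 0 ≤ σ) (hs : 1 / 4 ≤ s) (hT : 0 < T)
    (hT1 : T ≤ 1) (ht : |t| ≤ T) (c : ℂ) {F : ℝ × ℝ → ℂ} (hF : Measurable F)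
    (h2 : MemLp (fun z => (bourgainWeight dispersion σ s z : ℂ) * F z) 2) {m : ℝ → ℂ}
    (hm : Measurable m) {a K : ℝ} (h : a < σ)
    (hmK : ∀ η, ‖m η‖ ≤ K * Real.exp (a * |2 * Real.pi * η|)) :
    Integrable (fun z : ℝ × ℝ => m z.1 * wave (t * z.2) * duhamelTerm T c F z) ∧
    ∫ z : ℝ × ℝ, m z.1 * wave (t * z.2) * duhamelTerm T c F z =
      ∫ y, m (total y).1 * wave (t * (dispersion * (total y).1 ^ 3)) * (c * (total y).1) *
        cubicProd F y * timeIntegral t (phaseDefect y) := by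
  have hint := integrable_mul_duhamelIntegrand hσ hs hT hT1 h c hF h2
    (m := fun z => m z.1 * wave (t * z.2)) (by fun_prop)
    (fun z => by rw [norm_mul, norm_wave, mul_one]; exact hmK z.1)
  have hint2 := hint.integral_prod_left
  simp_rw [integral_const_mul] at hint2
  refine ⟨hint2, ?_⟩
  have e1 : ∫ z : ℝ × ℝ, m z.1 * wave (t * z.2) * duhamelTerm T c F z =
      ∫ q : (ℝ × ℝ) × ℝ × (ℝ × ℝ) × (ℝ × ℝ),
        m q.1.1 * wave (t * q.1.2) * duhamelIntegrand T c F F F q.1 q.2 := by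
    rw [Measure.volume_eq_prod (ℝ × ℝ) (ℝ × (ℝ × ℝ) × (ℝ × ℝ)), integral_prod _ hint]
    simp_rw [integral_const_mul]
    rfl
  have hmp := measurePreserving_total
  rw [e1, ← hmp.map_eq, integral_map hmp.measurable.aemeasurable (by rw [hmp.map_eq]; exact hint.1)]
  have hint3 := hmp.integrable_comp_of_integrable hint
  refine (integral_prod_symm _ hint3).trans ?_
  refine integral_congr_ae (Eventually.of_forall fun y => ?_)
  have e2 : ∀ θ, m (total y).1 * wave (t * θ) *
      duhamelIntegrand T c F F F ((total y).1, θ) ((total y).2, y.1) =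
      m (total y).1 * wave (t * (dispersion * (total y).1 ^ 3)) * (c * (total y).1) * cubicProd F y *
        (fun x => wave (t * x) * duhamelKernel T x (phaseDefect y))
          (θ - dispersion * (total y).1 ^ 3) := by
    intro θ
    have e3 : ((total y).1, (total y).2) - y.1.1 - y.1.2 = y.2 := by
      rw [Prod.mk.eta]; unfold total; abel
    simp only [duhamelIntegrand, cubicProd, phaseDefect]
    rw [e3, show t * θ = t * (dispersion * (total y).1 ^ 3) + t * (θ - dispersion * (total y).1 ^ 3) by
      ring, wave_add]
    ring
  refine (integral_congr_ae (Eventually.of_forall e2)).trans ?_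
  rw [integral_const_mul, integral_sub_right_eq_self
    (fun x => wave (t * x) * duhamelKernel T x (phaseDefect y)), integral_wave_mul_duhamelKernel hT ht]

/-- On the existence interval, the solution satisfies the integral equation. -/
theorem IsAmplitude.integral_eq {σ s T t : ℝ} (hσ : 0 ≤ σ) (hs : 1 / 4 ≤ s) (hT : 0 < T)
    (hT1 : T ≤ 1) (ht : |t| ≤ T) {c : ℂ} {φ : ℝ → ℂ} (hφ : Measurable φ)
    (hρ : MemLp (fun η => (gevreyWeight σ s η : ℂ) * φ η) 2) {r : ℝ≥0} {F : ℝ × ℝ → ℂ}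
    (hF : IsAmplitude σ s T c φ r F) {m : ℝ → ℂ}
    (hm : Measurable m) {a K : ℝ} (h : a < σ)
    (hmK : ∀ η, ‖m η‖ ≤ K * Real.exp (a * |2 * Real.pi * η|)) :
    ∫ z : ℝ × ℝ, m z.1 * wave (t * z.2) * F z =
      (∫ η, m η * wave (t * (dispersion * η ^ 3)) * φ η) +
      ∫ y, m (total y).1 * wave (t * (dispersion * (total y).1 ^ 3)) * (c * (total y).1) *
        cubicProd F y * timeIntegral t (phaseDefect y) := by
  obtain ⟨i1, e1⟩ := integral_mul_freeTerm (by linarith) hT1 ht hφ hρ hm h hmK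
  obtain ⟨i2, e2⟩ := integral_mul_duhamelTerm hσ hs hT hT1 ht c hF.measurable hF.memLp hm h hmK
  rw [← e1, ← e2, ← integral_add i1 i2]
  refine integral_congr_ae ?_
  filter_upwards [hF.eq] with z hz
  rw [hz, mul_add]

theorem norm_two_pi_I_mul (η : ℝ) : ‖(2 * Real.pi * Complex.I * η : ℂ)‖ = |2 * Real.pi * η| := by
  simp [abs_mul]

theorem hasDerivAt_wave_mul (b t : ℝ) :
    HasDerivAt (fun r : ℝ => wave (r * b)) (2 * Real.pi * Complex.I * b * wave (t * b)) t := by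
  have h1 : HasDerivAt (fun r : ℝ => ((2 * Real.pi * (r * b) : ℝ) : ℂ) * Complex.I)
      (2 * Real.pi * Complex.I * b) t := by
    have h2 : HasDerivAt (fun r : ℝ => 2 * Real.pi * (r * b)) (2 * Real.pi * b) t := by
      simpa using ((hasDerivAt_id t).mul_const b).const_mul (2 * Real.pi)
    convert! (h2.ofReal_comp).mul_const Complex.I using 1
    push_cast; ring
  convert! h1.cexp using 1
  unfold wave
  ring

theorem norm_timeIntegral_le (t y : ℝ) : ‖timeIntegral t y‖ ≤ |t| := by
  unfold timeIntegral
  rcases eq_or_ne y 0 with rfl | hy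
  · simp
  have h1 : ‖wave (t * y) - 1‖ ≤ |2 * Real.pi * (t * y)| := by
    have := Real.norm_exp_I_mul_ofReal_sub_one_le (x := 2 * Real.pi * (t * y))
    rw [mul_comm] at this
    exact this
  have h2 : ‖(2 * Real.pi * y * Complex.I : ℂ)‖ = |2 * Real.pi * y| := by simp [abs_mul]
  have h3 : 0 < |2 * Real.pi * y| := by
    have := Real.pi_pos
    positivity
  rw [norm_div, h2, div_le_iff₀ h3]
  refine h1.trans (le_of_eq ?_)
  rw [← abs_mul]; ring_nf

/-- At y = 0 the quotient is 0 for every t instead of t, so the formula would fail there. -/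
theorem hasDerivAt_timeIntegral {y : ℝ} (hy : y ≠ 0) (t : ℝ) :
    HasDerivAt (fun r => timeIntegral r y) (wave (t * y)) t := by
  have h := ((hasDerivAt_wave_mul y t).sub_const 1).div_const (2 * Real.pi * y * Complex.I)
  convert! h using 1
  have h1 : (y : ℂ) ≠ 0 := Complex.ofReal_ne_zero.2 hy
  have h2 : (Real.pi : ℂ) ≠ 0 := Complex.ofReal_ne_zero.2 Real.pi_ne_zero
  field_simp

theorem measurePreserving_prod_total :
    MeasurePreserving (fun y : ((ℝ × ℝ) × (ℝ × ℝ)) × (ℝ × ℝ) => (y.1, total y)) :=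
  (MeasurePreserving.id volume).skew_product
    (g := fun (p : (ℝ × ℝ) × (ℝ × ℝ)) (w : ℝ × ℝ) => p.1 + p.2 + w)
    (by unfold Function.uncurry; fun_prop)
    (Eventually.of_forall fun p => map_add_left_eq_self _ _)

/-- The exceptional set is the preimage of the graph of the dispersion relation, a null set. This
makes the default value of `timeIntegral` at 0 harmless. -/
theorem ae_phaseDefect_ne_zero : ∀ᵐ y, phaseDefect y ≠ 0 := by
  have h1 : ∀ᵐ z : ℝ × ℝ, z.2 - dispersion * z.1 ^ 3 ≠ 0 := by
    have hs : MeasurableSet {z : ℝ × ℝ | z.2 - dispersion * z.1 ^ 3 = 0} :=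
      measurableSet_eq_fun (by fun_prop) (by fun_prop)
    refine measure_mono_null (t := {z : ℝ × ℝ | z.2 - dispersion * z.1 ^ 3 = 0}) (fun z hz => ?_) ?_
    · simpa using hz
    · rw [Measure.volume_eq_prod, Measure.measure_prod_null hs]
      refine Eventually.of_forall fun η => ?_
      refine measure_mono_null (t := {dispersion * η ^ 3}) (fun θ hθ => ?_) Real.volume_singleton
      exact sub_eq_zero.1 hθ
  exact (Measure.quasiMeasurePreserving_snd.comp
    measurePreserving_prod_total.quasiMeasurePreserving).ae h1

section

variable {σ s : ℝ} {F : ℝ × ℝ → ℂ}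

theorem integrable_pow_mul (hσ : 0 < σ) (hs : 0 ≤ s) (hF : Measurable F)
    (h2 : MemLp (fun z => (bourgainWeight dispersion σ s z : ℂ) * F z) 2) (k : ℕ) (x t : ℝ) :
    Integrable fun z : ℝ × ℝ =>
      (2 * Real.pi * Complex.I * z.1) ^ k * wave (x * z.1) * wave (t * z.2) * F z := by
  refine integrable_mul_of_memLp (K := k.factorial / (σ / 2) ^ k) (half_lt_self hσ) hs hF h2
    (m := fun z => (2 * Real.pi * Complex.I * z.1) ^ k * wave (x * z.1) * wave (t * z.2))
    (by fun_prop) fun z => ?_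
  rw [norm_mul, norm_mul, norm_wave, norm_wave, mul_one, mul_one, norm_pow, norm_two_pi_I_mul]
  exact pow_le_mul_exp (half_pos hσ) k _

theorem integrable_pow_mul_cubicProd (hσ : 0 < σ) (hs : 0 ≤ s) (hF : Measurable F)
    (h2 : MemLp (fun z => (bourgainWeight dispersion σ s z : ℂ) * F z) 2) (k : ℕ) :
    Integrable fun y => |2 * Real.pi * (total y).1| ^ k * ‖cubicProd F y‖ := by
  have h1 : Integrable fun z : ℝ × ℝ => ((Real.exp (σ / 2 * |2 * Real.pi * z.1|) : ℝ) : ℂ) * F z := by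
    refine integrable_mul_of_memLp (K := 1) (half_lt_self hσ) hs hF h2
      (m := fun z => ((Real.exp (σ / 2 * |2 * Real.pi * z.1|) : ℝ) : ℂ)) (by fun_prop) fun z => ?_
    rw [Complex.norm_real, Real.norm_of_nonneg (Real.exp_pos _).le, one_mul]
  have h3 := ((h1.norm.mul_prod h1.norm).mul_prod h1.norm).const_mul (k.factorial / (σ / 2) ^ k)
  have hm := measurable_cubicProd hF
  refine h3.mono' (by fun_prop) (Eventually.of_forall fun y => ?_)
  rw [norm_mul, norm_pow, norm_norm, Real.norm_eq_abs, abs_abs]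
  refine (mul_le_mul_of_nonneg_right (pow_le_mul_exp (half_pos hσ) k _) (norm_nonneg _)).trans ?_
  rw [mul_assoc]
  refine mul_le_mul_of_nonneg_left ?_ (by positivity)
  simp only [norm_mul, Complex.norm_real, Real.norm_of_nonneg (Real.exp_pos _).le, cubicProd]
  have h4 : Real.exp (σ / 2 * |2 * Real.pi * (total y).1|) ≤
      Real.exp (σ / 2 * |2 * Real.pi * y.1.1.1|) * Real.exp (σ / 2 * |2 * Real.pi * y.1.2.1|) *
        Real.exp (σ / 2 * |2 * Real.pi * y.2.1|) := by
    rw [← Real.exp_add, ← Real.exp_add, ← mul_add, ← mul_add]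
    refine Real.exp_le_exp.2 (mul_le_mul_of_nonneg_left ?_ (half_pos hσ).le)
    have e : 2 * Real.pi * (total y).1 =
        2 * Real.pi * y.1.1.1 + 2 * Real.pi * y.1.2.1 + 2 * Real.pi * y.2.1 := by
      unfold total; simp only [Prod.fst_add]; ring
    rw [e]
    exact abs_add_three _ _ _
  refine (mul_le_mul_of_nonneg_right h4 (by positivity)).trans (le_of_eq ?_)
  ring

/-- The space-time function with Fourier transform `F`, differentiated `k` times in space. -/
noncomputable def evolution (F : ℝ × ℝ → ℂ) (k : ℕ) (t x : ℝ) : ℂ :=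
  ∫ z : ℝ × ℝ, (2 * Real.pi * Complex.I * z.1) ^ k * wave (x * z.1) * wave (t * z.2) * F z

/-- The total frequency is the sum of three, so the integral splits into three products. This is
∂ₓ(u³) = 3u²∂ₓu on the Fourier side. -/
theorem integral_total_mul_cubicProd (hσ : 0 < σ) (hs : 0 ≤ s) (hF : Measurable F)
    (h2 : MemLp (fun z => (bourgainWeight dispersion σ s z : ℂ) * F z) 2) (t x : ℝ) :
    ∫ y, 2 * Real.pi * Complex.I * (total y).1 *
      (wave (x * (total y).1) * wave (t * (total y).2) * cubicProd F y) =
      3 * evolution F 0 t x ^ 2 * evolution F 1 t x := by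
  obtain ⟨f, hf⟩ : ∃ f : ℕ → ℝ × ℝ → ℂ, ∀ k z, f k z =
    (2 * Real.pi * Complex.I * z.1) ^ k * wave (x * z.1) * wave (t * z.2) * F z := ⟨_, fun _ _ => rfl⟩
  have hi : ∀ k, Integrable (f k) := fun k => by
    rw [show f k = _ from funext (hf k)]; exact integrable_pow_mul hσ hs hF h2 k x t
  have hev : ∀ k, ∫ z, f k z = evolution F k t x := fun k => by simp only [hf]; rfl
  have e : ∀ y : ((ℝ × ℝ) × (ℝ × ℝ)) × (ℝ × ℝ), 2 * Real.pi * Complex.I * (total y).1 *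
      (wave (x * (total y).1) * wave (t * (total y).2) * cubicProd F y) =
      f 1 y.1.1 * f 0 y.1.2 * f 0 y.2 + f 0 y.1.1 * f 1 y.1.2 * f 0 y.2 +
        f 0 y.1.1 * f 0 y.1.2 * f 1 y.2 := by
    intro y
    simp only [hf, total, cubicProd, Prod.fst_add, Prod.snd_add, mul_add, wave_add]
    push_cast; ring
  simp_rw [e]
  have hi3 : ∀ i j k, Integrable fun y : ((ℝ × ℝ) × (ℝ × ℝ)) × (ℝ × ℝ) =>
      f i y.1.1 * f j y.1.2 * f k y.2 := fun i j k => ((hi i).mul_prod (hi j)).mul_prod (hi k)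
  have hi12 : Integrable fun y : ((ℝ × ℝ) × (ℝ × ℝ)) × (ℝ × ℝ) =>
      f 1 y.1.1 * f 0 y.1.2 * f 0 y.2 + f 0 y.1.1 * f 1 y.1.2 * f 0 y.2 := (hi3 1 0 0).add (hi3 0 1 0)
  have c : ∀ i j k, ∫ y : ((ℝ × ℝ) × (ℝ × ℝ)) × (ℝ × ℝ), f i y.1.1 * f j y.1.2 * f k y.2 =
      evolution F i t x * evolution F j t x * evolution F k t x := fun i j k => by
    rw [Measure.volume_eq_prod, integral_prod_mul (fun p : (ℝ × ℝ) × (ℝ × ℝ) => f i p.1 * f j p.2) (f k),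
      Measure.volume_eq_prod, integral_prod_mul, hev, hev, hev]
  rw [integral_add hi12 (hi3 0 0 1), integral_add (hi3 1 0 0) (hi3 0 1 0), c, c, c]
  ring

/-- The value of `dispersion` is the one for which 2πi · 4π²η³ = -(2πiη)³: the time derivative
equals minus the third space derivative. -/
theorem hasDerivAt_integral_free (hσ : 0 < σ) (hs : 0 ≤ s) {φ : ℝ → ℂ} (hφ : Measurable φ)
    (hρ : MemLp (fun η => (gevreyWeight σ s η : ℂ) * φ η) 2) (t x : ℝ) :
    HasDerivAt (fun r => ∫ η, wave (x * η) * wave (r * (dispersion * η ^ 3)) * φ η)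
      (-∫ η : ℝ, (2 * Real.pi * Complex.I * η) ^ 3 * wave (x * η) *
        wave (t * (dispersion * η ^ 3)) * φ η) t := by
  have hi := integrable_exp_mul_of_memLp (half_lt_self hσ) hs hφ hρ
  have h0 := integrable_derivSymbol (half_pos hσ) hφ hi 0
  have h3 := integrable_derivSymbol (half_pos hσ) hφ hi 3
  rw [derivSymbol_zero] at h0
  have h := hasDerivAt_integral_of_dominated_loc_of_deriv_le (𝕜 := ℝ) (μ := (volume : Measure ℝ))
    (F := fun (r : ℝ) (η : ℝ) => wave (x * η) * wave (r * (dispersion * η ^ 3)) * φ η)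
    (F' := fun (r : ℝ) (η : ℝ) => -((2 * Real.pi * Complex.I * η) ^ 3 * wave (x * η) *
        wave (r * (dispersion * η ^ 3)) * φ η)) (x₀ := t)
    (bound := fun η => ‖derivSymbol 3 φ η‖) univ_mem
    (Eventually.of_forall fun r => by fun_prop) ?_ (by fun_prop) ?_ h3.norm ?_
  · rw [← integral_neg]; exact h.2
  · refine h0.norm.mono' (by fun_prop) (Eventually.of_forall fun η => ?_)
    rw [norm_mul, norm_mul, norm_wave, norm_wave, one_mul, one_mul]
  · refine Eventually.of_forall fun η r _ => le_of_eq ?_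
    rw [norm_neg, norm_mul, norm_mul, norm_mul, norm_wave, norm_wave, mul_one, mul_one]
    unfold derivSymbol
    rw [norm_mul]
  · refine Eventually.of_forall fun η r _ => ?_
    convert! ((hasDerivAt_wave_mul (dispersion * η ^ 3) r).const_mul (wave (x * η))).mul_const (φ η) using 1
    unfold dispersion
    push_cast
    linear_combination (-8 * Real.pi ^ 3 * Complex.I * η ^ 3 * wave (x * η) *
      wave (r * (4 * Real.pi ^ 2 * η ^ 3)) * φ η : ℂ) * Complex.I_sq

/-- The derivative falls on the dispersive phase, which gives minus the third space derivative, and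
on the time integral, which gives the nonlinearity. Four powers of the frequency must be integrable,
three for the dispersion and one for the derivative in the nonlinearity. -/
theorem hasDerivAt_integral_duhamel (hσ : 0 < σ) (hs : 0 ≤ s) (hF : Measurable F)
    (h2 : MemLp (fun z => (bourgainWeight dispersion σ s z : ℂ) * F z) 2) (c : ℂ) (t x : ℝ) :
    HasDerivAt (fun r => ∫ y, wave (x * (total y).1) * wave (r * (dispersion * (total y).1 ^ 3)) *
      (c * (total y).1) * cubicProd F y * timeIntegral r (phaseDefect y))
      (-(∫ y, (2 * Real.pi * Complex.I * (total y).1) ^ 3 * wave (x * (total y).1) *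
          wave (t * (dispersion * (total y).1 ^ 3)) * (c * (total y).1) * cubicProd F y *
            timeIntegral t (phaseDefect y)) +
        ∫ y, c * (total y).1 * (wave (x * (total y).1) * wave (t * (total y).2) * cubicProd F y)) t := by
  have hm := measurable_cubicProd hF
  have i1 := integrable_pow_mul_cubicProd hσ hs hF h2 1
  have i4 := integrable_pow_mul_cubicProd hσ hs hF h2 4
  have hle : ∀ η : ℝ, |η| ≤ |2 * Real.pi * η| := fun η => by
    rw [abs_mul]
    exact le_mul_of_one_le_left (abs_nonneg _) (by
      rw [abs_of_pos Real.two_pi_pos]; linarith [Real.pi_gt_three])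
  have hmT : ∀ r, Measurable fun y : ((ℝ × ℝ) × (ℝ × ℝ)) × (ℝ × ℝ) => timeIntegral r (phaseDefect y) :=
    fun r => (measurable_timeIntegral r).comp measurable_phaseDefect
  have hA : ∀ r y, ‖(2 * Real.pi * Complex.I * (total y).1) ^ 3 * wave (x * (total y).1) *
      wave (r * (dispersion * (total y).1 ^ 3)) * (c * (total y).1) * cubicProd F y *
        timeIntegral r (phaseDefect y)‖ ≤
      ‖c‖ * |r| * (|2 * Real.pi * (total y).1| ^ 4 * ‖cubicProd F y‖) := by
    intro r y
    rw [norm_mul, norm_mul, norm_mul, norm_mul, norm_mul, norm_pow, norm_two_pi_I_mul, norm_wave,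
      norm_wave, norm_mul c, Complex.norm_real, Real.norm_eq_abs, mul_one, mul_one]
    calc _ ≤ |2 * Real.pi * (total y).1| ^ 3 * (‖c‖ * |2 * Real.pi * (total y).1|) * ‖cubicProd F y‖ * |r| := by
          exact mul_le_mul (mul_le_mul_of_nonneg_right (mul_le_mul_of_nonneg_left
            (mul_le_mul_of_nonneg_left (hle _) (norm_nonneg _)) (by positivity)) (norm_nonneg _))
            (norm_timeIntegral_le _ _) (norm_nonneg _) (by positivity)
      _ = _ := by ring
  have hB : ∀ r y, ‖c * (total y).1 * (wave (x * (total y).1) * wave (r * (total y).2) * cubicProd F y)‖ ≤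
      ‖c‖ * (|2 * Real.pi * (total y).1| ^ 1 * ‖cubicProd F y‖) := by
    intro r y
    rw [norm_mul, norm_mul, norm_mul, norm_mul, norm_wave, norm_wave, Complex.norm_real,
      Real.norm_eq_abs, one_mul, one_mul, pow_one, mul_assoc]
    exact mul_le_mul_of_nonneg_left (mul_le_mul_of_nonneg_right (hle _) (norm_nonneg _)) (norm_nonneg _)
  have ia : Integrable fun y => (2 * Real.pi * Complex.I * (total y).1) ^ 3 * wave (x * (total y).1) *
      wave (t * (dispersion * (total y).1 ^ 3)) * (c * (total y).1) * cubicProd F y *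
        timeIntegral t (phaseDefect y) := by
    have := hmT t
    exact (i4.const_mul (‖c‖ * |t|)).mono' (by fun_prop) (Eventually.of_forall fun y => hA t y)
  have ib : Integrable fun y =>
      c * (total y).1 * (wave (x * (total y).1) * wave (t * (total y).2) * cubicProd F y) :=
    (i1.const_mul ‖c‖).mono' (by fun_prop) (Eventually.of_forall fun y => hB t y)
  have h := hasDerivAt_integral_of_dominated_loc_of_deriv_le (𝕜 := ℝ)
    (μ := (volume : Measure (((ℝ × ℝ) × (ℝ × ℝ)) × (ℝ × ℝ))))
    (F := fun (r : ℝ) y => wave (x * (total y).1) * wave (r * (dispersion * (total y).1 ^ 3)) *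
      (c * (total y).1) * cubicProd F y * timeIntegral r (phaseDefect y))
    (F' := fun (r : ℝ) y => -((2 * Real.pi * Complex.I * (total y).1) ^ 3 * wave (x * (total y).1) *
          wave (r * (dispersion * (total y).1 ^ 3)) * (c * (total y).1) * cubicProd F y *
            timeIntegral r (phaseDefect y)) +
        c * (total y).1 * (wave (x * (total y).1) * wave (r * (total y).2) * cubicProd F y)) (x₀ := t)
    (bound := fun y => ‖c‖ * (|t| + 1) * (|2 * Real.pi * (total y).1| ^ 4 * ‖cubicProd F y‖) +
      ‖c‖ * (|2 * Real.pi * (total y).1| ^ 1 * ‖cubicProd F y‖)) (Metric.ball_mem_nhds t one_pos)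
    (Eventually.of_forall fun r => by have := hmT r; fun_prop) ?_ (ia.neg.add ib).1 ?_
    ((i4.const_mul _).add (i1.const_mul _)) ?_
  · refine h.2.congr_deriv ?_
    rw [integral_add (f := fun y => -((2 * Real.pi * Complex.I * (total y).1) ^ 3 *
      wave (x * (total y).1) * wave (t * (dispersion * (total y).1 ^ 3)) * (c * (total y).1) *
        cubicProd F y * timeIntegral t (phaseDefect y))) ia.neg ib, integral_neg]
  · have := hmT t
    refine (i1.const_mul (‖c‖ * |t|)).mono' (by fun_prop) (Eventually.of_forall fun y => ?_)
    rw [norm_mul, norm_mul, norm_mul, norm_mul, norm_wave, norm_wave, norm_mul c, Complex.norm_real,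
      Real.norm_eq_abs, one_mul, one_mul, pow_one]
    calc _ ≤ ‖c‖ * |2 * Real.pi * (total y).1| * ‖cubicProd F y‖ * |t| := by
          exact mul_le_mul (mul_le_mul_of_nonneg_right (mul_le_mul_of_nonneg_left (hle _)
            (norm_nonneg _)) (norm_nonneg _)) (norm_timeIntegral_le _ _) (norm_nonneg _) (by positivity)
      _ = _ := by ring
  · refine Eventually.of_forall fun y r hr => ?_
    have hr1 : |r| ≤ |t| + 1 := by
      rw [Metric.mem_ball, Real.dist_eq] at hr
      have := abs_sub_abs_le_abs_sub r t
      linarith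
    refine (norm_add_le _ _).trans (add_le_add ?_ (hB r y))
    rw [norm_neg]
    refine (hA r y).trans ?_
    gcongr
  · filter_upwards [ae_phaseDefect_ne_zero] with y hy r _
    have d1 := (hasDerivAt_wave_mul (dispersion * (total y).1 ^ 3) r).const_mul (wave (x * (total y).1))
    have d2 := ((d1.mul_const (c * (total y).1)).mul_const (cubicProd F y)).mul (hasDerivAt_timeIntegral hy r)
    -- The dispersive phase and the derivative of the time integral recombine into the full phase of
    -- the product of the three waves.
    have e : wave (r * (total y).2) = wave (r * (dispersion * (total y).1 ^ 3)) * wave (r * phaseDefect y) := by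
      rw [← wave_add, phaseDefect]; ring_nf
    convert! d2 using 1
    rw [e]
    generalize wave (r * (dispersion * (total y).1 ^ 3)) = w
    unfold dispersion
    push_cast
    linear_combination (-8 * Real.pi ^ 3 * Complex.I * (total y).1 ^ 3 * wave (x * (total y).1) *
      w * (c * (total y).1) * cubicProd F y * timeIntegral r (phaseDefect y) : ℂ) * Complex.I_sq

/-- The equation, for the complex-valued space-time function. -/
theorem IsAmplitude.hasDerivWithinAt_evolution {T t : ℝ} (hσ : 0 < σ) (hs : 1 / 4 ≤ s) (hT : 0 < T)
    (hT1 : T ≤ 1) (ht : t ∈ Icc (-T) T) {μ : ℝ} {φ : ℝ → ℂ} (hφ : Measurable φ)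
    (hρ : MemLp (fun η => (gevreyWeight σ s η : ℂ) * φ η) 2) {r : ℝ≥0}
    (hF : IsAmplitude σ s T (-(μ / 3) * (2 * Real.pi * Complex.I)) φ r F) (x : ℝ) :
    HasDerivWithinAt (fun r => evolution F 0 r x)
      (-evolution F 3 t x - μ * evolution F 0 t x ^ 2 * evolution F 1 t x) (Icc (-T) T) t := by
  have hs0 : 0 ≤ s := by linarith
  have habs : ∀ r ∈ Icc (-T) T, |r| ≤ T := fun r hr => abs_le.2 hr
  have key : ∀ k, ∀ r ∈ Icc (-T) T, evolution F k r x =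
      (∫ η : ℝ, (2 * Real.pi * Complex.I * η) ^ k * wave (x * η) * wave (r * (dispersion * η ^ 3)) * φ η) +
      ∫ y, (2 * Real.pi * Complex.I * (total y).1) ^ k * wave (x * (total y).1) *
        wave (r * (dispersion * (total y).1 ^ 3)) *
        (-(μ / 3) * (2 * Real.pi * Complex.I) * (total y).1) * cubicProd F y *
          timeIntegral r (phaseDefect y) := fun k r hr =>
    hF.integral_eq hσ.le hs hT hT1 (habs r hr) hφ hρ
      (m := fun η => (2 * Real.pi * Complex.I * η) ^ k * wave (x * η)) (by fun_prop)
      (a := σ / 2) (K := k.factorial / (σ / 2) ^ k) (half_lt_self hσ) fun η => by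
        rw [norm_mul, norm_wave, mul_one, norm_pow, norm_two_pi_I_mul]
        exact pow_le_mul_exp (half_pos hσ) k _
  have d := (hasDerivAt_integral_free hσ hs0 hφ hρ t x).add
    (hasDerivAt_integral_duhamel hσ hs0 hF.measurable hF.memLp (-(μ / 3) * (2 * Real.pi * Complex.I)) t x)
  have hcub := integral_total_mul_cubicProd hσ hs0 hF.measurable hF.memLp t x
  have e : ∫ y, -(μ / 3) * (2 * Real.pi * Complex.I) * (total y).1 *
      (wave (x * (total y).1) * wave (t * (total y).2) * cubicProd F y) =
      -μ * evolution F 0 t x ^ 2 * evolution F 1 t x := by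
    have e1 : ∀ y, -(μ / 3) * (2 * Real.pi * Complex.I) * (total y).1 *
      (wave (x * (total y).1) * wave (t * (total y).2) * cubicProd F y) = (-(μ / 3) : ℂ) *
        (2 * Real.pi * Complex.I * (total y).1 *
          (wave (x * (total y).1) * wave (t * (total y).2) * cubicProd F y)) := fun y => by ring
    simp_rw [e1]
    rw [integral_const_mul, hcub]
    ring
  rw [e] at d
  have h0 : ∀ r ∈ Icc (-T) T, evolution F 0 r x =
      ((fun r => ∫ η : ℝ, wave (x * η) * wave (r * (dispersion * η ^ 3)) * φ η) + fun r =>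
        ∫ y, wave (x * (total y).1) * wave (r * (dispersion * (total y).1 ^ 3)) *
        (-(μ / 3) * (2 * Real.pi * Complex.I) * (total y).1) * cubicProd F y *
          timeIntegral r (phaseDefect y)) r := fun r hr => by
    rw [key 0 r hr]; simp only [pow_zero, one_mul, Pi.add_apply]
  have d2 := (d.hasDerivWithinAt (s := Icc (-T) T)).congr h0 (h0 t ht)
  convert! d2 using 1
  rw [key 3 t ht]
  ring

end

/-! ### Conjugation symmetry. -/

theorem isNegInvariant_prod {E E' : Type*} [MeasureSpace E] [MeasureSpace E'] [InvolutiveNeg E]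
    [InvolutiveNeg E'] [MeasurableNeg E] [MeasurableNeg E'] [SFinite (volume : Measure E)]
    [SFinite (volume : Measure E')] [(volume : Measure E).IsNegInvariant]
    [(volume : Measure E').IsNegInvariant] : (volume : Measure (E × E')).IsNegInvariant :=
  ⟨((Measure.measurePreserving_neg (volume : Measure E)).prod
    (Measure.measurePreserving_neg (volume : Measure E'))).map_eq⟩

/-- The conjugate reflection; on the Fourier side it corresponds to complex conjugation. -/
noncomputable def conjReflect (F : ℝ × ℝ → ℂ) (z : ℝ × ℝ) : ℂ := (starRingEnd ℂ) (F (-z))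

theorem measurable_conjReflect {F : ℝ × ℝ → ℂ} (hF : Measurable F) : Measurable (conjReflect F) :=
  (Complex.continuous_conj.measurable).comp (hF.comp measurable_neg)

theorem bourgainWeight_neg (κ σ s : ℝ) (z : ℝ × ℝ) :
    bourgainWeight κ σ s (-z) = bourgainWeight κ σ s z := by
  unfold bourgainWeight gevreyWeight modulation bracket
  have e : (-z).2 - κ * (-z).1 ^ 3 = -(z.2 - κ * z.1 ^ 3) := by
    rw [Prod.fst_neg, Prod.snd_neg]; ring
  rw [e, abs_neg, Prod.fst_neg, mul_neg, abs_neg]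

/-- The factor `z.1` from the derivative is odd under reflection, so the coefficient has to be
purely imaginary. -/
theorem duhamelTerm_conjReflect (T : ℝ) {c : ℂ} (hc : (starRingEnd ℂ) c = -c) (F : ℝ × ℝ → ℂ) :
    duhamelTerm T c (conjReflect F) = conjReflect (duhamelTerm T c F) := by
  funext z
  have h1 : (volume : Measure ((ℝ × ℝ) × (ℝ × ℝ))).IsNegInvariant := isNegInvariant_prod
  have h2 : (volume : Measure (ℝ × (ℝ × ℝ) × (ℝ × ℝ))).IsNegInvariant := isNegInvariant_prod
  unfold conjReflect duhamelTerm
  rw [← integral_conj, ← integral_neg_eq_self]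
  refine integral_congr_ae (Eventually.of_forall fun p => ?_)
  have e1 : -z.2 - dispersion * (-z.1) ^ 3 = -(z.2 - dispersion * z.1 ^ 3) := by ring
  have e3 : -((z.1, (-p).1) - (-p).2.1 - (-p).2.2 : ℝ × ℝ) = ((-z).1, p.1) - p.2.1 - p.2.2 := by
    ext <;> simp <;> ring
  simp only [duhamelIntegrand, map_mul, e3, hc, Complex.conj_ofReal]
  rw [← conj_duhamelKernel]
  simp only [Prod.fst_neg, Prod.snd_neg, neg_neg, e1, Complex.ofReal_neg]
  rw [show -(-p.1 - dispersion * z.1 ^ 3) = p.1 - dispersion * (-z.1) ^ 3 by ring]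
  ring

theorem freeTerm_conjReflect {φ : ℝ → ℂ} (hφ : ∀ᵐ η, (starRingEnd ℂ) (φ (-η)) = φ η) :
    conjReflect (freeTerm φ) =ᵐ[volume] freeTerm φ := by
  have h1 : ∀ᵐ z : ℝ × ℝ, (starRingEnd ℂ) (φ (-z.1)) = φ z.1 :=
    Measure.quasiMeasurePreserving_fst.ae hφ
  filter_upwards [h1] with z hz
  unfold conjReflect freeTerm
  rw [map_mul, Prod.fst_neg, Prod.snd_neg, hz, ← conj_cutoffHat (z.2 - dispersion * z.1 ^ 3)]
  ring_nf

theorem ae_neg {p : ℝ × ℝ → Prop} (h : ∀ᵐ z, p z) : ∀ᵐ z, p (-z) :=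
  (Measure.measurePreserving_neg (volume : Measure (ℝ × ℝ))).quasiMeasurePreserving.ae h

/-- For a real datum the reflected amplitude solves the same equation with the same bound.
Comparison with the original one by Lipschitz dependence shows that the solution is real. -/
theorem IsAmplitude.conjReflect {σ s T : ℝ} {c : ℂ} (hc : (starRingEnd ℂ) c = -c) {φ : ℝ → ℂ}
    (hφ : ∀ᵐ η, (starRingEnd ℂ) (φ (-η)) = φ η) {r : ℝ≥0} {F : ℝ × ℝ → ℂ}
    (hF : IsAmplitude σ s T c φ r F) : IsAmplitude σ s T c φ r (conjReflect F) where
  measurable := measurable_conjReflect hF.measurable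
  eLpNorm_le := by
    have hm := hF.measurable
    refine (le_of_eq ?_).trans hF.eLpNorm_le
    rw [← eLpNorm_comp_measurePreserving (g := fun z => (bourgainWeight dispersion σ s z : ℂ) * F z)
      (by fun_prop) (Measure.measurePreserving_neg (volume : Measure (ℝ × ℝ)))]
    refine eLpNorm_congr_norm_ae (Eventually.of_forall fun z => ?_)
    simp only [Function.comp_apply, norm_mul, MKdV.conjReflect, bourgainWeight_neg, RCLike.norm_conj]
  eq := by
    filter_upwards [ae_neg hF.eq, freeTerm_conjReflect hφ] with z h1 h2
    rw [duhamelTerm_conjReflect T hc, ← h2]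
    simp only [MKdV.conjReflect, h1, map_add]

/-! ### Time slices and the restricted Bourgain norm. -/

section Profile

variable {σ s : ℝ} {F F' : ℝ × ℝ → ℂ}

/-- The spatial Fourier transform at time `t` of the function with space-time Fourier transform `F`. -/
noncomputable def profile (F : ℝ × ℝ → ℂ) (t η : ℝ) : ℂ := ∫ θ, wave (t * θ) * F (η, θ)

theorem measurable_profile (hF : Measurable F) (t : ℝ) : Measurable (profile F t) := by
  have h : Measurable fun z : ℝ × ℝ => wave (t * z.2) * F z := by fun_prop
  exact h.stronglyMeasurable.integral_prod_right'.measurable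

theorem enorm_profile_le (F : ℝ × ℝ → ℂ) (t η : ℝ) : ‖profile F t η‖ₑ ≤ ∫⁻ θ, ‖F (η, θ)‖ₑ := by
  refine (enorm_integral_le_lintegral_enorm _).trans (le_of_eq (lintegral_congr fun θ => ?_))
  rw [← ofReal_norm, norm_mul, norm_wave, one_mul, ofReal_norm]

theorem enorm_gevreyWeight (σ s η : ℝ) :
    ‖(gevreyWeight σ s η : ℂ)‖ₑ = ENNReal.ofReal (gevreyWeight σ s η) := by
  rw [← ofReal_norm, Complex.norm_real, Real.norm_of_nonneg (gevreyWeight_pos _ _ _).le]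

theorem exists_eLpNorm_profile_le : ∃ C : ℝ≥0, ∀ σ s t : ℝ, ∀ F : ℝ × ℝ → ℂ, Measurable F →
    eLpNorm (fun η => (gevreyWeight σ s η : ℂ) * profile F t η) 2 ≤
      C * eLpNorm (fun z => (bourgainWeight dispersion σ s z : ℂ) * F z) 2 := by
  obtain ⟨C, hC⟩ := exists_sq_lintegral_time_le
  refine ⟨NNReal.sqrt C, fun σ s t F hF => ?_⟩
  refine (ENNReal.pow_le_pow_left_iff two_ne_zero).1 ?_
  rw [mul_pow, ← ENNReal.coe_pow, NNReal.sq_sqrt, ← lintegral_weight_mul_enorm_sq, eLpNorm_two_sq]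
  refine le_trans (lintegral_mono fun η => ?_) (hC σ s (fun z => ‖F z‖ₑ) hF.enorm)
  rw [enorm_mul, enorm_gevreyWeight]
  exact pow_le_pow_left' (mul_le_mul' le_rfl (enorm_profile_le F t η)) 2

theorem memLp_profile (hF : Measurable F)
    (h2 : MemLp (fun z => (bourgainWeight dispersion σ s z : ℂ) * F z) 2) (t : ℝ) :
    MemLp (fun η => (gevreyWeight σ s η : ℂ) * profile F t η) 2 := by
  obtain ⟨C, hC⟩ := exists_eLpNorm_profile_le
  have := measurable_profile hF t
  exact ⟨by fun_prop, (hC σ s t F hF).trans_lt (ENNReal.mul_lt_top ENNReal.coe_lt_top h2.2)⟩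

theorem fourierInv_derivSymbol_profile (hσ : 0 < σ) (hs : 0 ≤ s) (hF : Measurable F)
    (h2 : MemLp (fun z => (bourgainWeight dispersion σ s z : ℂ) * F z) 2) (k : ℕ) (t x : ℝ) :
    𝓕⁻ (derivSymbol k (profile F t)) x = evolution F k t x := by
  have hi := integrable_pow_mul hσ hs hF h2 k x t
  unfold evolution
  rw [fourierInv_eq_integral_wave, Measure.volume_eq_prod, integral_prod _ hi]
  refine integral_congr_ae (Eventually.of_forall fun η => ?_)
  simp only [derivSymbol, profile]
  rw [← integral_const_mul, ← integral_const_mul]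
  refine integral_congr_ae (Eventually.of_forall fun θ => ?_)
  simp only
  ring

theorem fourierInv_profile (hσ : 0 < σ) (hs : 0 ≤ s) (hF : Measurable F)
    (h2 : MemLp (fun z => (bourgainWeight dispersion σ s z : ℂ) * F z) 2) (t x : ℝ) :
    𝓕⁻ (profile F t) x = evolution F 0 t x := by
  rw [← fourierInv_derivSymbol_profile hσ hs hF h2, derivSymbol_zero]

theorem integrable_of_memLp_bourgainWeight (hσ : 0 < σ) (hs : 0 ≤ s) (hF : Measurable F)
    (h2 : MemLp (fun z => (bourgainWeight dispersion σ s z : ℂ) * F z) 2) : Integrable F := by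
  simpa [wave_zero] using integrable_pow_mul hσ hs hF h2 0 0 0

theorem integrable_slice (hF : Integrable F) : ∀ᵐ η, Integrable fun θ => F (η, θ) := by
  rw [Measure.volume_eq_prod] at hF
  exact hF.prod_right_ae

theorem profile_sub (hF : Integrable F) (hF' : Integrable F') (t : ℝ) :
    (profile fun z => F z - F' z) t =ᵐ[volume] fun η => profile F t η - profile F' t η := by
  filter_upwards [integrable_slice hF, integrable_slice hF'] with η h h'
  unfold profile
  rw [← integral_sub (integrable_wave_mul h t) (integrable_wave_mul h' t)]
  refine integral_congr_ae (Eventually.of_forall fun θ => ?_)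
  simp only
  ring

theorem continuous_profile {η : ℝ} (h : Integrable fun θ => F (η, θ)) :
    Continuous fun t => profile F t η := by
  refine continuous_of_dominated (bound := fun θ => ‖F (η, θ)‖)
    (fun t => (integrable_wave_mul h t).1) (fun t => Eventually.of_forall fun θ => ?_) h.norm
    (Eventually.of_forall fun θ => by fun_prop)
  rw [norm_mul, norm_wave, one_mul]

/-- Dominated convergence in the space frequency: each slice is continuous in time, and the
majorant, four times the square of the weighted L¹ norm in time frequency, is integrable. -/
theorem tendsto_eLpNorm_profile_sub (hσ : 0 < σ) (hs : 0 ≤ s) (hF : Measurable F)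
    (h2 : MemLp (fun z => (bourgainWeight dispersion σ s z : ℂ) * F z) 2) (t : ℝ) :
    Tendsto (fun r => eLpNorm (fun η => (gevreyWeight σ s η : ℂ) * (profile F r η - profile F t η)) 2)
      (𝓝 t) (𝓝 0) := by
  obtain ⟨C, hC⟩ := exists_sq_lintegral_time_le
  have hi := integrable_of_memLp_bourgainWeight hσ hs hF h2
  have hB := (hC σ s (fun z => ‖F z‖ₑ) hF.enorm).trans_lt (ENNReal.mul_lt_top ENNReal.coe_lt_top
    (by rw [lintegral_weight_mul_enorm_sq]; exact ENNReal.pow_lt_top h2.2))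
  have hbm : Measurable fun η => ∫⁻ θ, ‖F (η, θ)‖ₑ := hF.enorm.lintegral_prod_right'
  have hpm := measurable_profile hF
  have hsq : Tendsto (fun r => ∫⁻ η, ‖(gevreyWeight σ s η : ℂ) * (profile F r η - profile F t η)‖ₑ ^ 2)
      (𝓝 t) (𝓝 0) := by
    have h := tendsto_lintegral_filter_of_dominated_convergence (μ := (volume : Measure ℝ)) (l := 𝓝 t)
      (F := fun r η => ‖(gevreyWeight σ s η : ℂ) * (profile F r η - profile F t η)‖ₑ ^ 2)
      (f := fun _ => 0)
      (fun η => 4 * (ENNReal.ofReal (gevreyWeight σ s η) * ∫⁻ θ, ‖F (η, θ)‖ₑ) ^ 2)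
      (Eventually.of_forall fun r => by
        have := hpm r; have := hpm t; fun_prop)
      (Eventually.of_forall fun r => Eventually.of_forall fun η => ?_) ?_ ?_
    · simpa using h
    · rw [enorm_mul, enorm_gevreyWeight, show (4 : ℝ≥0∞) = 2 ^ 2 by norm_num, ← mul_pow]
      refine pow_le_pow_left' ?_ 2
      rw [mul_left_comm]
      refine mul_le_mul' le_rfl ((enorm_sub_le).trans ?_)
      rw [two_mul]
      exact add_le_add (enorm_profile_le F r η) (enorm_profile_le F t η)
    · rw [lintegral_const_mul' _ _ (by norm_num)]
      exact (ENNReal.mul_lt_top (by norm_num) hB).ne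
    · filter_upwards [integrable_slice hi] with η hη
      have hc := continuous_profile hη
      have h3 : Continuous fun r =>
          ‖(gevreyWeight σ s η : ℂ) * (profile F r η - profile F t η)‖ₑ ^ 2 :=
        (ENNReal.continuous_pow 2).comp (continuous_const.mul (hc.sub continuous_const)).enorm
      simpa using h3.tendsto t
  have h4 := hsq.ennrpow_const (1 / 2 : ℝ)
  rw [ENNReal.zero_rpow_of_pos (by norm_num)] at h4
  refine h4.congr fun r => ?_
  rw [← eLpNorm_two_sq, ← ENNReal.rpow_natCast, ← ENNReal.rpow_mul]
  norm_num

end Profile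

theorem one_le_bourgainWeight {σ s : ℝ} (hσ : 0 ≤ σ) (hs : 0 ≤ s) (z : ℝ × ℝ) :
    1 ≤ bourgainWeight dispersion σ s z :=
  one_le_mul_of_one_le_of_one_le (one_le_gevreyWeight hσ hs _)
    (Real.one_le_rpow (one_le_modulation _ _) (by norm_num))

/-- The coordinates of a point of the space-time plane. -/
def planeCoord (z : Plane) : ℝ × ℝ := (z 0, z 1)

theorem measurePreserving_planeCoord : MeasurePreserving planeCoord :=
  (volume_preserving_finTwoArrow ℝ).comp (PiLp.volume_preserving_ofLp (Fin 2))

section Plane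

variable {σ s : ℝ} {F F' : ℝ × ℝ → ℂ}

theorem memLp_of_memLp_bourgainWeight (hσ : 0 ≤ σ) (hs : 0 ≤ s) (hF : Measurable F)
    (h2 : MemLp (fun z => (bourgainWeight dispersion σ s z : ℂ) * F z) 2) :
    MemLp F 2 (volume : Measure (ℝ × ℝ)) := by
  refine h2.mono hF.aestronglyMeasurable (Eventually.of_forall fun z => ?_)
  rw [norm_mul, Complex.norm_real, Real.norm_of_nonneg (bourgainWeight_pos _ _ _ _).le]
  exact le_mul_of_one_le_left (norm_nonneg _) (one_le_bourgainWeight hσ hs z)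

theorem fourierInv_comp_planeCoord (hF : Measurable F) (z : Plane) :
    𝓕⁻ (fun ζ : Plane => F (planeCoord ζ)) z = evolution F 0 (z 1) (z 0) := by
  rw [Real.fourierInv_eq', evolution]
  have hm : Measurable fun p : ℝ × ℝ => (2 * Real.pi * Complex.I * p.1) ^ 0 * wave (z 0 * p.1) *
    wave (z 1 * p.2) * F p := by fun_prop
  have hp := measurePreserving_planeCoord
  rw [← hp.map_eq, integral_map hp.measurable.aemeasurable hm.aestronglyMeasurable]
  refine integral_congr_ae (Eventually.of_forall fun ζ => ?_)
  simp only [pow_zero, one_mul, planeCoord, smul_eq_mul]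
  rw [← wave_add]
  congr 1
  unfold wave
  rw [PiLp.inner_apply, Fin.sum_univ_two]
  simp only [RCLike.inner_apply, conj_trivial]

/-- In the frequencies divided by 2π the modulation is 2π times the one defined with `dispersion`;
the constant 7 bounds 2π. -/
theorem planeWeight_le (σ s : ℝ) (ζ : Plane) :
    Real.exp (σ * |2 * Real.pi * ζ 0|) * bracket (2 * Real.pi * ζ 0) ^ s *
        bracket (2 * Real.pi * ζ 1 - (2 * Real.pi * ζ 0) ^ 3) ^ (9 / 16 : ℝ) ≤
      7 * bourgainWeight dispersion σ s (planeCoord ζ) := by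
  have hw := gevreyWeight_pos σ s (ζ 0)
  have hm : 0 < bracket (ζ 1 - dispersion * ζ 0 ^ 3) := bracket_pos _
  have e : 2 * Real.pi * ζ 1 - (2 * Real.pi * ζ 0) ^ 3 =
      2 * Real.pi * (ζ 1 - dispersion * ζ 0 ^ 3) := by unfold dispersion; ring
  have h1 : bracket (2 * Real.pi * ζ 1 - (2 * Real.pi * ζ 0) ^ 3) ^ (9 / 16 : ℝ) ≤
      7 * bracket (ζ 1 - dispersion * ζ 0 ^ 3) ^ (9 / 16 : ℝ) := by
    rw [e]
    calc _ ≤ (7 * bracket (ζ 1 - dispersion * ζ 0 ^ 3)) ^ (9 / 16 : ℝ) :=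
          Real.rpow_le_rpow (bracket_pos _).le (bracket_two_pi_mul_le _) (by norm_num)
      _ = 7 ^ (9 / 16 : ℝ) * bracket (ζ 1 - dispersion * ζ 0 ^ 3) ^ (9 / 16 : ℝ) :=
          Real.mul_rpow (by norm_num) hm.le
      _ ≤ _ := by
          refine mul_le_mul_of_nonneg_right ?_ (Real.rpow_nonneg hm.le _)
          calc (7 : ℝ) ^ (9 / 16 : ℝ) ≤ 7 ^ (1 : ℝ) :=
                Real.rpow_le_rpow_of_exponent_le (by norm_num) (by norm_num)
            _ = 7 := Real.rpow_one _
  refine (mul_le_mul_of_nonneg_left h1 hw.le).trans (le_of_eq ?_)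
  simp only [bourgainWeight, modulation, planeCoord]
  ring

/-- The restricted norm is controlled by the weighted norm of the space-time Fourier transform of any
extension. -/
theorem restrictedENorm_le (hσ : 0 < σ) (hs : 0 ≤ s) (hF : Measurable F)
    (h2 : MemLp (fun z => (bourgainWeight dispersion σ s z : ℂ) * F z) 2) {T : ℝ} {u : ℝ → ℝ → ℝ}
    (hu : ∀ t ∈ Ioo (-T) T, ∀ x, (u t x : ℂ) = evolution F 0 t x) :
    restrictedENorm σ s (9 / 16) T u ≤
      7 * eLpNorm (fun z => (bourgainWeight dispersion σ s z : ℂ) * F z) 2 := by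
  have hp := measurePreserving_planeCoord
  have h1 : Integrable fun ζ : Plane => F (planeCoord ζ) :=
    hp.integrable_comp_of_integrable (integrable_of_memLp_bourgainWeight hσ hs hF h2)
  have hL : MemLp (fun ζ : Plane => F (planeCoord ζ)) 2 (volume : Measure Plane) :=
    (memLp_of_memLp_bourgainWeight hσ.le hs hF h2).comp_measurePreserving hp
  unfold restrictedENorm
  -- The extension chosen is the inverse transform of `F` itself, which is defined at all times.
  refine (iInf₂_le (𝓕⁻ (hL.toLp fun ζ : Plane => F (planeCoord ζ))) ?_).trans ?_
  · filter_upwards [fourierInv_toLp_ae_eq h1 hL] with z hz hzt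
    rw [hz, fourierInv_comp_planeCoord hF, hu _ hzt]
  · unfold bourgainENorm
    rw [FourierTransform.fourier_fourierInv_eq,
      ← eLpNorm_comp_measurePreserving (g := fun z => (bourgainWeight dispersion σ s z : ℂ) * F z)
        h2.1 hp]
    have h7 := eLpNorm_le_nnreal_smul_eLpNorm_of_ae_le_mul (c := 7) (p := 2)
      (f := fun ζ : Plane => ((Real.exp (σ * |2 * Real.pi * ζ 0|) * bracket (2 * Real.pi * ζ 0) ^ s *
        bracket (2 * Real.pi * ζ 1 - (2 * Real.pi * ζ 0) ^ 3) ^ (9 / 16 : ℝ) : ℝ) : ℂ) *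
        (hL.toLp fun ζ : Plane => F (planeCoord ζ)) ζ)
      (g := (fun z => (bourgainWeight dispersion σ s z : ℂ) * F z) ∘ planeCoord)
      (μ := (volume : Measure Plane)) ?_
    · exact h7
    · filter_upwards [hL.coeFn_toLp] with ζ hζ
      have hb1 := bracket_pos (2 * Real.pi * ζ 0)
      have hb2 := bracket_pos (2 * Real.pi * ζ 1 - (2 * Real.pi * ζ 0) ^ 3)
      rw [hζ, ← NNReal.coe_le_coe]
      simp only [Function.comp_apply, NNReal.coe_mul, coe_nnnorm, norm_mul, Complex.norm_real]
      rw [← norm_mul, ← norm_mul, Real.norm_of_nonneg (by positivity),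
        Real.norm_of_nonneg (bourgainWeight_pos _ _ _ _).le, ← mul_assoc]
      exact mul_le_mul_of_nonneg_right (planeWeight_le σ s ζ) (norm_nonneg _)

theorem evolution_sub (hσ : 0 < σ) (hs : 0 ≤ s) (hF : Measurable F) (hF' : Measurable F')
    (h2 : MemLp (fun z => (bourgainWeight dispersion σ s z : ℂ) * F z) 2)
    (h2' : MemLp (fun z => (bourgainWeight dispersion σ s z : ℂ) * F' z) 2) (k : ℕ) (t x : ℝ) :
    evolution (fun z => F z - F' z) k t x = evolution F k t x - evolution F' k t x := by
  unfold evolution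
  rw [← integral_sub (integrable_pow_mul hσ hs hF h2 k x t) (integrable_pow_mul hσ hs hF' h2' k x t)]
  simp only [mul_sub]

end Plane

/-! ### The real solution attached to an amplitude. -/

section Solution

variable {σ s : ℝ} {F F' : ℝ × ℝ → ℂ}

/-- The real space-time function with Fourier transform `F`. -/
noncomputable def solution (F : ℝ × ℝ → ℂ) (t x : ℝ) : ℝ := (evolution F 0 t x).re

/-- `F` is the space-time Fourier transform of a real function of Gevrey-Bourgain class. -/
structure IsRealSymbol (σ s : ℝ) (F : ℝ × ℝ → ℂ) : Prop where
  measurable : Measurable F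
  memLp : MemLp (fun z => (bourgainWeight dispersion σ s z : ℂ) * F z) 2
  conjReflect : conjReflect F =ᵐ[volume] F

/-- Conjugation followed by z ↦ -z leaves the integral unchanged, so the evolution is real and
taking real parts loses nothing. -/
theorem IsRealSymbol.ofReal_solution (h : IsRealSymbol σ s F) (t x : ℝ) :
    (solution F t x : ℂ) = evolution F 0 t x := by
  refine Complex.conj_eq_iff_re.1 ?_
  unfold evolution
  rw [← integral_conj, ← integral_neg_eq_self]
  refine integral_congr_ae ?_
  filter_upwards [h.conjReflect] with z hz
  rw [← hz]
  simp only [pow_zero, one_mul, map_mul, conj_wave, Prod.fst_neg, Prod.snd_neg, mul_neg, neg_neg,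
    MKdV.conjReflect]

theorem IsRealSymbol.solution_eq_fourierInv (h : IsRealSymbol σ s F) (hσ : 0 < σ) (hs : 0 ≤ s) (t x : ℝ) :
    (solution F t x : ℂ) = 𝓕⁻ (profile F t) x := by
  rw [h.ofReal_solution, fourierInv_profile hσ hs h.measurable h.memLp]

theorem IsRealSymbol.symbol_solution (h : IsRealSymbol σ s F) (hσ : 0 < σ) (hs : 0 ≤ s) (t : ℝ) :
    MemLp (fun x => (solution F t x : ℂ)) 2 (volume : Measure ℝ) ∧
      symbol (solution F t) =ᵐ[volume] profile F t := by
  have hm := measurable_profile h.measurable t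
  have h2 := memLp_profile h.measurable h.memLp t
  exact symbol_ae_eq (integrable_of_memLp_gevreyWeight hσ hs hm h2)
    (memLp_of_memLp_gevreyWeight hσ.le hs hm h2)
    (Eventually.of_forall (h.solution_eq_fourierInv hσ hs t))

theorem IsRealSymbol.memGevrey (h : IsRealSymbol σ s F) (hσ : 0 < σ) (hs : 0 ≤ s) (t : ℝ) :
    MemGevrey σ s (solution F t) := by
  unfold MemGevrey
  rw [gevreyENorm_of_ae_eq_fourierInv hσ hs (measurable_profile h.measurable t)
    (memLp_profile h.measurable h.memLp t) (Eventually.of_forall (h.solution_eq_fourierInv hσ hs t))]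
  exact (memLp_profile h.measurable h.memLp t).2

theorem IsRealSymbol.gevreyENorm_sub (h : IsRealSymbol σ s F) (h' : IsRealSymbol σ s F') (hσ : 0 < σ)
    (hs : 0 ≤ s) (r t : ℝ) : gevreyENorm σ s (solution F r - solution F' t) =
      eLpNorm (fun η => (gevreyWeight σ s η : ℂ) * (profile F r η - profile F' t η)) 2 := by
  rw [gevreyENorm_sub_eq (h.memGevrey hσ hs r) (h'.memGevrey hσ hs t)]
  refine eLpNorm_congr_ae ?_
  filter_upwards [(h.symbol_solution hσ hs r).2, (h'.symbol_solution hσ hs t).2] with η h1 h2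
  rw [h1, h2]

theorem exists_gevreyENorm_solution_sub_le : ∃ C : ℝ≥0, ∀ σ s : ℝ, 0 < σ → 0 ≤ s →
    ∀ F F' : ℝ × ℝ → ℂ, IsRealSymbol σ s F → IsRealSymbol σ s F' → ∀ t,
      gevreyENorm σ s (solution F t - solution F' t) ≤
        C * eLpNorm (fun z => (bourgainWeight dispersion σ s z : ℂ) * (F z - F' z)) 2 := by
  obtain ⟨C, hC⟩ := exists_eLpNorm_profile_le
  refine ⟨C, fun σ s hσ hs F F' h h' t => ?_⟩
  rw [h.gevreyENorm_sub h' hσ hs]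
  refine (le_of_eq ?_).trans (hC σ s t (fun z => F z - F' z) (h.measurable.sub h'.measurable))
  refine eLpNorm_congr_ae ?_
  filter_upwards [profile_sub (integrable_of_memLp_bourgainWeight hσ hs h.measurable h.memLp)
    (integrable_of_memLp_bourgainWeight hσ hs h'.measurable h'.memLp) t] with η hη
  rw [hη]

theorem IsRealSymbol.restrictedENorm_sub_le (h : IsRealSymbol σ s F) (h' : IsRealSymbol σ s F')
    (hσ : 0 < σ) (hs : 0 ≤ s) (T : ℝ) :
    restrictedENorm σ s (9 / 16) T (solution F - solution F') ≤
      7 * eLpNorm (fun z => (bourgainWeight dispersion σ s z : ℂ) * (F z - F' z)) 2 := by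
  refine restrictedENorm_le (F := fun z => F z - F' z) hσ hs (h.measurable.sub h'.measurable) ?_ fun t _ x => ?_
  · simp only [mul_sub]; exact h.memLp.sub h'.memLp
  · rw [evolution_sub hσ hs h.measurable h'.measurable h.memLp h'.memLp, ← h.ofReal_solution,
      ← h'.ofReal_solution, ← Complex.ofReal_sub]
    rfl

theorem IsRealSymbol.memRestricted (h : IsRealSymbol σ s F) (hσ : 0 < σ) (hs : 0 ≤ s) (T : ℝ) :
    MemRestricted σ s (9 / 16) T (solution F) :=
  (restrictedENorm_le hσ hs h.measurable h.memLp fun t _ => h.ofReal_solution t).trans_lt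
    (ENNReal.mul_lt_top (by norm_num) h.memLp.2)

theorem IsRealSymbol.continuousInGevrey (h : IsRealSymbol σ s F) (hσ : 0 < σ) (hs : 0 ≤ s) (T : ℝ) :
    ContinuousInGevrey σ s T (solution F) := by
  refine ⟨fun t _ => h.memGevrey hσ hs t, fun t _ => ?_⟩
  simp only [h.gevreyENorm_sub h hσ hs]
  exact (tendsto_eLpNorm_profile_sub hσ hs h.measurable h.memLp t).mono_left nhdsWithin_le_nhds

theorem IsRealSymbol.integrable_exp_mul_profile (h : IsRealSymbol σ s F) (hs : 0 ≤ s) (t : ℝ)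
    {a : ℝ} (ha : a < σ) :
    Integrable fun η => (Real.exp (a * |2 * Real.pi * η|) : ℂ) * profile F t η :=
  integrable_exp_mul_of_memLp ha hs (measurable_profile h.measurable t)
    (memLp_profile h.measurable h.memLp t)

theorem IsRealSymbol.extendsToStrip (h : IsRealSymbol σ s F) (hσ : 0 < σ) (hs : 0 ≤ s) (t : ℝ) :
    ExtendsToStrip σ (solution F t) :=
  extendsToStrip_of_eq_fourierInv (measurable_profile h.measurable t)
    (fun _ ha => h.integrable_exp_mul_profile hs t ha) (h.solution_eq_fourierInv hσ hs t)

theorem IsRealSymbol.iteratedDeriv_solution (h : IsRealSymbol σ s F) (hσ : 0 < σ) (hs : 0 ≤ s) (k : ℕ)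
    (t x : ℝ) : ((iteratedDeriv k (solution F t) x : ℝ) : ℂ) = evolution F k t x := by
  rw [(iteratedDeriv_eq_fourierInv (half_pos hσ) (measurable_profile h.measurable t)
    (h.integrable_exp_mul_profile hs t (half_lt_self hσ)) (h.solution_eq_fourierInv hσ hs t) k).1 x,
    fourierInv_derivSymbol_profile hσ hs h.measurable h.memLp]

theorem timeIntegral_zero (y : ℝ) : timeIntegral 0 y = 0 := by
  have := norm_timeIntegral_le 0 y
  rw [abs_zero] at this
  exact norm_le_zero_iff.1 this

/-- At t = 0 the time integral vanishes, so only the datum is left in the integral equation. -/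
theorem IsAmplitude.evolution_zero {T : ℝ} (hσ : 0 < σ) (hs : 1 / 4 ≤ s) (hT : 0 < T) (hT1 : T ≤ 1)
    {c : ℂ} {φ : ℝ → ℂ} (hφ : Measurable φ)
    (hρ : MemLp (fun η => (gevreyWeight σ s η : ℂ) * φ η) 2) {r : ℝ≥0}
    (hF : IsAmplitude σ s T c φ r F) (x : ℝ) : evolution F 0 0 x = 𝓕⁻ φ x := by
  have h := hF.integral_eq hσ.le hs hT hT1 (t := 0) (by simpa using hT.le) hφ hρ
    (m := fun η => wave (x * η)) (by fun_prop) (a := 0) (K := 1) hσ fun η => by simp [norm_wave]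
  unfold evolution
  rw [fourierInv_eq_integral_wave]
  simpa [timeIntegral_zero, wave_zero] using h

theorem IsAmplitude.solvesIVP {T : ℝ} (hσ : 0 < σ) (hs : 1 / 4 ≤ s) (hT : 0 < T) (hT1 : T ≤ 1)
    {μ : ℝ} {u₀ : ℝ → ℝ} (hu₀ : MemGevrey σ s u₀) {r : ℝ≥0}
    (hF : IsAmplitude σ s T (-(μ / 3) * (2 * Real.pi * Complex.I)) (symbol u₀) r F)
    (h : IsRealSymbol σ s F) : SolvesIVP μ T u₀ (solution F) where
  contDiff t _ := contDiff_of_eq_fourierInv (half_pos hσ) (measurable_profile h.measurable t)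
    (h.integrable_exp_mul_profile (by linarith) t (half_lt_self hσ))
    (h.solution_eq_fourierInv hσ (by linarith) t) 3
  equation t ht x := by
    have hs0 : 0 ≤ s := by linarith
    have hd := hF.hasDerivWithinAt_evolution hσ hs hT hT1 ht (measurable_symbol u₀) hu₀.memLp_symbol x
    have hre := Complex.reCLM.hasFDerivAt.comp_hasDerivWithinAt t hd
    refine ⟨_, hre, ?_⟩
    have e : -evolution F 3 t x - μ * evolution F 0 t x ^ 2 * evolution F 1 t x =
        ((-iteratedDeriv 3 (solution F t) x - μ * solution F t x ^ 2 * deriv (solution F t) x : ℝ) : ℂ) := by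
      rw [← iteratedDeriv_one]
      push_cast
      rw [h.iteratedDeriv_solution hσ hs0, h.iteratedDeriv_solution hσ hs0, h.ofReal_solution]
    rw [e]
    simp only [Complex.reCLM_apply, Complex.ofReal_re]
    ring
  initial := by
    filter_upwards [hu₀.ae_eq_fourierInv hσ (by linarith)] with x hx
    refine Complex.ofReal_injective ?_
    rw [hx, h.ofReal_solution, hF.evolution_zero hσ hs hT hT1 (measurable_symbol u₀) hu₀.memLp_symbol]

theorem IsAmplitude.isSolution {T : ℝ} (hσ : 0 < σ) (hs : 1 / 4 ≤ s) (hT : 0 < T) (hT1 : T ≤ 1)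
    {μ : ℝ} {u₀ : ℝ → ℝ} (hu₀ : MemGevrey σ s u₀) {r : ℝ≥0}
    (hF : IsAmplitude σ s T (-(μ / 3) * (2 * Real.pi * Complex.I)) (symbol u₀) r F)
    (h : IsRealSymbol σ s F) : IsSolution μ σ s (9 / 16) T u₀ (solution F) where
  solves := hF.solvesIVP hσ hs hT hT1 hu₀ h
  continuous := h.continuousInGevrey hσ (by linarith) T
  bourgain := h.memRestricted hσ (by linarith) T

end Solution

/-! ### Conclusion. -/

theorem restrictedENorm_congr {σ s b T : ℝ} {u v : ℝ → ℝ → ℝ} (h : EqOn u v (Ioo (-T) T)) :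
    restrictedENorm σ s b T u = restrictedENorm σ s b T v := by
  unfold restrictedENorm
  refine iInf_congr fun w => iInf_congr_Prop ?_ fun _ => rfl
  refine eventually_congr (Eventually.of_forall fun z => ?_)
  refine forall_congr' fun hz => ?_
  rw [h hz]

theorem conj_nonlinearityCoeff (μ : ℝ) : (starRingEnd ℂ) (-(μ / 3) * (2 * Real.pi * Complex.I)) =
    -(-(μ / 3) * (2 * Real.pi * Complex.I)) := by
  simp only [map_mul, map_neg, map_div₀, Complex.conj_ofReal, Complex.conj_I, map_ofNat]
  ring

theorem norm_nonlinearityCoeff_le {μ : ℝ} (hμ : μ = 1 ∨ μ = -1) :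
    ‖(-(μ / 3) * (2 * Real.pi * Complex.I) : ℂ)‖ ≤ 3 := by
  have h1 : |μ| = 1 := by rcases hμ with rfl | rfl <;> simp
  simp only [norm_mul, norm_neg, norm_div, Complex.norm_real, Real.norm_eq_abs, h1, Complex.norm_I,
    Complex.norm_ofNat, abs_of_pos Real.pi_pos]
  linarith [Real.pi_lt_four]

/-- Local solvability on the Fourier side for real data, with Lipschitz dependence on the datum. -/
theorem exists_real_amplitude : ∃ A : ℝ≥0, ∃ T₀ : ℝ≥0 → ℝ, (∀ R, 0 < T₀ R ∧ T₀ R ≤ 1) ∧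
    ∀ σ s μ : ℝ, 0 < σ → 1 / 4 ≤ s → (μ = 1 ∨ μ = -1) → ∀ R : ℝ≥0, ∀ u₀ : ℝ → ℝ, MemGevrey σ s u₀ →
      gevreyENorm σ s u₀ ≤ R → ∃ F, IsSolution μ σ s (9 / 16) (T₀ R) u₀ (solution F) ∧
        IsRealSymbol σ s F ∧ ∀ v₀ : ℝ → ℝ, MemGevrey σ s v₀ → gevreyENorm σ s v₀ ≤ R →
          ∃ F', IsSolution μ σ s (9 / 16) (T₀ R) v₀ (solution F') ∧ IsRealSymbol σ s F' ∧
            eLpNorm (fun z => (bourgainWeight dispersion σ s z : ℂ) * (F z - F' z)) 2 ≤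
              A * gevreyENorm σ s (u₀ - v₀) := by
  obtain ⟨A, T₀, hT₀, hA⟩ := exists_amplitude
  refine ⟨2 * A, T₀, hT₀, fun σ s μ hσ hs hμ R u₀ hu₀ huR => ?_⟩
  have hs0 : 0 ≤ s := by linarith
  obtain ⟨hex, hlip⟩ := hA σ s hσ.le hs R _ (norm_nonlinearityCoeff_le hμ)
  have key : ∀ v₀ : ℝ → ℝ, MemGevrey σ s v₀ → gevreyENorm σ s v₀ ≤ R → ∃ F,
      IsAmplitude σ s (T₀ R) (-(μ / 3) * (2 * Real.pi * Complex.I)) (symbol v₀) (2 * A * R) F ∧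
        IsRealSymbol σ s F := fun v₀ hv₀ hvR => by
    obtain ⟨F, hF⟩ := hex (symbol v₀) (measurable_symbol v₀) (by rwa [← gevreyENorm_eq hv₀.memLp])
    -- The reflected amplitude has the same datum and lies in the same ball, so Lipschitz dependence
    -- with zero right side identifies the two almost everywhere.
    have hF' := hF.conjReflect (conj_nonlinearityCoeff μ) (hv₀.conj_symbol hσ hs0)
    have h := hlip _ _ (measurable_symbol v₀) (measurable_symbol v₀) _ _ hF' hF
    have hm := hF.measurable
    have hm' := hF'.measurable
    simp only [sub_self, mul_zero, eLpNorm_zero', nonpos_iff_eq_zero] at h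
    rw [eLpNorm_eq_zero_iff (by fun_prop) (by norm_num)] at h
    refine ⟨F, hF, hF.measurable, hF.memLp, ?_⟩
    filter_upwards [h] with z hz
    have hW : (bourgainWeight dispersion σ s z : ℂ) ≠ 0 :=
      Complex.ofReal_ne_zero.2 (bourgainWeight_pos _ _ _ _).ne'
    exact sub_eq_zero.1 ((mul_eq_zero.1 hz).resolve_left hW)
  obtain ⟨F, hF, hFr⟩ := key u₀ hu₀ huR
  refine ⟨F, hF.isSolution hσ hs (hT₀ R).1 (hT₀ R).2 hu₀ hFr, hFr, fun v₀ hv₀ hvR => ?_⟩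
  obtain ⟨F', hF', hFr'⟩ := key v₀ hv₀ hvR
  refine ⟨F', hF'.isSolution hσ hs (hT₀ R).1 (hT₀ R).2 hv₀ hFr', hFr', ?_⟩
  rw [gevreyENorm_sub_eq hu₀ hv₀, ENNReal.coe_mul]
  exact hlip _ _ (measurable_symbol u₀) (measurable_symbol v₀) _ _ hF hF'

theorem IsSolution.eqOn {μ σ s b T : ℝ} (hμ : μ = 1 ∨ μ = -1) (hσ : 0 < σ) (hs : 0 ≤ s) (hT : 0 < T)
    {u₀ : ℝ → ℝ} {u v : ℝ → ℝ → ℝ} (hu : IsSolution μ σ s b T u₀ u) (hv : IsSolution μ σ s b T u₀ v) :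
    EqOn u v (Icc (-T) T) :=
  hu.solves.unique hμ hσ hs hT hv.solves hu.continuous hv.continuous

end MKdV

theorem mainTheorem1 :
    ∃ b : ℝ, 1 / 2 < b ∧ b < 1 ∧ ∀ s : ℝ, 1 / 4 ≤ s →
      ∃ T₀ : ℝ≥0 → ℝ, (∀ R, 0 < T₀ R) ∧
        ∀ μ : ℝ, μ = 1 ∨ μ = -1 → ∀ σ : ℝ, 0 < σ →
          ∀ u₀ : ℝ → ℝ, MKdV.MemGevrey σ s u₀ →
            ∀ T : ℝ, T = T₀ (MKdV.gevreyENorm σ s u₀).toNNReal →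
            -- existence, uniqueness, persistence of the radius of analyticity
            (∃ u : ℝ → ℝ → ℝ, MKdV.IsSolution μ σ s b T u₀ u ∧
              (∀ v : ℝ → ℝ → ℝ, MKdV.IsSolution μ σ s b T u₀ v → Set.EqOn v u (Set.Icc (-T) T)) ∧
              ∀ t ∈ Set.Icc (-T) T,
                MKdV.ExtendsToStrip σ (u t)) ∧
            -- on a ball around the datum, the data-to-solution map is defined and Lipschitz
            ∃ δ : ℝ≥0, 0 < δ ∧ ∃ L : ℝ≥0,
              (∀ v₀ : ℝ → ℝ, MKdV.MemGevrey σ s v₀ → MKdV.gevreyENorm σ s (v₀ - u₀) < δ →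
                ∃ v : ℝ → ℝ → ℝ, MKdV.IsSolution μ σ s b T v₀ v) ∧
              ∀ v₀ w₀ : ℝ → ℝ, MKdV.MemGevrey σ s v₀ → MKdV.MemGevrey σ s w₀ →
                MKdV.gevreyENorm σ s (v₀ - u₀) < δ → MKdV.gevreyENorm σ s (w₀ - u₀) < δ →
                ∀ v w : ℝ → ℝ → ℝ,
                  MKdV.IsSolution μ σ s b T v₀ v →
                  MKdV.IsSolution μ σ s b T w₀ w →
                  (∀ t ∈ Set.Icc (-T) T,
                    MKdV.gevreyENorm σ s (v t - w t) ≤ L * MKdV.gevreyENorm σ s (v₀ - w₀)) ∧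
                  MKdV.restrictedENorm σ s b T (v - w) ≤
                    L * MKdV.gevreyENorm σ s (v₀ - w₀) := by

  obtain ⟨A, T₀, hT₀, hA⟩ := MKdV.exists_real_amplitude
  obtain ⟨C, hC⟩ := MKdV.exists_gevreyENorm_solution_sub_le
  -- The time is taken for size R + 1, so that all data within distance 1 of `u₀` share the same
  -- interval.
  refine ⟨9 / 16, by norm_num, by norm_num, fun s hs => ⟨fun R => T₀ (R + 1), fun R => (hT₀ _).1,
    fun μ hμ σ hσ u₀ hu₀ T hT => ?_⟩⟩
  obtain ⟨R, hR⟩ : ∃ R, R = (MKdV.gevreyENorm σ s u₀).toNNReal + 1 := ⟨_, rfl⟩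
  replace hT : T = T₀ R := by rw [hT, hR]
  have hT0 : 0 < T := hT ▸ (hT₀ R).1
  have hs0 : 0 ≤ s := by linarith
  have hA' := hA σ s μ hσ hs hμ R
  rw [← hT] at hA'
  have hRe : (R : ℝ≥0∞) = MKdV.gevreyENorm σ s u₀ + 1 := by
    rw [hR, ENNReal.coe_add, ENNReal.coe_toNNReal hu₀.ne, ENNReal.coe_one]
  have hball : ∀ v₀ : ℝ → ℝ, MKdV.MemGevrey σ s v₀ → MKdV.gevreyENorm σ s (v₀ - u₀) < (1 : ℝ≥0) →
      MKdV.gevreyENorm σ s v₀ ≤ R := fun v₀ hv₀ hv => by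
    rw [hRe, add_comm]
    exact (MKdV.gevreyENorm_le_add hv₀ hu₀).trans (add_le_add hv.le le_rfl)
  -- The radius is the 1 added to the size of the datum; `L` is the sum of the constants for the two
  -- norms.
  refine ⟨?_, 1, one_pos, C * A + 7 * A, fun v₀ hv₀ hv => ?_, fun v₀ w₀ hv₀ hw₀ hvb hwb v w hv hw => ?_⟩
  · obtain ⟨F, hF, hFr, -⟩ := hA' u₀ hu₀ (hRe ▸ le_self_add)
    exact ⟨_, hF, fun v hv => hv.eqOn hμ hσ hs0 hT0 hF, fun t _ => hFr.extendsToStrip hσ hs0 t⟩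
  · obtain ⟨F, hF, -⟩ := hA' v₀ hv₀ (hball v₀ hv₀ hv)
    exact ⟨_, hF⟩
  · obtain ⟨F, hF, hFr, h⟩ := hA' v₀ hv₀ (hball v₀ hv₀ hvb)
    obtain ⟨F', hF', hFr', hle⟩ := h w₀ hw₀ (hball w₀ hw₀ hwb)
    -- Arbitrary solutions are replaced by the constructed ones through uniqueness, and the bounds
    -- for amplitudes apply.
    have ev := hv.eqOn hμ hσ hs0 hT0 hF
    have ew := hw.eqOn hμ hσ hs0 hT0 hF'
    constructor
    · intro t ht
      rw [ev ht, ew ht]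
      calc _ ≤ C * (A * MKdV.gevreyENorm σ s (v₀ - w₀)) :=
            (hC σ s hσ hs0 F F' hFr hFr' t).trans (mul_le_mul' le_rfl hle)
        _ = (C * A : ℝ≥0) * MKdV.gevreyENorm σ s (v₀ - w₀) := by rw [ENNReal.coe_mul, mul_assoc]
        _ ≤ _ := by
          refine mul_le_mul' (ENNReal.coe_le_coe.2 le_self_add) le_rfl
    · have e : Set.EqOn (v - w) (MKdV.solution F - MKdV.solution F') (Set.Ioo (-T) T) := fun t ht => by
        rw [Pi.sub_apply, Pi.sub_apply, ev (Ioo_subset_Icc_self ht), ew (Ioo_subset_Icc_self ht)]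
      rw [MKdV.restrictedENorm_congr e]
      calc _ ≤ 7 * (A * MKdV.gevreyENorm σ s (v₀ - w₀)) :=
            (hFr.restrictedENorm_sub_le hFr' hσ hs0 T).trans (mul_le_mul' le_rfl hle)
        _ = (7 * A : ℝ≥0) * MKdV.gevreyENorm σ s (v₀ - w₀) := by
          rw [ENNReal.coe_mul, mul_assoc]; rfl
        _ ≤ _ := by
          refine mul_le_mul' (ENNReal.coe_le_coe.2 le_add_self) le_rfl
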